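/- Let $\alpha,\beta>0$ and $w^*\in(0,1)$, and let $W,(W_i)_{i\ge 1}$ be i.i.d. random variables with the law of a Beta$(\alpha,\beta)$ variable conditioned to be at least $w^*$, that is, $$\mathbb P(W\ge x)=Z_{w^*}\int_x^1\frac{\Gamma(\alpha+\beta)}{\Gamma(\alpha)\Gamma(\beta)}s^{\alpha-1}(1-s)^{\beta-1}\,\mathrm ds,\qquad x\in[w^*,1),$$ where $Z_{w^*}$ is such that $\mathbb P(W\ge w^*)=1$. Put $\theta:=1+\mathbb E[W]$. The weighted recursive tree with these weights is the following growing random tree. Start with a single vertex, labelled $1$; for each $n\ge 1$ add a vertex labelled $n+1$ which, conditionally on the weights and on the connections of the earlier vertices, connects to vertex $i\in\{1,\dots,n\}$ with probability $W_i/\sum_{j=1}^nW_j$. Edges are directed from the new vertex to the old one. Let $\mathcal Z_n(i)$ denote the in-degree of vertex $i$ in the tree with vertex set $[n]=\{1,\dots,n\}$. Fix an integer $k\ge1$ and $c\in(0,\theta/(\theta-1))$. Let $d_i=d_i(n)$, $i\in[k]$, be integer-valued sequences with $d_i(n)\to\infty$ as $n\to\infty$ and $d_i(n)\le c\log n$ for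 all $i\in[k]$ and all sufficiently large $n$. For $n\ge k$ let $v_1,\dots,v_k$ be $k$ distinct vertices selected uniformly at random without replacement from $[n]$, independently of the weights and of the tree. Then, for all $n$ sufficiently large, the event $\{\mathcal Z_n(v_i)\ge d_i \text{ for all } i\in[k]\}$ has positive probability, and, conditionally on this event, the tuple $$\Big(\frac{\log v_i-(\log n-(1-\theta^{-1})d_i)}{\sqrt{(1-\theta^{-1})^2d_i}}\Big)_{i\in[k]}$$ converges in distribution, as $n\to\infty$, to $(M_i)_{i\in[k]}$, where $M_1,\dots,M_k$ are independent standard normal random variables. -/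

import Mathlib

open MeasureTheory ProbabilityTheory Filter
open scoped Topology BoundedContinuousFunction

/-- The Beta distribution with parameters `α`, `β`, conditioned on `[w, ∞)`: its tail is
`x ↦ Z * ∫ s in x..1, Γ(α+β)/(Γ(α)Γ(β)) * s^(α-1) * (1-s)^(β-1)` on `[w, 1)`, where `Z`
normalises the value at `x = w` to one. -/
noncomputable def truncatedBeta (α β w : ℝ) : Measure ℝ :=
  cond (betaMeasure α β) (Set.Ici w)

/-- `θ = 1 + E[W]` for weights `W` with law `ν`. -/
noncomputable def thetaOf (ν : Measure ℝ) : ℝ := 1 + ∫ x, x ∂ν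

namespace WRT

/-! Vertices are indexed from zero: the natural number `i` stands for the vertex with label
`i + 1`, so that the vertices of the `n`-th tree are `0, …, n - 1`. The root is `0`; for `n ≥ 1`
the random variable `parent n` is the vertex to which the new vertex `n` is connected
(`parent 0` is a dummy that is never used). -/

variable {Ω : Type*}

/-- The information available when vertex `n` chooses its parent: all the weights, and the
choices made by the earlier vertices `1, …, n - 1`. -/
abbrev history (W : ℕ → Ω → ℝ) (parent : ℕ → Ω → ℕ) (n : ℕ) : MeasurableSpace Ω :=
  (⨆ i, MeasurableSpace.comap (W i) inferInstance) ⊔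
    ⨆ j ∈ Finset.Ico 1 n, MeasurableSpace.comap (parent j) inferInstance

/-- `(W, parent)` is a weighted recursive tree with i.i.d. vertex-weights of law `ν`: given the
weights and the earlier choices, the vertex `n ≥ 1` is connected to the vertex `i < n` with
probability `W i / (W 0 + ⋯ + W (n - 1))`. -/
structure IsWeightedRecursiveTree [MeasurableSpace Ω] (P : Measure Ω) (ν : Measure ℝ)
    (W : ℕ → Ω → ℝ) (parent : ℕ → Ω → ℕ) : Prop where
  measurable_weight : ∀ i, Measurable (W i)
  weight_law : ∀ i, P.map (W i) = ν
  weight_indep : iIndepFun W P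
  measurable_parent : ∀ n, 1 ≤ n → Measurable (parent n)
  parent_condProb : ∀ n, 1 ≤ n → ∀ i < n,
    P⟦parent n ⁻¹' {i} | history W parent n⟧
      =ᵐ[P] fun ω => W i ω / ∑ j ∈ Finset.range n, W j ω

/-- In-degree of the vertex `i` in the tree with vertices `0, …, n - 1`. -/
def inDegree (parent : ℕ → Ω → ℕ) (n i : ℕ) (ω : Ω) : ℕ :=
  ((Finset.Ico 1 n).filter fun j => parent j ω = i).card

/-- `v 0, …, v (k - 1)` are selected uniformly at random without replacement from the vertices
`0, …, n - 1`, independently of the weights and the tree. -/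
structure IsUniformSample [MeasurableSpace Ω] (P : Measure Ω) (W : ℕ → Ω → ℝ)
    (parent : ℕ → Ω → ℕ) (n k : ℕ) (v : Fin k → Ω → ℕ) : Prop where
  measurable : ∀ i, Measurable (v i)
  uniform : ∀ a : Fin k ↪ Fin n,
    P {ω | ∀ i, v i ω = (a i : ℕ)} = 1 / (n.descFactorial k : ENNReal)
  indep : Indep (⨆ i, MeasurableSpace.comap (v i) inferInstance)
    (⨆ m, history W parent m) P

/-- The event that the in-degree of `v i` in the `n`-th tree is at least `d i`, for all `i`. -/
def degreeEvent (parent : ℕ → Ω → ℕ) (n : ℕ) {k : ℕ} (v : Fin k → Ω → ℕ) (d : Fin k → ℤ) :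
    Set Ω :=
  {ω | ∀ i, d i ≤ (inDegree parent n (v i ω) ω : ℤ)}

/-- The rescaled labels `(log (label of v i) - (log n - (1 - θ⁻¹) d i)) / √((1 - θ⁻¹)² d i)`. -/
noncomputable def rescaledLabels (θ : ℝ) (n : ℕ) {k : ℕ} (v : Fin k → Ω → ℕ) (d : Fin k → ℤ)
    (ω : Ω) : Fin k → ℝ := fun i =>
  (Real.log ((v i ω : ℝ) + 1) - (Real.log n - (1 - θ⁻¹) * (d i : ℝ))) /
    Real.sqrt ((1 - θ⁻¹) ^ 2 * (d i : ℝ))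

end WRT

/-! Write `X` for a weight, `μ` for its mean, so `θ = 1 + μ`, and `T = log (n / v)` for a sampled
vertex `v`. Given the weights, vertex `a` receives an edge at step `m > a` with probability `W a / S
m`, where the partial sum `S m` is close to `μ m`. Its in-degree is therefore nearly Poisson of mean
`(W a / μ) log (n / a)`. Since `v` is uniform, `T` is nearly standard exponential. The limiting
picture is a Poisson process of rate `X / μ` run up to an independent exponential time `T`,
conditioned to have at least `d` points.

This picture is explicit. Fubini turns `∫ exp (-z t) P(at least d points by time t) dt` into `z⁻¹
E[(X / (X + μ z)) ^ d]` (`poissonTail.integral_cexp_mul`, `mixedTail.integral_cexp_mul`); at `z = 1`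
this is the probability of the conditioning event. The bias `(X / (X + μ)) ^ d` pushes `X` to the
top of its range. Because the weight law has at least polynomial mass near one, the biased mean of
`1 - X` is `o (d ^ (-1/2))` (`tendsto_sqrt_mul_tilted_deficit`), so `X` may be replaced by one. What
remains is the transform of a sum of `d` independent exponentials of mean `μ / (1 + μ) = 1 - θ⁻¹`,
and the central limit theorem gives the centring and the scaling for `log v = log n - T`
(`tendsto_charFun_mixedTail`).

The conditioning event may be as rare as a power of `1 / n`, so the comparison of tree and picture
needs relative errors. With `η = n ^ (-ε/4)` and `L` about `n ^ ε`, Hoeffding's inequality puts all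
sums `S m`, `L ≤ m < n`, within a factor `1 ± η` of `μ m`, except with a stretched-exponentially
small probability. A relative error `η` in the Poisson mean costs a factor of the form `(1 + O(η)) ^
d`, which tends to one since `d = O(log n)`. Several vertices compete for each edge: the joint tail
is at most the product of the marginal tails (`jointTail.le_prod_bernoulliTail`), and it falls short
of the Poisson product by a relative error of order `∑ m ^ (-2)` over `m ≥ L`, that is `1 / L`
(`jointTail.prod_poissonTail_sub_le`).

Labels below `L` are discarded by a Chernoff bound with parameter `s`; a suitable `s` exists exactly
because `c < θ / (θ - 1)` leaves room for it (`exists_chernoff_rate`). A pointwise lower bound and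
an upper bound on the total then yield convergence in total variation to a product law
(`sum_abs_sub_le`, `tendsto_sum_abs_sub_prod_cellWeight`). Independence of the limits comes from
that product, and Lévy's theorem finishes the proof. -/

/-- The probability that a Poisson variable of mean `t` is at least `d`. -/
noncomputable def poissonTail (t : ℝ) (d : ℕ) : ℝ :=
  1 - Real.exp (-t) * ∑ m ∈ Finset.range d, t ^ m / (m.factorial : ℝ)

/-! ### Poisson tails as functions of the mean -/

namespace poissonTail

@[simp] lemma zero_right (t : ℝ) : poissonTail t 0 = 1 := by simp [poissonTail]

lemma zero_left (d : ℕ) (hd : d ≠ 0) : poissonTail 0 d = 0 := by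
  obtain ⟨d, rfl⟩ := Nat.exists_eq_succ_of_ne_zero hd
  simp [poissonTail, Finset.sum_range_succ']

lemma succ_right (t : ℝ) (d : ℕ) :
    poissonTail t (d + 1) = poissonTail t d - Real.exp (-t) * (t ^ d / (d.factorial : ℝ)) := by
  simp only [poissonTail, Finset.sum_range_succ]; ring

/-- As the mean grows, the tail grows at the rate given by the point mass at `d - 1`. Truncated
subtraction makes this valid for `d = 0` too, where both terms cancel; the same convention `d - 1 =
0` serves all the recursions below. -/
lemma hasDerivAt (d : ℕ) (t : ℝ) :
    HasDerivAt (fun s => poissonTail s d) (poissonTail t (d - 1) - poissonTail t d) t := by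
  induction d with
  | zero => simpa using hasDerivAt_const t (1 : ℝ)
  | succ d ih =>
    have h1 : HasDerivAt (fun s : ℝ => Real.exp (-s)) (-Real.exp (-t)) t := by
      simpa using (hasDerivAt_neg t).exp
    have h2 : HasDerivAt (fun s : ℝ => s ^ d / (d.factorial : ℝ))
        ((d : ℝ) * t ^ (d - 1) / (d.factorial : ℝ)) t := by
      simpa using (hasDerivAt_pow d t).div_const (d.factorial : ℝ)
    have h3 := ih.sub (h1.mul h2)
    have h4 : (fun s => poissonTail s (d + 1)) =
        ((fun s => poissonTail s d) - (fun s : ℝ => Real.exp (-s)) *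
          fun s : ℝ => s ^ d / (d.factorial : ℝ)) := by
      funext s; simp [succ_right]
    rw [h4]
    convert! h3 using 1
    rw [Nat.add_sub_cancel, succ_right]
    cases d with
    | zero => simp
    | succ d =>
      rw [succ_right, Nat.factorial_succ]
      push_cast
      have : (d.factorial : ℝ) ≠ 0 := by positivity
      have : (d : ℝ) + 1 ≠ 0 := by positivity
      field_simp
      ring

lemma continuous (d : ℕ) : Continuous fun t => poissonTail t d := by
  unfold poissonTail; fun_prop

lemma antitone_right {t : ℝ} (ht : 0 ≤ t) : Antitone (poissonTail t) := by
  refine antitone_nat_of_succ_le fun d => ?_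
  rw [succ_right]
  have : 0 ≤ Real.exp (-t) * (t ^ d / (d.factorial : ℝ)) := by positivity
  linarith

lemma le_pred {t : ℝ} (ht : 0 ≤ t) (d : ℕ) : poissonTail t d ≤ poissonTail t (d - 1) :=
  antitone_right ht (Nat.sub_le d 1)

lemma le_one {t : ℝ} (ht : 0 ≤ t) (d : ℕ) : poissonTail t d ≤ 1 := by
  simpa using antitone_right ht (Nat.zero_le d)

lemma monotoneOn_left (d : ℕ) : MonotoneOn (fun t => poissonTail t d) (Set.Ici 0) := by
  refine monotoneOn_of_hasDerivWithinAt_nonneg (convex_Ici 0) (continuous d).continuousOn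
    (fun t _ => (hasDerivAt d t).hasDerivWithinAt) fun t ht => ?_
  rw [interior_Ici] at ht
  exact sub_nonneg.2 (le_pred (le_of_lt ht) d)

lemma mono_left {s t : ℝ} (hs : 0 ≤ s) (hst : s ≤ t) (d : ℕ) :
    poissonTail s d ≤ poissonTail t d :=
  monotoneOn_left d (Set.mem_Ici.2 hs) (Set.mem_Ici.2 (hs.trans hst)) hst

lemma nonneg {t : ℝ} (ht : 0 ≤ t) (d : ℕ) : 0 ≤ poissonTail t d := by
  refine le_trans ?_ (mono_left le_rfl ht d)
  rcases eq_or_ne d 0 with rfl | hd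
  · simp
  · rw [zero_left d hd]

/-- Adding a Bernoulli variable of parameter `p` is dominated by adding a Poisson variable of
mean `q` when `p ≤ 1 - exp (-q)`. -/
lemma bernoulli_step_le {t p q : ℝ} (ht : 0 ≤ t) (hq : 0 ≤ q) (hp : p ≤ 1 - Real.exp (-q))
    (d : ℕ) : (1 - p) * poissonTail t d + p * poissonTail t (d - 1) ≤ poissonTail (t + q) d := by
  -- With `exp s` as integrating factor, comparing `s = 0` and `s = q` gives the inequality for `p =
  -- 1 - exp (-q)`. Smaller `p` follows because the left side increases with `p`.
  have hmono : MonotoneOn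
      (fun s => Real.exp s * (poissonTail (t + s) d - poissonTail t (d - 1))) (Set.Ici 0) := by
    refine monotoneOn_of_hasDerivWithinAt_nonneg (f' := fun s => Real.exp s *
      (poissonTail (t + s) (d - 1) - poissonTail t (d - 1))) (convex_Ici 0) ?_ (fun s _ => ?_)
      fun s hs => ?_
    · have := continuous d
      fun_prop
    · have h := (hasDerivAt d (t + s)).comp_const_add t s
      have := (Real.hasDerivAt_exp s).mul (h.sub_const (poissonTail t (d - 1)))
      refine HasDerivAt.hasDerivWithinAt ?_
      convert! this using 1
      ring
    · rw [interior_Ici] at hs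
      have := mono_left ht (by linarith [Set.mem_Ioi.1 hs] : t ≤ t + s) (d - 1)
      have := Real.exp_pos s
      nlinarith
  have h := hmono (Set.mem_Ici.2 le_rfl) (Set.mem_Ici.2 hq) hq
  simp only [Real.exp_zero, add_zero, one_mul] at h
  have h1 := mul_le_mul_of_nonneg_left h (Real.exp_pos (-q)).le
  rw [← mul_assoc, ← Real.exp_add, neg_add_cancel, Real.exp_zero, one_mul] at h1
  have h2 := le_pred ht d
  nlinarith

/-- Mean value theorem, with the two tails in the slope bounded at opposite ends of the interval.
Applied at levels `d` and `d - 1` it gives the second-order bound, whence the level `d - 2` in all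
later error terms. -/
lemma sub_le_mul {t q : ℝ} (ht : 0 ≤ t) (hq : 0 ≤ q) (d : ℕ) :
    poissonTail (t + q) d - poissonTail t d
      ≤ q * (poissonTail (t + q) (d - 1) - poissonTail t d) := by
  rcases hq.eq_or_lt with rfl | hq
  · simp
  obtain ⟨x, hx, hxe⟩ := exists_hasDerivAt_eq_slope (fun s => poissonTail s d)
    (fun s => poissonTail s (d - 1) - poissonTail s d) (by linarith : t < t + q)
    (continuous d).continuousOn (fun x _ => hasDerivAt d x)
  rw [add_sub_cancel_left, eq_div_iff hq.ne'] at hxe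
  have h1 := mono_left (ht.trans hx.1.le) hx.2.le (d - 1)
  have h2 := mono_left ht hx.1.le d
  nlinarith

/-- Second-order upper bound in the mean. -/
lemma add_le_taylor {t q : ℝ} (ht : 0 ≤ t) (hq : 0 ≤ q) (d : ℕ) :
    poissonTail (t + q) d ≤ poissonTail t d + q * (poissonTail t (d - 1) - poissonTail t d)
      + q ^ 2 * poissonTail (t + q) (d - 2) := by
  have h1 := sub_le_mul ht hq d
  have h2 := sub_le_mul ht hq (d - 1)
  have h3 := nonneg ht (d - 1)
  have h4 : d - 1 - 1 = d - 2 := by omega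
  rw [h4] at h2
  nlinarith [mul_nonneg hq h3, mul_nonneg hq (mul_nonneg hq h3)]

/-- Compare derivatives in `t`: rescaling the mean multiplies the Gamma density by `c ^ d` and makes
its exponential factor smaller. A relative error in the mean thus costs only a factor to the power
`d`, however rare the event is. -/
lemma mul_left_le {t c : ℝ} (ht : 0 ≤ t) (hc : 1 ≤ c) (d : ℕ) :
    poissonTail (c * t) d ≤ c ^ d * poissonTail t d := by
  cases d with
  | zero => simp
  | succ d =>
    have hder : ∀ s, HasDerivAt (fun s => poissonTail s (d + 1))
        (Real.exp (-s) * (s ^ d / (d.factorial : ℝ))) s := fun s => by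
      have := hasDerivAt (d + 1) s
      rwa [Nat.add_sub_cancel, succ_right, sub_sub_cancel] at this
    have hmono : MonotoneOn (fun s => c ^ (d + 1) * poissonTail s (d + 1) -
        poissonTail (c * s) (d + 1)) (Set.Ici 0) := by
      refine monotoneOn_of_hasDerivWithinAt_nonneg (f' := fun s => c ^ (d + 1) * 
        (Real.exp (-s) * (s ^ d / (d.factorial : ℝ))) -
        (Real.exp (-(c * s)) * ((c * s) ^ d / (d.factorial : ℝ))) * c) (convex_Ici 0) ?_
        (fun s _ => ?_) fun s hs => ?_
      · have := continuous (d + 1)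
        fun_prop
      · have h1 := (hder s).const_mul (c ^ (d + 1))
        have h2 := (hder (c * s)).comp s (by simpa using (hasDerivAt_id s).const_mul c)
        exact (h1.sub h2).hasDerivWithinAt
      · rw [interior_Ici] at hs
        have hs : 0 < s := hs
        have h1 : Real.exp (-(c * s)) ≤ Real.exp (-s) := Real.exp_le_exp.2 (by nlinarith)
        have h2 : 0 ≤ c ^ (d + 1) * (s ^ d / (d.factorial : ℝ)) := by positivity
        have := mul_le_mul_of_nonneg_left h1 h2
        calc (0 : ℝ) ≤ c ^ (d + 1) * (s ^ d / (d.factorial : ℝ)) * Real.exp (-s)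
              - c ^ (d + 1) * (s ^ d / (d.factorial : ℝ)) * Real.exp (-(c * s)) := by linarith
          _ = _ := by ring
    have h := hmono (Set.mem_Ici.2 le_rfl) (Set.mem_Ici.2 ht) ht
    simp only [mul_zero, zero_left (d + 1) (by simp), sub_self] at h
    linarith

/-- The Chernoff bound, as `exp ((s - 1) * t)` is the generating function of a Poisson variable at
`s`. The proof integrates the bound at level `d` to reach level `d + 1`. -/
lemma pow_mul_le_exp {s t : ℝ} (hs : 1 ≤ s) (ht : 0 ≤ t) (d : ℕ) :
    s ^ d * poissonTail t d ≤ Real.exp ((s - 1) * t) := by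
  induction d generalizing t with
  | zero =>
    simpa using mul_nonneg (sub_nonneg.2 hs) ht
  | succ d ih =>
    have hmono : MonotoneOn (fun x => Real.exp (s * x) - s ^ (d + 1) * 
        (Real.exp x * poissonTail x (d + 1))) (Set.Ici 0) := by
      refine monotoneOn_of_hasDerivWithinAt_nonneg (f' := fun x => Real.exp (s * x) * s -
        s ^ (d + 1) * (Real.exp x * poissonTail x d)) (convex_Ici 0) ?_
        (fun x _ => ?_) fun x hx => ?_
      · have := continuous (d + 1)
        fun_prop
      · have h1 : HasDerivAt (fun x => Real.exp (s * x)) (Real.exp (s * x) * s) x :=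
          (by simpa using (hasDerivAt_id x).const_mul s : HasDerivAt (fun x => s * x) s x).exp
        have h2 := ((Real.hasDerivAt_exp x).mul (hasDerivAt (d + 1) x)).const_mul (s ^ (d + 1))
        refine HasDerivAt.hasDerivWithinAt ?_
        convert! h1.sub h2 using 1
        rw [Nat.add_sub_cancel]
        ring
      · rw [interior_Ici] at hx
        have h := ih (le_of_lt (Set.mem_Ioi.1 hx))
        have h1 := mul_le_mul_of_nonneg_left h
          (mul_nonneg (by linarith : (0:ℝ) ≤ s) (Real.exp_pos x).le)
        rw [mul_assoc s (Real.exp x) (Real.exp _), ← Real.exp_add,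
          show x + (s - 1) * x = s * x by ring] at h1
        have : s ^ (d + 1) * (Real.exp x * poissonTail x d) =
          s * Real.exp x * (s ^ d * poissonTail x d) := by ring
        rw [this]
        linarith
    have h := hmono (Set.mem_Ici.2 le_rfl) (Set.mem_Ici.2 ht) ht
    simp only [mul_zero, zero_left (d + 1) (by simp), Real.exp_zero, sub_zero] at h
    have h1 : s ^ (d + 1) * (Real.exp t * poissonTail t (d + 1)) ≤ Real.exp (s * t) := by linarith
    have h2 := mul_le_mul_of_nonneg_left h1 (Real.exp_pos (-t)).le
    rw [← Real.exp_add] at h2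
    calc s ^ (d + 1) * poissonTail t (d + 1)
        = Real.exp (-t) * Real.exp t * (s ^ (d + 1) * poissonTail t (d + 1)) := by
          rw [← Real.exp_add]; simp
      _ = Real.exp (-t) * (s ^ (d + 1) * (Real.exp t * poissonTail t (d + 1))) := by ring
      _ ≤ _ := h2
      _ = _ := by ring_nf

lemma integrableOn_cexp_mul {z : ℂ} (hz : 0 < z.re) {c : ℝ} (hc : 0 ≤ c) (d : ℕ) :
    IntegrableOn (fun t : ℝ => Complex.exp (-z * t) * (poissonTail (c * t) d : ℂ))
      (Set.Ioi 0) := by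
  refine Integrable.mono' (g := fun t : ℝ => Real.exp (-z.re * t)) ?_ ?_ ?_
  · exact integrableOn_exp_mul_Ioi (by linarith) 0
  · refine Continuous.aestronglyMeasurable ?_
    have := continuous d
    fun_prop
  · refine (ae_restrict_iff' measurableSet_Ioi).2 (Eventually.of_forall fun t ht => ?_)
    have ht : 0 < t := ht
    rw [norm_mul, Complex.norm_exp, Complex.norm_real, Real.norm_eq_abs,
      abs_of_nonneg (nonneg (mul_nonneg hc ht.le) d)]
    have h1 : (-z * (t : ℂ)).re = -z.re * t := by simp
    rw [h1]
    exact mul_le_of_le_one_right (Real.exp_pos _).le (le_one (mul_nonneg hc ht.le) d)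

/-- Laplace transform of the Poisson tail in its mean. -/
lemma integral_cexp_mul {z : ℂ} (hz : 0 < z.re) {c : ℝ} (hc : 0 ≤ c) (d : ℕ) :
    ∫ t in Set.Ioi (0 : ℝ), Complex.exp (-z * t) * (poissonTail (c * t) d : ℂ)
      = z⁻¹ * (c / (c + z)) ^ d := by
  have hz0 : z ≠ 0 := fun h => by simp [h] at hz
  have hcz : (c : ℂ) + z ≠ 0 := fun h => by
    have := congrArg Complex.re h
    simp at this
    linarith
  induction d with
  | zero =>
    simp only [zero_right, Complex.ofReal_one, mul_one, pow_zero]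
    rw [integral_exp_mul_complex_Ioi (by simpa using hz) 0]
    simp
  | succ d ih =>
    have hI := integrableOn_cexp_mul hz hc d
    have hI' := integrableOn_cexp_mul hz hc (d + 1)
    have hder : ∀ t : ℝ, HasDerivAt
        (fun t : ℝ => Complex.exp (-z * t) * (poissonTail (c * t) (d + 1) : ℂ))
        ((c : ℂ) * (Complex.exp (-z * t) * (poissonTail (c * t) d : ℂ)) -
          (c + z) * (Complex.exp (-z * t) * (poissonTail (c * t) (d + 1) : ℂ))) t := by
      intro t
      have h1 : HasDerivAt (fun t : ℝ => Complex.exp (-z * t)) (Complex.exp (-z * t) * -z) t := by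
        have : HasDerivAt (fun t : ℝ => -z * (t : ℂ)) (-z) t := by
          simpa using (Complex.ofRealCLM.hasDerivAt (x := t)).const_mul (-z)
        exact this.cexp
      have h2 : HasDerivAt (fun t : ℝ => poissonTail (c * t) (d + 1))
          ((poissonTail (c * t) d - poissonTail (c * t) (d + 1)) * c) t :=
        (hasDerivAt (d + 1) (c * t)).comp t (by simpa using (hasDerivAt_id t).const_mul c)
      have h3 := h1.mul h2.ofReal_comp
      convert! h3 using 1
      push_cast
      ring
    have hlim : Tendsto (fun t : ℝ => Complex.exp (-z * t) * (poissonTail (c * t) (d + 1) : ℂ))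
        atTop (𝓝 0) := by
      rw [tendsto_zero_iff_norm_tendsto_zero]
      have h0 : Tendsto (fun t : ℝ => Real.exp (-z.re * t)) atTop (𝓝 0) :=
        Real.tendsto_exp_atBot.comp (tendsto_id.const_mul_atTop_of_neg (by linarith))
      refine squeeze_zero' (Eventually.of_forall fun t => norm_nonneg _) ?_ h0
      filter_upwards [eventually_ge_atTop 0] with t ht
      rw [norm_mul, Complex.norm_exp, Complex.norm_real, Real.norm_eq_abs,
        abs_of_nonneg (nonneg (mul_nonneg hc ht) _)]
      have h1 : (-z * (t : ℂ)).re = -z.re * t := by simp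
      rw [h1]
      exact mul_le_of_le_one_right (Real.exp_pos _).le (le_one (mul_nonneg hc ht) _)
    -- Both boundary terms vanish, so the integrals at levels `d` and `d + 1` have ratio `c / (c +
    -- z)`.
    have h := integral_Ioi_of_hasDerivAt_of_tendsto' (a := 0) (fun t _ => hder t)
      ((hI.const_mul _).sub (hI'.const_mul _)) hlim
    rw [integral_sub (hI.const_mul _) (hI'.const_mul _), integral_const_mul, integral_const_mul,
      ih] at h
    simp only [mul_zero, zero_left (d + 1) (by simp), Complex.ofReal_zero, sub_zero] at h
    have h5 := (eq_div_iff hcz).2 ((mul_comm _ _).trans (sub_eq_zero.1 h).symm)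
    rw [h5, pow_succ]
    field_simp

end poissonTail

/-! ### First-order expansion of finite products -/

section ProductExpansion

variable {ι : Type*} [DecidableEq ι]

lemma Finset.prod_add_sum_erase_insert (S : Finset ι) {a : ι} (ha : a ∉ S) (G D : ι → ℝ) :
    ∏ i ∈ insert a S, G i + ∑ i ∈ insert a S, D i * ∏ j ∈ (insert a S).erase i, G j
      = G a * (∏ i ∈ S, G i + ∑ i ∈ S, D i * ∏ j ∈ S.erase i, G j) + D a * ∏ i ∈ S, G i := by
  rw [Finset.prod_insert ha, Finset.sum_insert ha, Finset.erase_insert ha]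
  have : ∑ i ∈ S, D i * ∏ j ∈ (insert a S).erase i, G j
      = G a * ∑ i ∈ S, D i * ∏ j ∈ S.erase i, G j := by
    rw [Finset.mul_sum]
    refine Finset.sum_congr rfl fun i hi => ?_
    have hia : i ≠ a := fun h => ha (h ▸ hi)
    rw [Finset.erase_insert_of_ne hia.symm,
      Finset.prod_insert (fun h => ha (Finset.mem_of_mem_erase h))]
    ring
  rw [this]
  ring

/-- The left side is the part of the expanded product of degree at most one in `D`; the omitted
terms are nonnegative. -/
lemma Finset.prod_add_sum_erase_le (S : Finset ι) (G D : ι → ℝ)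
    (hG : ∀ i ∈ S, 0 ≤ G i) (hD : ∀ i ∈ S, 0 ≤ D i) :
    ∏ i ∈ S, G i + ∑ i ∈ S, D i * ∏ j ∈ S.erase i, G j ≤ ∏ i ∈ S, (G i + D i) := by
  induction S using Finset.induction_on with
  | empty => simp
  | insert a S ha ih =>
    rw [Finset.prod_add_sum_erase_insert S ha, Finset.prod_insert ha]
    have hG' : ∀ i ∈ S, 0 ≤ G i := fun i hi => hG i (Finset.mem_insert_of_mem hi)
    have hD' : ∀ i ∈ S, 0 ≤ D i := fun i hi => hD i (Finset.mem_insert_of_mem hi)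
    have ih := ih hG' hD'
    have h1 : ∏ i ∈ S, G i ≤ ∏ i ∈ S, (G i + D i) :=
      Finset.prod_le_prod hG' fun i hi => by linarith [hD' i hi]
    have hGa := hG a (Finset.mem_insert_self a S)
    have hDa := hD a (Finset.mem_insert_self a S)
    nlinarith

/-- Terms of order two or more in `p` are gathered into one error. A further factor is at most `2 *
Q a`, so it at most doubles the error already present; this doubling is the source of `2 ^ S.card`.
-/
lemma Finset.prod_le_prod_add_sum_erase (S : Finset ι) (p G D Q : ι → ℝ)
    (hp : ∀ i ∈ S, 0 ≤ p i) (hS : ∑ i ∈ S, p i ≤ 1)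
    (hG : ∀ i ∈ S, 0 ≤ G i) (hD : ∀ i ∈ S, 0 ≤ D i) (hQ : ∀ i ∈ S, G i + D i ≤ Q i) :
    ∏ i ∈ S, (G i + p i * D i + p i ^ 2 * Q i) ≤
      ∏ i ∈ S, G i + ∑ i ∈ S, p i * D i * ∏ j ∈ S.erase i, G j
        + 3 * (2 ^ S.card - 1) * (∑ i ∈ S, p i) ^ 2 * ∏ i ∈ S, Q i := by
  induction S using Finset.induction_on with
  | empty => simp
  | insert a S ha ih =>
    rw [Finset.prod_add_sum_erase_insert S ha G (fun i => p i * D i), Finset.prod_insert ha,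
      Finset.card_insert_of_notMem ha, Finset.prod_insert ha, Finset.sum_insert ha]
    rw [Finset.sum_insert ha] at hS
    have hp' : ∀ i ∈ S, 0 ≤ p i := fun i hi => hp i (Finset.mem_insert_of_mem hi)
    have hG' : ∀ i ∈ S, 0 ≤ G i := fun i hi => hG i (Finset.mem_insert_of_mem hi)
    have hD' : ∀ i ∈ S, 0 ≤ D i := fun i hi => hD i (Finset.mem_insert_of_mem hi)
    have hQ' : ∀ i ∈ S, G i + D i ≤ Q i := fun i hi => hQ i (Finset.mem_insert_of_mem hi)
    have hpa := hp a (Finset.mem_insert_self a S)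
    have hGa := hG a (Finset.mem_insert_self a S)
    have hDa := hD a (Finset.mem_insert_self a S)
    have hQa := hQ a (Finset.mem_insert_self a S)
    have hs0 : 0 ≤ ∑ i ∈ S, p i := Finset.sum_nonneg hp'
    have ih := ih hp' (by linarith) hG' hD' hQ'
    have hX0 : 0 ≤ ∏ i ∈ S, G i := Finset.prod_nonneg hG'
    have hXZ : ∏ i ∈ S, G i ≤ ∏ i ∈ S, Q i :=
      Finset.prod_le_prod hG' fun i hi => by linarith [hD' i hi, hQ' i hi]
    have hY : ∑ i ∈ S, p i * D i * ∏ j ∈ S.erase i, G j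
        ≤ (∑ i ∈ S, p i) * ∏ i ∈ S, Q i := by
      rw [Finset.sum_mul]
      refine Finset.sum_le_sum fun i hi => ?_
      rw [mul_assoc, ← Finset.mul_prod_erase S Q hi]
      refine mul_le_mul_of_nonneg_left ?_ (hp' i hi)
      refine mul_le_mul (by linarith [hG' i hi, hQ' i hi]) ?_ ?_ ?_
      · exact Finset.prod_le_prod (fun j hj => hG' j (Finset.mem_of_mem_erase hj))
          fun j hj => by
            have := Finset.mem_of_mem_erase hj
            linarith [hD' j this, hQ' j this]
      · exact Finset.prod_nonneg fun j hj => hG' j (Finset.mem_of_mem_erase hj)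
      · linarith [hG' i hi, hQ' i hi, hD' i hi]
    have hY0 : 0 ≤ ∑ i ∈ S, p i * D i * ∏ j ∈ S.erase i, G j :=
      Finset.sum_nonneg fun i hi => mul_nonneg (mul_nonneg (hp' i hi) (hD' i hi))
        (Finset.prod_nonneg fun j hj => hG' j (Finset.mem_of_mem_erase hj))
    have hc : (1 : ℝ) ≤ 2 ^ S.card := one_le_pow₀ (by norm_num)
    have hprod0 : 0 ≤ ∏ i ∈ S, (G i + p i * D i + p i ^ 2 * Q i) :=
      Finset.prod_nonneg fun i hi => by
        have h1 := hp' i hi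
        have h2 := hG' i hi
        have h3 := hD' i hi
        have h4 := hQ' i hi
        have : 0 ≤ Q i := by linarith
        positivity
    rw [pow_succ (2 : ℝ) S.card]
    generalize (∏ i ∈ S, (G i + p i * D i + p i ^ 2 * Q i)) = T at *
    generalize (∏ i ∈ S, G i) = X at *
    generalize (∏ i ∈ S, Q i) = Z at *
    generalize (∑ i ∈ S, p i * D i * ∏ j ∈ S.erase i, G j) = Y at *
    generalize (∑ i ∈ S, p i) = s at *
    generalize (2 : ℝ) ^ S.card = c at *
    generalize p a = x at *
    generalize G a = g at *
    generalize D a = y at *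
    generalize Q a = q at *
    have hZ0 : 0 ≤ Z := hX0.trans hXZ
    have hq0 : 0 ≤ q := by linarith
    have hx1 : x ≤ 1 := by linarith
    have hs1 : s ≤ 1 := by linarith
    have hgy : g + x * y ≤ q := by nlinarith
    have hZq : 0 ≤ Z * q := mul_nonneg hZ0 hq0
    have h1 : (g + x * y + x ^ 2 * q) * T ≤
        (g + x * y + x ^ 2 * q) * (X + Y + 3 * (c - 1) * s ^ 2 * Z) :=
      mul_le_mul_of_nonneg_left ih (by positivity)
    have h2 : x * y * Y ≤ x * s * (Z * q) := by
      have : y * Y ≤ q * (s * Z) := mul_le_mul (by linarith) hY hY0 hq0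
      nlinarith
    have h3 : x ^ 2 * q * (X + Y) ≤ 2 * x ^ 2 * (Z * q) := by
      have : X + Y ≤ 2 * Z := by nlinarith
      have := mul_le_mul_of_nonneg_left this (by positivity : 0 ≤ x ^ 2 * q)
      linarith
    have h4 : (g + x * y + x ^ 2 * q) * (3 * (c - 1) * s ^ 2 * Z) ≤
        2 * (3 * (c - 1) * s ^ 2) * (Z * q) := by
      have h5 : g + x * y + x ^ 2 * q ≤ 2 * q := by
        have := mul_le_of_le_one_left hq0 (pow_le_one₀ hpa hx1 : x ^ 2 ≤ 1)
        linarith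
      have h6 : 0 ≤ 3 * (c - 1) * s ^ 2 * Z := by
        have : 0 ≤ c - 1 := by linarith
        positivity
      have := mul_le_mul_of_nonneg_right h5 h6
      linarith
    have h7 : x * s + 2 * x ^ 2 + 2 * (3 * (c - 1) * s ^ 2) ≤ 3 * (c * 2 - 1) * (x + s) ^ 2 := by
      have h8 : 0 ≤ c - 1 := by linarith
      nlinarith [mul_nonneg h8 (mul_nonneg hpa hs0), mul_nonneg hpa hs0,
        mul_nonneg h8 (sq_nonneg x), sq_nonneg s, sq_nonneg x]
    have h9 := mul_le_mul_of_nonneg_right h7 hZq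
    linarith

end ProductExpansion

/-! ### Tail recursions for Bernoulli sums and for competing counters -/

section Recursions

/-- The probability that a sum of `m` independent Bernoulli variables with parameters
`q 0, …, q (m - 1)` is at least `d`. -/
noncomputable def bernoulliTail (q : ℕ → ℝ) : ℕ → ℕ → ℝ
  | 0, d => if d = 0 then 1 else 0
  | m + 1, d => (1 - q m) * bernoulliTail q m d + q m * bernoulliTail q m (d - 1)

namespace bernoulliTail

variable {q : ℕ → ℝ}

lemma nonneg_and_le_pred (hq0 : ∀ m, 0 ≤ q m) (hq1 : ∀ m, q m ≤ 1) (m d : ℕ) :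
    0 ≤ bernoulliTail q m d ∧ bernoulliTail q m d ≤ bernoulliTail q m (d - 1) := by
  induction m generalizing d with
  | zero =>
    simp only [bernoulliTail]
    constructor
    · split_ifs <;> simp
    · rcases eq_or_ne d 0 with rfl | hd
      · simp
      · rw [if_neg hd]
        split_ifs <;> simp
  | succ m ih =>
    simp only [bernoulliTail]
    have h0 := hq0 m
    have h1 := hq1 m
    have ha := ih d
    have hb := ih (d - 1)
    constructor
    · nlinarith
    · nlinarith

lemma le_pow_inv_mul_exp (hq0 : ∀ m, 0 ≤ q m) (hq1 : ∀ m, q m ≤ 1) {s : ℝ} (hs : 1 ≤ s)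
    (m d : ℕ) :
    s ^ d * bernoulliTail q m d ≤ Real.exp ((s - 1) * ∑ j ∈ Finset.range m, q j) := by
  induction m generalizing d with
  | zero =>
    simp only [bernoulliTail]
    split_ifs with h <;> simp [h]
  | succ m ih =>
    rw [Finset.sum_range_succ, mul_add, Real.exp_add]
    have hE := Real.exp_pos ((s - 1) * ∑ j ∈ Finset.range m, q j)
    have h0 := hq0 m
    have h1 := hq1 m
    have ha := ih d
    have hb := ih (d - 1)
    have hn := (nonneg_and_le_pred hq0 hq1 m (d - 1)).1
    have hc : s ^ d * bernoulliTail q m (d - 1) ≤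
        s * Real.exp ((s - 1) * ∑ j ∈ Finset.range m, q j) := by
      rcases Nat.eq_zero_or_pos d with rfl | hd
      · simp only [Nat.zero_sub, pow_zero, one_mul] at hb ⊢
        nlinarith
      · obtain ⟨d, rfl⟩ := Nat.exists_eq_succ_of_ne_zero hd.ne'
        simp only [Nat.succ_eq_add_one, Nat.add_sub_cancel] at hb ⊢
        rw [pow_succ]
        nlinarith
    have hd : 1 + (s - 1) * q m ≤ Real.exp ((s - 1) * q m) := by
      linarith [Real.add_one_le_exp ((s - 1) * q m)]
    simp only [bernoulliTail]
    calc s ^ d * ((1 - q m) * bernoulliTail q m d + q m * bernoulliTail q m (d - 1))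
        = (1 - q m) * (s ^ d * bernoulliTail q m d)
          + q m * (s ^ d * bernoulliTail q m (d - 1)) := by ring
      _ ≤ (1 - q m) * Real.exp ((s - 1) * ∑ j ∈ Finset.range m, q j)
          + q m * (s * Real.exp ((s - 1) * ∑ j ∈ Finset.range m, q j)) :=
          add_le_add (mul_le_mul_of_nonneg_left ha (by linarith))
            (mul_le_mul_of_nonneg_left hc h0)
      _ = Real.exp ((s - 1) * ∑ j ∈ Finset.range m, q j) * (1 + (s - 1) * q m) := by ring
      _ ≤ _ := mul_le_mul_of_nonneg_left hd hE.le

/-- Each Bernoulli step is dominated by a Poisson increment of mean `τ (m + 1) - τ m`, which is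
nonzero with probability at least `q m`. -/
lemma le_poissonTail (hq0 : ∀ m, 0 ≤ q m) (hq1 : ∀ m, q m ≤ 1) {τ : ℕ → ℝ} (hτ0 : 0 ≤ τ 0)
    (hτ : Monotone τ) {N : ℕ} (hqτ : ∀ m < N, q m ≤ 1 - Real.exp (-(τ (m + 1) - τ m)))
    {m : ℕ} (hm : m ≤ N) (d : ℕ) :
    bernoulliTail q m d ≤ poissonTail (τ m) d := by
  induction m generalizing d with
  | zero =>
    simp only [bernoulliTail]
    split_ifs with h
    · simp [h]
    · exact poissonTail.nonneg hτ0 d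
  | succ m ih =>
    have h0 : 0 ≤ τ m := hτ0.trans (hτ (Nat.zero_le m))
    have h := poissonTail.bernoulli_step_le h0 (sub_nonneg.2 (hτ (Nat.le_succ m))) (hqτ m hm) d
    rw [add_sub_cancel] at h
    refine le_trans ?_ h
    simp only [bernoulliTail]
    have hm' : m ≤ N := (Nat.le_succ m).trans hm
    exact add_le_add (mul_le_mul_of_nonneg_left (ih hm' d) (by linarith [hq1 m]))
      (mul_le_mul_of_nonneg_left (ih hm' (d - 1)) (hq0 m))

end bernoulliTail

variable {ι : Type*} [Fintype ι] [DecidableEq ι]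

/-- Joint tail of counters that start at zero: in step `m` the counter `i` alone increases by one
with probability `p m i`, and with the remaining probability nothing happens. -/
noncomputable def jointTail (p : ℕ → ι → ℝ) : ℕ → (ι → ℕ) → ℝ
  | 0, d => if d = 0 then 1 else 0
  | m + 1, d => (1 - ∑ i, p m i) * jointTail p m d
      + ∑ i, p m i * jointTail p m (Function.update d i (d i - 1))

namespace jointTail


/-- At most one counter moves per step, so the transition applied to a product of tails gives
precisely the first-order part of the product that independent counters would give. -/
lemma prod_step (p : ι → ℝ) (G : ι → ℕ → ℝ) (d : ι → ℕ) :
    (1 - ∑ i, p i) * ∏ i, G i (d i)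
      + ∑ i, p i * ∏ j, G j (Function.update d i (d i - 1) j)
      = ∏ i, G i (d i) + ∑ i, p i * (G i (d i - 1) - G i (d i)) *
          ∏ j ∈ Finset.univ.erase i, G j (d j) := by
  have h : ∀ i, ∏ j, G j (Function.update d i (d i - 1) j)
      = G i (d i - 1) * ∏ j ∈ Finset.univ.erase i, G j (d j) := fun i => by
    rw [← Finset.mul_prod_erase _ _ (Finset.mem_univ i), Function.update_self]
    congr 1
    exact Finset.prod_congr rfl fun j hj => by
      rw [Function.update_of_ne (Finset.ne_of_mem_erase hj)]
  have h' : ∀ i, ∏ j, G j (d j) = G i (d i) * ∏ j ∈ Finset.univ.erase i, G j (d j) := fun i =>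
    (Finset.mul_prod_erase _ (fun j => G j (d j)) (Finset.mem_univ i)).symm
  rw [sub_mul, one_mul, sub_add, Finset.sum_mul, ← Finset.sum_sub_distrib, sub_eq_add_neg,
    ← Finset.sum_neg_distrib]
  congr 1
  refine Finset.sum_congr rfl fun i _ => ?_
  rw [h i, h' i]
  ring

lemma prod_step_le (p : ι → ℝ) (hp : ∀ i, 0 ≤ p i) (G : ι → ℕ → ℝ) (d : ι → ℕ)
    (hG : ∀ i, 0 ≤ G i (d i)) (hG' : ∀ i, G i (d i) ≤ G i (d i - 1)) :
    (1 - ∑ i, p i) * ∏ i, G i (d i)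
      + ∑ i, p i * ∏ j, G j (Function.update d i (d i - 1) j)
      ≤ ∏ i, ((1 - p i) * G i (d i) + p i * G i (d i - 1)) := by
  rw [prod_step]
  refine (Finset.prod_add_sum_erase_le Finset.univ (fun i => G i (d i))
    (fun i => p i * (G i (d i - 1) - G i (d i))) (fun i _ => hG i)
    fun i _ => mul_nonneg (hp i) (sub_nonneg.2 (hG' i))).trans_eq ?_
  exact Finset.prod_congr rfl fun i _ => by ring

variable {p : ℕ → ι → ℝ}

/-- Negative dependence: independent counters could also move together, and those extra terms only
raise the joint tail. -/
lemma le_prod_bernoulliTail (hp0 : ∀ m i, 0 ≤ p m i) (hp1 : ∀ m, ∑ i, p m i ≤ 1)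
    (m : ℕ) (d : ι → ℕ) :
    jointTail p m d ≤ ∏ i, bernoulliTail (fun m => p m i) m (d i) := by
  have hpi : ∀ m i, p m i ≤ 1 := fun m i =>
    (Finset.single_le_sum (fun j _ => hp0 m j) (Finset.mem_univ i)).trans (hp1 m)
  induction m generalizing d with
  | zero =>
    simp only [jointTail, bernoulliTail]
    split_ifs with h
    · simp [h]
    · exact Finset.prod_nonneg fun i _ => by split_ifs <;> simp
  | succ m ih =>
    have hb := fun i => bernoulliTail.nonneg_and_le_pred (q := fun m => p m i)
      (fun m => hp0 m i) (fun m => hpi m i) m (d i)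
    refine le_trans ?_ (prod_step_le (p m) (hp0 m)
      (fun i => bernoulliTail (fun m => p m i) m) d (fun i => (hb i).1) fun i => (hb i).2)
    simp only [jointTail]
    exact add_le_add (mul_le_mul_of_nonneg_left (ih d) (by linarith [hp1 m]))
      (Finset.sum_le_sum fun i _ => mul_le_mul_of_nonneg_left (ih _) (hp0 m i))

/-- Comparison from below with independent Poisson variables; the error is governed by the
probability that two increments coincide. -/
lemma prod_poissonTail_sub_le (hp0 : ∀ m i, 0 ≤ p m i) (hp1 : ∀ m, ∑ i, p m i ≤ 1)
    {t τ : ι → ℕ → ℝ} {A : ℕ → ℝ} (ht0 : ∀ i, t i 0 = 0) (ht : ∀ i, Monotone (t i))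
    {N : ℕ} (htp : ∀ i, ∀ m < N, t i (m + 1) - t i m ≤ p m i)
    (hτ0 : ∀ i, τ i 0 = 0) (hτ : ∀ i, Monotone (τ i))
    (hpτ : ∀ i, ∀ m < N, p m i ≤ 1 - Real.exp (-(τ i (m + 1) - τ i m)))
    (hA0 : 0 ≤ A 0)
    (hA : ∀ m, A m + 3 * 2 ^ Fintype.card ι * (∑ i, p m i) ^ 2 ≤ A (m + 1))
    {m : ℕ} (hm : m ≤ N) (d : ι → ℕ) :
    ∏ i, poissonTail (t i m) (d i) - A m * ∏ i, poissonTail (τ i m) (d i - 2)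
      ≤ jointTail p m d := by
  have htn : ∀ i m, 0 ≤ t i m := fun i m => (ht0 i).symm.le.trans (ht i (Nat.zero_le m))
  have hτn : ∀ i m, 0 ≤ τ i m := fun i m => (hτ0 i).symm.le.trans (hτ i (Nat.zero_le m))
  have hAn : ∀ m, 0 ≤ A m := fun m => by
    induction m with
    | zero => exact hA0
    | succ m ih => exact (add_nonneg ih (by positivity)).trans (hA m)
  have htτ : ∀ i, ∀ m ≤ N, t i m ≤ τ i m := fun i m hm => by
    induction m with
    | zero => rw [ht0, hτ0]
    | succ m ih =>
      have ih := ih ((Nat.le_succ m).trans hm)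
      have h1 := htp i m hm
      have h2 := hpτ i m hm
      have h3 := Real.add_one_le_exp (-(τ i (m + 1) - τ i m))
      linarith
  induction m generalizing d with
  | zero =>
    simp only [jointTail, ht0, hτ0]
    split_ifs with h
    · subst h
      simpa using hA0
    · obtain ⟨i, hi⟩ := Function.ne_iff.1 h
      rw [Finset.prod_eq_zero (Finset.mem_univ i) (poissonTail.zero_left _ hi), zero_sub,
        neg_nonpos]
      exact mul_nonneg hA0 (Finset.prod_nonneg fun i _ => poissonTail.nonneg le_rfl _)
  | succ m ih =>
    have ih := fun d => ih ((Nat.le_succ m).trans hm) d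
    have hstep : jointTail p (m + 1) d ≥
        ((1 - ∑ i, p m i) * ∏ i, poissonTail (t i m) (d i)
          + ∑ i, p m i * ∏ j, poissonTail (t j m) (Function.update d i (d i - 1) j))
        - A m * ((1 - ∑ i, p m i) * ∏ i, poissonTail (τ i m) (d i - 2)
          + ∑ i, p m i * ∏ j, poissonTail (τ j m) (Function.update d i (d i - 1) j - 2)) := by
      simp only [jointTail]
      have h1 := mul_le_mul_of_nonneg_left (ih d) (by linarith [hp1 m] : 0 ≤ 1 - ∑ i, p m i)
      have h2 : ∑ i, p m i * (∏ j, poissonTail (t j m) (Function.update d i (d i - 1) j)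
          - A m * ∏ j, poissonTail (τ j m) (Function.update d i (d i - 1) j - 2)) ≤
          ∑ i, p m i * jointTail p m (Function.update d i (d i - 1)) :=
        Finset.sum_le_sum fun i _ => mul_le_mul_of_nonneg_left (ih _) (hp0 m i)
      have h3 : ∑ i, p m i * (∏ j, poissonTail (t j m) (Function.update d i (d i - 1) j)
          - A m * ∏ j, poissonTail (τ j m) (Function.update d i (d i - 1) j - 2)) =
          ∑ i, p m i * ∏ j, poissonTail (t j m) (Function.update d i (d i - 1) j)
          - A m * ∑ i, p m i *
            ∏ j, poissonTail (τ j m) (Function.update d i (d i - 1) j - 2) := by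
        rw [Finset.mul_sum, ← Finset.sum_sub_distrib]
        exact Finset.sum_congr rfl fun i _ => by ring
      rw [h3] at h2
      linarith
    -- The dominating Poisson product is a supersolution of the recursion, so an error multiplied by
    -- it can be carried from step to step.
    have hQ : (1 - ∑ i, p m i) * ∏ i, poissonTail (τ i m) (d i - 2)
          + ∑ i, p m i * ∏ j, poissonTail (τ j m) (Function.update d i (d i - 1) j - 2)
          ≤ ∏ i, poissonTail (τ i (m + 1)) (d i - 2) := by
      refine (prod_step_le (p m) (hp0 m) (fun i e => poissonTail (τ i m) (e - 2)) d
        (fun i => poissonTail.nonneg (hτn i m) _)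
        fun i => poissonTail.antitone_right (hτn i m) (by omega)).trans ?_
      refine Finset.prod_le_prod (fun i _ => ?_) fun i _ => ?_
      · have h1 : p m i ≤ 1 :=
          (Finset.single_le_sum (fun j _ => hp0 m j) (Finset.mem_univ i)).trans (hp1 m)
        exact add_nonneg (mul_nonneg (by linarith) (poissonTail.nonneg (hτn i m) _))
          (mul_nonneg (hp0 m i) (poissonTail.nonneg (hτn i m) _))
      · have h := poissonTail.bernoulli_step_le (hτn i m)
          (sub_nonneg.2 (hτ i (Nat.le_succ m))) (hpτ i m hm) (d i - 2)
        rw [add_sub_cancel] at h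
        rwa [show d i - 2 - 1 = d i - 1 - 2 by omega] at h
    -- The lower Poisson product is a subsolution up to a quadratic error. Taylor's bound treats
    -- each factor and the product expansion combines them; the new error is again a multiple of the
    -- dominating product.
    have hT : ∏ i, poissonTail (t i (m + 1)) (d i) ≤
        ((1 - ∑ i, p m i) * ∏ i, poissonTail (t i m) (d i)
          + ∑ i, p m i * ∏ j, poissonTail (t j m) (Function.update d i (d i - 1) j))
        + 3 * 2 ^ Fintype.card ι * (∑ i, p m i) ^ 2 *
          ∏ i, poissonTail (τ i (m + 1)) (d i - 2) := by
      rw [prod_step (p m) (fun i => poissonTail (t i m)) d]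
      have hD : ∀ i, 0 ≤ poissonTail (t i m) (d i - 1) - poissonTail (t i m) (d i) := fun i =>
        sub_nonneg.2 (poissonTail.le_pred (htn i m) _)
      have hQn : ∀ i, 0 ≤ poissonTail (τ i (m + 1)) (d i - 2) := fun i =>
        poissonTail.nonneg (hτn i (m + 1)) _
      have h1 : ∏ i, poissonTail (t i (m + 1)) (d i) ≤ ∏ i, (poissonTail (t i m) (d i)
          + p m i * (poissonTail (t i m) (d i - 1) - poissonTail (t i m) (d i))
          + p m i ^ 2 * poissonTail (τ i (m + 1)) (d i - 2)) := by
        refine Finset.prod_le_prod (fun i _ => poissonTail.nonneg (htn i (m + 1)) _)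
          fun i _ => ?_
        have hq0 := sub_nonneg.2 (ht i (Nat.le_succ m))
        have h := poissonTail.add_le_taylor (htn i m) hq0 (d i)
        rw [add_sub_cancel] at h
        have h2 := poissonTail.mono_left (htn i (m + 1)) (htτ i (m + 1) hm) (d i - 2)
        have h3 := htp i m hm
        have h4 : (t i (m + 1) - t i m) ^ 2 ≤ p m i ^ 2 := pow_le_pow_left₀ hq0 h3 2
        have h5 := poissonTail.nonneg (htn i (m + 1)) (d i - 2)
        have h6 := mul_le_mul h4 h2 h5 (sq_nonneg _)
        have h7 := mul_le_mul_of_nonneg_right h3 (hD i)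
        linarith
      have h2 := Finset.prod_le_prod_add_sum_erase Finset.univ (p m)
        (fun i => poissonTail (t i m) (d i))
        (fun i => poissonTail (t i m) (d i - 1) - poissonTail (t i m) (d i))
        (fun i => poissonTail (τ i (m + 1)) (d i - 2)) (fun i _ => hp0 m i) (hp1 m)
        (fun i _ => poissonTail.nonneg (htn i m) _) (fun i _ => hD i) (fun i _ => by
          rw [add_sub_cancel]
          exact (poissonTail.antitone_right (htn i m) (by omega)).trans
            (poissonTail.mono_left (htn i m) ((ht i (Nat.le_succ m)).trans (htτ i _ hm)) _))
      refine h1.trans (h2.trans ?_)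
      have h3 : 3 * ((2 : ℝ) ^ (Finset.univ : Finset ι).card - 1) * (∑ i, p m i) ^ 2 *
          ∏ i, poissonTail (τ i (m + 1)) (d i - 2) ≤ 3 * 2 ^ Fintype.card ι *
          (∑ i, p m i) ^ 2 * ∏ i, poissonTail (τ i (m + 1)) (d i - 2) := by
        refine mul_le_mul_of_nonneg_right (mul_le_mul_of_nonneg_right ?_ (sq_nonneg _))
          (Finset.prod_nonneg fun i _ => hQn i)
        rw [Finset.card_univ]
        linarith
      linarith
    have hQ0 : 0 ≤ ∏ i, poissonTail (τ i (m + 1)) (d i - 2) :=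
      Finset.prod_nonneg fun i _ => poissonTail.nonneg (hτn i (m + 1)) _
    have h1 := mul_le_mul_of_nonneg_left hQ (hAn m)
    have h2 := mul_le_mul_of_nonneg_right (hA m) hQ0
    linarith

end jointTail

end Recursions

/-! ### The law of the in-degrees given the weights -/

namespace WRT

/-- The probability that the vertex `m` connects to the vertex `i`, given the weights. -/
noncomputable def attachProb (w : ℕ → ℝ) (m i : ℕ) : ℝ :=
  if i < m then w i / ∑ j ∈ Finset.range m, w j else 0

/-- The event that the in-degree of `a i` in the `n`-th tree is at least `d i`, for all `i`. -/
def vertexDegreeEvent {Ω ι : Type*} (parent : ℕ → Ω → ℕ) (n : ℕ) (a d : ι → ℕ) : Set Ω :=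
  {ω | ∀ i, d i ≤ inDegree parent n (a i) ω}

section attachProb

variable {w : ℕ → ℝ}

lemma sum_weights_pos (hw : ∀ i, 0 < w i) {m : ℕ} (hm : 0 < m) :
    0 < ∑ j ∈ Finset.range m, w j :=
  Finset.sum_pos (fun i _ => hw i) (Finset.nonempty_range_iff.2 hm.ne')

lemma attachProb_nonneg (hw : ∀ i, 0 < w i) (m i : ℕ) : 0 ≤ attachProb w m i := by
  unfold attachProb
  split_ifs with h
  · exact div_nonneg (hw i).le (Finset.sum_nonneg fun j _ => (hw j).le)
  · exact le_rfl

lemma sum_attachProb_le_one (hw : ∀ i, 0 < w i) (m : ℕ) (s : Finset ℕ) :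
    ∑ i ∈ s, attachProb w m i ≤ 1 := by
  have h1 : ∑ i ∈ s, attachProb w m i ≤ ∑ i ∈ Finset.range m, attachProb w m i := by
    rw [← Finset.sum_filter_add_sum_filter_not s (· < m),
      Finset.sum_eq_zero (s := s.filter (¬ · < m)) (f := attachProb w m)
        fun i hi => if_neg (Finset.mem_filter.1 hi).2, add_zero]
    exact Finset.sum_le_sum_of_subset_of_nonneg
      (fun i hi => Finset.mem_range.2 (Finset.mem_filter.1 hi).2)
      fun i _ _ => attachProb_nonneg hw m i
  refine h1.trans ?_
  rcases Nat.eq_zero_or_pos m with rfl | hm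
  · simp
  · have : ∑ i ∈ Finset.range m, attachProb w m i
        = ∑ i ∈ Finset.range m, w i / ∑ j ∈ Finset.range m, w j :=
      Finset.sum_congr rfl fun i hi => if_pos (Finset.mem_range.1 hi)
    rw [this, ← Finset.sum_div, div_self (sum_weights_pos hw hm).ne']

lemma attachProb_le_one (hw : ∀ i, 0 < w i) (m i : ℕ) : attachProb w m i ≤ 1 := by
  simpa using sum_attachProb_le_one hw m {i}

lemma sum_attachProb_comp_le_one {ι : Type*} [Fintype ι] (hw : ∀ i, 0 < w i) (m : ℕ) {a : ι → ℕ}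
    (ha : Function.Injective a) : ∑ i, attachProb w m (a i) ≤ 1 := by
  have := sum_attachProb_le_one hw m (Finset.univ.map ⟨a, ha⟩)
  rwa [Finset.sum_map] at this

end attachProb

section Tree

variable {Ω : Type*} {W : ℕ → Ω → ℝ} {parent : ℕ → Ω → ℕ}

/-- The sigma-algebra of the weights. -/
abbrev weightSigma (W : ℕ → Ω → ℝ) : MeasurableSpace Ω :=
  ⨆ i, MeasurableSpace.comap (W i) inferInstance

lemma weightSigma_le_history (n : ℕ) : weightSigma W ≤ history W parent n := le_sup_left

lemma measurable_weight_weightSigma (i : ℕ) : Measurable[weightSigma W] (W i) :=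
  (Measurable.of_comap_le (le_iSup (fun i => MeasurableSpace.comap (W i) inferInstance) i))

lemma measurable_parent_history {j n : ℕ} (hj : j ∈ Finset.Ico 1 n) :
    Measurable[history W parent n] (parent j) := by
  refine Measurable.of_comap_le (le_trans ?_ le_sup_right)
  exact le_iSup₂ (f := fun j (_ : j ∈ Finset.Ico 1 n) =>
    MeasurableSpace.comap (parent j) inferInstance) j hj

lemma measurable_inDegree_history (n i : ℕ) :
    Measurable[history W parent n] (inDegree parent n i) := by
  have : inDegree parent n i = fun ω => ∑ j ∈ Finset.Ico 1 n, if parent j ω = i then 1 else 0 := by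
    funext ω
    rw [inDegree, Finset.card_filter]
  rw [this]
  refine Finset.measurable_sum _ fun j hj => ?_
  exact Measurable.ite (measurable_parent_history hj (measurableSet_singleton i))
    measurable_const measurable_const

lemma measurableSet_vertexDegreeEvent {ι : Type*} [Countable ι] (n : ℕ) (a d : ι → ℕ) :
    MeasurableSet[history W parent n] (vertexDegreeEvent parent n a d) := by
  have : vertexDegreeEvent parent n a d = ⋂ i, inDegree parent n (a i) ⁻¹' Set.Ici (d i) := by
    ext ω; simp [vertexDegreeEvent]
  rw [this]
  exact MeasurableSet.iInter fun i => measurable_inDegree_history n (a i) measurableSet_Ici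

lemma inDegree_succ {m : ℕ} (hm : 1 ≤ m) (i : ℕ) (ω : Ω) :
    inDegree parent (m + 1) i ω = inDegree parent m i ω + if parent m ω = i then 1 else 0 := by
  rw [inDegree, inDegree, Finset.card_filter, Finset.card_filter, Finset.sum_Ico_succ_top hm]

lemma indicator_one_congr {s t : Set Ω} {ω : Ω} (h : ω ∈ s ↔ ω ∈ t) :
    s.indicator (fun _ => (1 : ℝ)) ω = t.indicator (fun _ => 1) ω := by
  by_cases hs : ω ∈ s
  · rw [Set.indicator_of_mem hs, Set.indicator_of_mem (h.1 hs)]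
  · rw [Set.indicator_of_notMem hs, Set.indicator_of_notMem fun ht => hs (h.2 ht)]

/-- The pathwise form of the recursion defining `jointTail`. Injectivity of `a` ensures that the new
edge raises at most one of the degrees. -/
lemma indicator_vertexDegreeEvent_succ {ι : Type*} [Fintype ι] [DecidableEq ι] {m : ℕ}
    (hm : 1 ≤ m) {a : ι → ℕ} (ha : Function.Injective a) (d : ι → ℕ) (ω : Ω) :
    (vertexDegreeEvent parent (m + 1) a d).indicator (fun _ => (1 : ℝ)) ω
      = (1 - ∑ i, (parent m ⁻¹' {a i}).indicator (fun _ => (1 : ℝ)) ω) *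
          (vertexDegreeEvent parent m a d).indicator (fun _ => 1) ω
        + ∑ i, (parent m ⁻¹' {a i}).indicator (fun _ => (1 : ℝ)) ω *
          (vertexDegreeEvent parent m a (Function.update d i (d i - 1))).indicator
            (fun _ => 1) ω := by
  by_cases h : ∃ i, parent m ω = a i
  · obtain ⟨i, hi⟩ := h
    have h1 : ∀ j, (parent m ⁻¹' {a j}).indicator (fun _ => (1 : ℝ)) ω
        = if j = i then 1 else 0 := fun j => by
      simp only [Set.indicator, Set.mem_preimage, Set.mem_singleton_iff, hi, ha.eq_iff]
      exact if_congr eq_comm rfl rfl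
    simp only [h1, Finset.sum_ite_eq', Finset.mem_univ, if_true, sub_self, zero_mul, zero_add,
      ite_mul, one_mul]
    refine indicator_one_congr (forall_congr' fun j => ?_)
    rw [inDegree_succ hm, hi]
    rcases eq_or_ne j i with rfl | hj
    · simp
    · rw [if_neg fun h => hj (ha h).symm, Function.update_of_ne hj, add_zero]
  · push Not at h
    have h1 : ∀ j, (parent m ⁻¹' {a j}).indicator (fun _ => (1 : ℝ)) ω = 0 := fun j => by
      simp [Set.indicator, h j]
    simp only [h1, Finset.sum_const_zero, sub_zero, one_mul, zero_mul, add_zero]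
    refine indicator_one_congr (forall_congr' fun j => ?_)
    rw [inDegree_succ hm, if_neg (h j), add_zero]

variable [mΩ : MeasurableSpace Ω] {P : Measure Ω} {ν : Measure ℝ}

lemma history_le (hT : IsWeightedRecursiveTree P ν W parent) (n : ℕ) :
    history W parent n ≤ mΩ := by
  refine sup_le (iSup_le fun i => (hT.measurable_weight i).comap_le) ?_
  exact iSup₂_le fun j hj => (hT.measurable_parent j (Finset.mem_Ico.1 hj).1).comap_le

lemma weightSigma_le (hT : IsWeightedRecursiveTree P ν W parent) : weightSigma W ≤ mΩ :=
  (weightSigma_le_history 0).trans (history_le hT 0)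

lemma integrable_of_ae_abs_le [IsFiniteMeasure P] {f : Ω → ℝ} (hf : Measurable f) {C : ℝ}
    (hC : ∀ᵐ ω ∂P, |f ω| ≤ C) : Integrable f P :=
  Integrable.of_bound hf.aestronglyMeasurable C hC

variable [IsProbabilityMeasure P]

lemma integral_mul_indicator_parent (hT : IsWeightedRecursiveTree P ν W parent)
    (hW : ∀ᵐ ω ∂P, ∀ i, 0 < W i ω) {m i : ℕ} (hm : 1 ≤ m) {ψ : Ω → ℝ}
    (hψ : Measurable[history W parent m] ψ) {C : ℝ} (hC : ∀ᵐ ω ∂P, |ψ ω| ≤ C) :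
    ∫ ω, ψ ω * (parent m ⁻¹' {i}).indicator (fun _ => (1 : ℝ)) ω ∂P
      = ∫ ω, ψ ω * attachProb (fun j => W j ω) m i ∂P := by
  have hlt : ∀ (ψ : Ω → ℝ), Measurable[history W parent m] ψ → (∃ C, ∀ᵐ ω ∂P, |ψ ω| ≤ C) →
      ∀ i < m, ∫ ω, ψ ω * (parent m ⁻¹' {i}).indicator (fun _ => (1 : ℝ)) ω ∂P
      = ∫ ω, ψ ω * attachProb (fun j => W j ω) m i ∂P := by
    rintro ψ hψ ⟨C, hC⟩ i hi
    have hset : MeasurableSet (parent m ⁻¹' {i}) :=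
      hT.measurable_parent m hm (measurableSet_singleton i)
    have hψm : Measurable ψ := hψ.mono (history_le hT m) le_rfl
    have hJ : Integrable ((parent m ⁻¹' {i}).indicator (fun _ => (1 : ℝ))) P :=
      (integrable_const 1).indicator hset
    have hψJ : Integrable (ψ * (parent m ⁻¹' {i}).indicator (fun _ => (1 : ℝ))) P :=
      hJ.bdd_mul (c := C) hψm.aestronglyMeasurable hC
    have h1 := condExp_mul_of_stronglyMeasurable_left (m := history W parent m) (μ := P)
      hψ.stronglyMeasurable hψJ hJ
    have h2 := hT.parent_condProb m hm i hi
    calc ∫ ω, ψ ω * (parent m ⁻¹' {i}).indicator (fun _ => (1 : ℝ)) ω ∂P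
        = ∫ ω, (P[ψ * (parent m ⁻¹' {i}).indicator (fun _ => (1 : ℝ)) | history W parent m]) ω
            ∂P := (integral_condExp (history_le hT m)).symm
      _ = _ := by
          refine integral_congr_ae ?_
          filter_upwards [h1, h2] with ω h1 h2
          rw [h1, Pi.mul_apply, h2, attachProb, if_pos hi]
  rcases lt_or_ge i m with hi | hi
  · exact hlt ψ hψ ⟨C, hC⟩ i hi
  -- The model prescribes only the probabilities of the values below `m`. They add up to one, so
  -- every other value is null.
  · have hae : ∀ᵐ ω ∂P, parent m ω < m := by
      have hmeas : Measurable (parent m) := hT.measurable_parent m hm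
      have hone : ∑ i ∈ Finset.range m, P.real (parent m ⁻¹' {i}) = 1 := by
        have h1 : ∀ i ∈ Finset.range m, P.real (parent m ⁻¹' {i})
            = ∫ ω, attachProb (fun j => W j ω) m i ∂P := fun i hi => by
          have := hlt (fun _ => 1) measurable_const ⟨1, by simp⟩ i (Finset.mem_range.1 hi)
          simp only [one_mul] at this
          rw [← this, integral_indicator_const _ (hmeas (measurableSet_singleton i))]
          simp
        have hint : ∀ i ∈ Finset.range m,
            Integrable (fun ω => attachProb (fun j => W j ω) m i) P := fun i _ => by
          refine integrable_of_ae_abs_le (C := 1) ?_ ?_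
          · unfold attachProb
            split_ifs
            · exact (hT.measurable_weight i).div
                (Finset.measurable_sum _ fun j _ => hT.measurable_weight j)
            · exact measurable_const
          · filter_upwards [hW] with ω hω
            rw [abs_of_nonneg (attachProb_nonneg hω m i)]
            exact attachProb_le_one hω m i
        rw [Finset.sum_congr rfl h1, ← integral_finsetSum _ hint]
        rw [integral_congr_ae (g := fun _ => (1 : ℝ))]
        · simp
        · filter_upwards [hW] with ω hω
          have : ∑ i ∈ Finset.range m, attachProb (fun j => W j ω) m i
              = ∑ i ∈ Finset.range m, W i ω / ∑ j ∈ Finset.range m, W j ω :=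
            Finset.sum_congr rfl fun i hi => if_pos (Finset.mem_range.1 hi)
          rw [this, ← Finset.sum_div, div_self (sum_weights_pos hω hm).ne']
      have hunion : P.real (parent m ⁻¹' (Finset.range m : Set ℕ)) = 1 := by
        rw [← hone]
        have : parent m ⁻¹' (Finset.range m : Set ℕ)
            = ⋃ i ∈ Finset.range m, parent m ⁻¹' {i} := by
          ext ω; simp
        rw [this, measureReal_biUnion_finset]
        · intro i _ j _ hij
          exact Disjoint.preimage _ (Set.disjoint_singleton.2 hij)
        · exact fun i _ => hmeas (measurableSet_singleton i)
      have h2 : P (parent m ⁻¹' (Finset.range m : Set ℕ)) = 1 := by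
        rw [measureReal_def] at hunion
        exact (ENNReal.toReal_eq_one_iff _).1 hunion
      have h3 := (prob_compl_eq_zero_iff (hmeas (Finset.measurableSet (Finset.range m)))).2 h2
      rw [ae_iff]
      convert h3 using 2
      ext ω
      simp
    refine integral_congr_ae ?_
    filter_upwards [hae] with ω hω
    have : parent m ω ≠ i := by omega
    simp [attachProb, hi.not_gt, this]

/-- Given the weights, the in-degrees of fixed vertices have the law described by `jointTail`. -/
lemma integral_mul_indicator_vertexDegreeEvent (hT : IsWeightedRecursiveTree P ν W parent)
    (hW : ∀ᵐ ω ∂P, ∀ i, 0 < W i ω) {ι : Type*} [Fintype ι] [DecidableEq ι] {a : ι → ℕ}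
    (ha : Function.Injective a) (m : ℕ) (d : ι → ℕ) {φ : Ω → ℝ}
    (hφ : Measurable[weightSigma W] φ) {C : ℝ} (hC : ∀ᵐ ω ∂P, |φ ω| ≤ C) :
    Integrable (fun ω => φ ω * jointTail (fun m i => attachProb (fun j => W j ω) m (a i)) m d) P ∧
    ∫ ω, φ ω * (vertexDegreeEvent parent m a d).indicator (fun _ => (1 : ℝ)) ω ∂P
      = ∫ ω, φ ω * jointTail (fun m i => attachProb (fun j => W j ω) m (a i)) m d ∂P := by
  have hpm : ∀ m i, Measurable[weightSigma W] fun ω => attachProb (fun j => W j ω) m (a i) := by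
    intro m i
    unfold attachProb
    split_ifs
    · exact (measurable_weight_weightSigma (a i)).div
        (Finset.measurable_sum _ fun j _ => measurable_weight_weightSigma j)
    · exact measurable_const
  -- The test function `φ` must vary in the induction: each step replaces it by `φ` times an
  -- attachment probability, which is again bounded and determined by the weights.
  induction m generalizing d φ C with
  | zero =>
    have h0 : ∀ ω, (vertexDegreeEvent parent 0 a d).indicator (fun _ => (1 : ℝ)) ω
        = if d = 0 then 1 else 0 := fun ω => by
      by_cases h : d = 0
      · rw [Set.indicator_of_mem, if_pos h]
        intro i
        simp [h]
      · rw [Set.indicator_of_notMem, if_neg h]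
        intro h'
        exact h (funext fun i => by simpa [inDegree] using h' i)
    simp only [jointTail, h0, and_true]
    exact (integrable_of_ae_abs_le (hφ.mono (weightSigma_le hT) le_rfl) hC).mul_const _
  | succ m ih =>
    have hφm : Measurable φ := hφ.mono (weightSigma_le hT) le_rfl
    have hφp : ∀ i, Measurable[weightSigma W]
        fun ω => φ ω * attachProb (fun j => W j ω) m (a i) := fun i => hφ.mul (hpm m i)
    have hφpC : ∀ i, ∀ᵐ ω ∂P, |φ ω * attachProb (fun j => W j ω) m (a i)| ≤ C := fun i => by
      filter_upwards [hW, hC] with ω hω h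
      rw [abs_mul, abs_of_nonneg (attachProb_nonneg hω m (a i))]
      exact (mul_le_of_le_one_right (abs_nonneg _) (attachProb_le_one hω m (a i))).trans h
    have hjt : ∀ ω, φ ω * jointTail (fun m i => attachProb (fun j => W j ω) m (a i)) (m + 1) d
        = φ ω * jointTail (fun m i => attachProb (fun j => W j ω) m (a i)) m d
          - ∑ i, φ ω * attachProb (fun j => W j ω) m (a i) *
              jointTail (fun m i => attachProb (fun j => W j ω) m (a i)) m d
          + ∑ i, φ ω * attachProb (fun j => W j ω) m (a i) *
              jointTail (fun m i => attachProb (fun j => W j ω) m (a i)) m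
                (Function.update d i (d i - 1)) := fun ω => by
      rw [← Finset.sum_mul, ← Finset.mul_sum]
      simp only [jointTail, mul_add, mul_assoc]
      rw [← Finset.mul_sum]
      ring
    have i1 := ih d hφ hC
    have i2 := fun i => ih d (hφp i) (hφpC i)
    have i3 := fun i => ih (Function.update d i (d i - 1)) (hφp i) (hφpC i)
    simp only [hjt]
    have j2 := integrable_finsetSum Finset.univ fun i _ => (i2 i).1
    have j3 := integrable_finsetSum Finset.univ fun i _ => (i3 i).1
    refine ⟨(i1.1.sub j2).add j3, ?_⟩
    refine Eq.trans ?_ (integral_add' (i1.1.sub j2) j3).symm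
    rw [integral_sub' i1.1 j2, integral_finsetSum _ fun i _ => (i2 i).1, integral_finsetSum _ fun i _ => (i3 i).1,
      ← i1.2]
    simp only [← (i2 _).2, ← (i3 _).2]
    -- Step `0` creates only the root and no edge: all attachment probabilities vanish and the
    -- degree event is unchanged.
    rcases Nat.eq_zero_or_pos m with rfl | hm
    · have : vertexDegreeEvent parent (0 + 1) a d = vertexDegreeEvent parent 0 a d := by
        simp [vertexDegreeEvent, inDegree]
      simp [attachProb, this]
    · have hψm : ∀ e, Measurable[history W parent m] fun ω =>
          φ ω * (vertexDegreeEvent parent m a e).indicator (fun _ => (1 : ℝ)) ω := fun e =>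
        (hφ.mono (weightSigma_le_history m) le_rfl).mul
          (measurable_const.indicator (measurableSet_vertexDegreeEvent m a e))
      have hψC : ∀ e, ∀ᵐ ω ∂P,
          |φ ω * (vertexDegreeEvent parent m a e).indicator (fun _ => (1 : ℝ)) ω| ≤ C := by
        intro e
        filter_upwards [hC] with ω hω
        refine le_trans ?_ hω
        rw [abs_mul]
        refine mul_le_of_le_one_right (abs_nonneg _) ?_
        by_cases h : ω ∈ vertexDegreeEvent parent m a e <;> simp [h]
      have hswap : ∀ e i, ∫ ω, φ ω * attachProb (fun j => W j ω) m (a i) *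
          (vertexDegreeEvent parent m a e).indicator (fun _ => (1 : ℝ)) ω ∂P
          = ∫ ω, φ ω * (vertexDegreeEvent parent m a e).indicator (fun _ => (1 : ℝ)) ω *
            (parent m ⁻¹' {a i}).indicator (fun _ => (1 : ℝ)) ω ∂P := fun e i => by
        rw [integral_mul_indicator_parent hT hW hm (hψm e) (hψC e)]
        exact integral_congr_ae (Eventually.of_forall fun ω => by ring)
      have hint : ∀ e i, Integrable (fun ω =>
          φ ω * (vertexDegreeEvent parent m a e).indicator (fun _ => (1 : ℝ)) ω *
            (parent m ⁻¹' {a i}).indicator (fun _ => (1 : ℝ)) ω) P := fun e i => by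
        have hJ : Integrable ((parent m ⁻¹' {a i}).indicator (fun _ => (1 : ℝ))) P :=
          (integrable_const 1).indicator (hT.measurable_parent m hm (measurableSet_singleton _))
        exact hJ.bdd_mul (c := C)
          ((hψm e).mono (history_le hT m) le_rfl).aestronglyMeasurable (hψC e)
      simp only [hswap]
      have k1 := integrable_of_ae_abs_le ((hψm d).mono (history_le hT m) le_rfl) (hψC d)
      have k2 := integrable_finsetSum Finset.univ fun i _ => hint d i
      have k3 := integrable_finsetSum Finset.univ
        fun i _ => hint (Function.update d i (d i - 1)) i
      rw [← integral_finsetSum _ fun i _ => hint _ i, ← integral_finsetSum _ fun i _ => hint _ i,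
        ← integral_sub k1 k2]
      refine Eq.trans ?_ (integral_add (k1.sub k2) k3)
      refine integral_congr_ae (Eventually.of_forall fun ω => ?_)
      simp only
      rw [indicator_vertexDegreeEvent_succ hm ha, ← Finset.mul_sum, mul_add, Finset.mul_sum]
      have : ∀ x y z : ℝ, x * ((1 - y) * z) = x * z - x * z * y := fun x y z => by ring
      rw [this]
      congr 1
      exact Finset.sum_congr rfl fun i _ => by ring

end Tree

end WRT

/-! ### Degree tails under control of the partial weight sums -/

namespace WRT

/-- The partial sums of the weights are close to `m * μ` for `L ≤ m < n`. -/
def GoodWeights (μ η : ℝ) (L n : ℕ) (w : ℕ → ℝ) : Prop :=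
  ∀ m, L ≤ m → m < n → (1 - η) * μ * m ≤ ∑ j ∈ Finset.range m, w j ∧
    ∑ j ∈ Finset.range m, w j ≤ (1 + η) * μ * m

/-- Here `(1 - p)⁻¹ = 1 + p / (1 - p) ≤ 1 + q ≤ exp q`. It converts a Bernoulli parameter into the
mean of a dominating Poisson variable. -/
lemma le_one_sub_exp_neg {p q : ℝ} (hp : p < 1) (h : p ≤ q * (1 - p)) :
    p ≤ 1 - Real.exp (-q) := by
  have h1 : 0 < 1 - p := by linarith
  rw [Real.exp_neg]
  have h2 : (1 - p)⁻¹ ≤ Real.exp q := by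
    refine le_trans ?_ (Real.add_one_le_exp q)
    rw [inv_le_iff_one_le_mul₀ h1]
    linarith
  have h3 := inv_anti₀ (inv_pos.2 h1) h2
  rw [inv_inv] at h3
  linarith

lemma inv_le_log_sub_log_pred {m : ℕ} (hm : 2 ≤ m) :
    (m : ℝ)⁻¹ ≤ Real.log m - Real.log ((m - 1 : ℕ) : ℝ) := by
  have h0 : (0 : ℝ) < m := by positivity
  have h1 : (0 : ℝ) < ((m - 1 : ℕ) : ℝ) := by
    have : 0 < m - 1 := by omega
    exact_mod_cast this
  have h2 : ((m - 1 : ℕ) : ℝ) = m - 1 := by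
    rw [Nat.cast_sub (by omega)]; simp
  rw [← Real.log_div h0.ne' h1.ne']
  have h3 := Real.one_sub_inv_le_log_of_pos (div_pos h0 h1)
  refine le_trans (le_of_eq ?_) h3
  rw [inv_div, h2]
  field_simp
  ring

lemma log_succ_sub_log_le_inv {m : ℕ} (hm : 1 ≤ m) :
    Real.log ((m + 1 : ℕ) : ℝ) - Real.log m ≤ (m : ℝ)⁻¹ := by
  have h0 : (0 : ℝ) < m := by positivity
  rw [← Real.log_div (by positivity) h0.ne']
  refine (Real.log_le_sub_one_of_pos (by positivity)).trans (le_of_eq ?_)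
  push_cast
  field_simp
  ring

lemma sum_range_inv_le (n : ℕ) : ∑ m ∈ Finset.range n, (m : ℝ)⁻¹ ≤ 1 + Real.log n := by
  cases n with
  | zero => simp
  | succ n =>
    have h := harmonic_le_one_add_log n
    rw [harmonic] at h
    push_cast at h
    rw [Finset.sum_range_succ']
    simp only [Nat.cast_zero, inv_zero, add_zero]
    push_cast
    refine h.trans ?_
    rcases Nat.eq_zero_or_pos n with rfl | hn
    · simp
    · have : Real.log n ≤ Real.log (n + 1) := Real.log_le_log (by positivity) (by linarith)
      linarith

section Bounds

variable {w : ℕ → ℝ} {w₀ μ η : ℝ} {L n : ℕ}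

lemma mul_le_sum_weights (hw : ∀ i, w₀ ≤ w i) (m : ℕ) :
    w₀ * m ≤ ∑ j ∈ Finset.range m, w j := by
  have := Finset.card_nsmul_le_sum (Finset.range m) w w₀ fun i _ => hw i
  rw [Finset.card_range, nsmul_eq_mul] at this
  linarith

lemma attachProb_le_inv (hw₀ : 0 < w₀) (hw : ∀ i, w₀ ≤ w i) (hw1 : ∀ i, w i ≤ 1) (m a : ℕ) :
    attachProb w m a ≤ w₀⁻¹ * (m : ℝ)⁻¹ := by
  unfold attachProb
  split_ifs with h
  · have hm : (0 : ℝ) < m := by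
      have : 0 < m := by omega
      exact_mod_cast this
    rw [← mul_inv, ← one_div]
    exact div_le_div₀ zero_le_one (hw1 a) (by positivity) (mul_le_sum_weights hw m)
  · positivity

lemma attachProb_le_one_sub_exp (hw₀ : 0 < w₀) (hw : ∀ i, w₀ ≤ w i) (hw1 : ∀ i, w i ≤ 1)
    (hμ : 0 < μ) (hη1 : η < 1 / 2) (hL : 1 ≤ η * μ * L)
    (hG : GoodWeights μ η L n w) {a m : ℕ} (ha : L ≤ a) (ham : a < m) (hmn : m < n) :
    attachProb w m a ≤ 1 - Real.exp (-(w a / (μ * (1 - 2 * η)) * (m : ℝ)⁻¹)) := by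
  have hwa : 0 < w a := hw₀.trans_le (hw a)
  have hLm : (L : ℝ) ≤ m := by exact_mod_cast (ha.trans ham.le)
  have hη0 : 0 < η * μ := by
    by_contra h
    push Not at h
    have : η * μ * L ≤ 0 := mul_nonpos_of_nonpos_of_nonneg h (Nat.cast_nonneg L)
    linarith
  have h1 : 1 ≤ η * μ * m := hL.trans (mul_le_mul_of_nonneg_left hLm hη0.le)
  have hm0 : (0 : ℝ) < m := by
    have : 0 < m := by omega
    exact_mod_cast this
  have hS := (hG m (ha.trans ham.le) hmn).1
  -- One `η` pays for the deviation of the partial sum, the other for the removed weight, since `w a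
  -- ≤ 1 ≤ η * μ * m`.
  have h2 : (1 - 2 * η) * μ * m ≤ ∑ j ∈ Finset.range m, w j - w a := by
    have := hw1 a
    nlinarith
  have h3 : 0 < (1 - 2 * η) * μ * m := by
    have : 0 < 1 - 2 * η := by linarith
    positivity
  set S := ∑ j ∈ Finset.range m, w j
  have hS0 : 0 < S := by linarith
  rw [attachProb, if_pos ham]
  refine le_one_sub_exp_neg ?_ ?_
  · rw [div_lt_one hS0]
    linarith
  · have h4 : w a / (μ * (1 - 2 * η)) * (m : ℝ)⁻¹ * (1 - w a / S)
        = w a / S * ((S - w a) / ((1 - 2 * η) * μ * m)) := by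
      field_simp
    rw [h4]
    refine le_mul_of_one_le_right (by positivity) ?_
    rwa [one_le_div h3]

/-- Intensity dominating the growth of the in-degree of the vertex `a`. -/
noncomputable def upperClock (κ : ℝ) (a m : ℕ) : ℝ :=
  κ * (Real.log ((max (m - 1) a : ℕ) : ℝ) - Real.log a)

/-- Intensity dominated by the growth of the in-degree of the vertex `a`. -/
noncomputable def lowerClock (κ : ℝ) (a m : ℕ) : ℝ :=
  κ * (Real.log ((max m (a + 1) : ℕ) : ℝ) - Real.log ((a + 1 : ℕ) : ℝ))

lemma upperClock_zero (κ : ℝ) (a : ℕ) : upperClock κ a 0 = 0 := by simp [upperClock]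

lemma lowerClock_zero (κ : ℝ) (a : ℕ) : lowerClock κ a 0 = 0 := by simp [lowerClock]

lemma monotone_upperClock {κ : ℝ} (hκ : 0 ≤ κ) {a : ℕ} (ha : 1 ≤ a) :
    Monotone (upperClock κ a) := fun m m' h => by
  have h1 : max (m - 1) a ≤ max (m' - 1) a := max_le_max (by omega) le_rfl
  have h2 : (0 : ℝ) < (max (m - 1) a : ℕ) := by
    have : 0 < max (m - 1) a := lt_of_lt_of_le ha (le_max_right _ _)
    exact_mod_cast this
  exact mul_le_mul_of_nonneg_left (sub_le_sub_right (Real.log_le_log h2 (by exact_mod_cast h1)) _)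
    hκ

lemma monotone_lowerClock {κ : ℝ} (hκ : 0 ≤ κ) (a : ℕ) :
    Monotone (lowerClock κ a) := fun m m' h => by
  have h1 : max m (a + 1) ≤ max m' (a + 1) := max_le_max h le_rfl
  have h2 : (0 : ℝ) < (max m (a + 1) : ℕ) := by
    have : 0 < max m (a + 1) := lt_of_lt_of_le (Nat.succ_pos a) (le_max_right _ _)
    exact_mod_cast this
  exact mul_le_mul_of_nonneg_left (sub_le_sub_right (Real.log_le_log h2 (by exact_mod_cast h1)) _)
    hκ

/-- The increment `log m - log (m - 1)` exceeds `1 / m`; this is what the shift by one in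
`upperClock` achieves. -/
lemma attachProb_le_upperClock (hw₀ : 0 < w₀) (hw : ∀ i, w₀ ≤ w i) (hw1 : ∀ i, w i ≤ 1)
    (hμ : 0 < μ) (hη1 : η < 1 / 2) (hL0 : 1 ≤ L) (hL : 1 ≤ η * μ * L)
    (hG : GoodWeights μ η L n w) {a m : ℕ} (ha : L ≤ a) (hmn : m < n) :
    attachProb w m a ≤ 1 - Real.exp (-(upperClock (w a / (μ * (1 - 2 * η))) a (m + 1)
      - upperClock (w a / (μ * (1 - 2 * η))) a m)) := by
  have hκ : 0 ≤ w a / (μ * (1 - 2 * η)) := by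
    have : 0 < 1 - 2 * η := by linarith
    have := hw₀.trans_le (hw a)
    positivity
  rcases lt_or_ge a m with ham | ham
  · refine (attachProb_le_one_sub_exp hw₀ hw hw1 hμ hη1 hL hG ha ham hmn).trans ?_
    have h1 : upperClock (w a / (μ * (1 - 2 * η))) a (m + 1)
        - upperClock (w a / (μ * (1 - 2 * η))) a m =
        w a / (μ * (1 - 2 * η)) * (Real.log m - Real.log ((m - 1 : ℕ) : ℝ)) := by
      rw [upperClock, upperClock, Nat.add_sub_cancel, max_eq_left ham.le,
        max_eq_left (by omega : a ≤ m - 1)]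
      ring
    rw [h1]
    refine sub_le_sub_left (Real.exp_le_exp.2 (neg_le_neg ?_)) 1
    exact mul_le_mul_of_nonneg_left (inv_le_log_sub_log_pred (by omega)) hκ
  · rw [attachProb, if_neg ham.not_gt]
    have := monotone_upperClock hκ (hL0.trans ha) (Nat.le_succ m)
    rw [sub_nonneg, Real.exp_le_one_iff]
    simp only [Nat.succ_eq_add_one] at this
    linarith

/-- Now `log (m + 1) - log m` lies below `1 / m`. The clock starts at `a + 1`, the first step at
which `a` can receive an edge. -/
lemma lowerClock_le_attachProb (hw₀ : 0 < w₀) (hw : ∀ i, w₀ ≤ w i)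
    (hμ : 0 < μ) (hη0 : 0 ≤ η) (hL0 : 1 ≤ L)
    (hG : GoodWeights μ η L n w) {a m : ℕ} (ha : L ≤ a) (hmn : m < n) :
    lowerClock (w a / (μ * (1 + η))) a (m + 1) - lowerClock (w a / (μ * (1 + η))) a m
      ≤ attachProb w m a := by
  have hwa := hw₀.trans_le (hw a)
  have hκ : 0 ≤ w a / (μ * (1 + η)) := by positivity
  rcases lt_or_ge a m with ham | ham
  · have hm0 : (0 : ℝ) < m := by
      have : 0 < m := by omega
      exact_mod_cast this
    rw [lowerClock, lowerClock, max_eq_left (by omega : a + 1 ≤ m + 1),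
      max_eq_left (by omega : a + 1 ≤ m), attachProb, if_pos ham, ← mul_sub,
      sub_sub_sub_cancel_right]
    refine (mul_le_mul_of_nonneg_left (log_succ_sub_log_le_inv (by omega)) hκ).trans ?_
    have hS0 : 0 < ∑ j ∈ Finset.range m, w j :=
      sum_weights_pos (fun i => hw₀.trans_le (hw i)) (by omega)
    rw [← div_eq_mul_inv, div_div]
    refine div_le_div_of_nonneg_left hwa.le hS0 ?_
    have := (hG m (ha.trans ham.le) hmn).2
    linarith
  · rw [attachProb, if_neg ham.not_gt, lowerClock, lowerClock,
      max_eq_right (by omega : m + 1 ≤ a + 1), max_eq_right (by omega : m ≤ a + 1), sub_self]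

lemma upperClock_le {κ : ℝ} (hκ : 0 ≤ κ) {a : ℕ} (ha : 1 ≤ a) (han : a < n) :
    upperClock κ a n ≤ κ * (Real.log n - Real.log a) := by
  refine mul_le_mul_of_nonneg_left (sub_le_sub_right (Real.log_le_log ?_ ?_) _) hκ
  · have : 0 < max (n - 1) a := lt_of_lt_of_le ha (le_max_right _ _)
    exact_mod_cast this
  · have : max (n - 1) a ≤ n := max_le (Nat.sub_le n 1) han.le
    exact_mod_cast this

lemma lowerClock_eq {κ : ℝ} {a : ℕ} (han : a < n) :
    lowerClock κ a n = κ * (Real.log n - Real.log ((a + 1 : ℕ) : ℝ)) := by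
  rw [lowerClock, max_eq_left (by omega : a + 1 ≤ n)]

lemma poissonTail_upperClock_le (hw₀ : 0 < w₀) (hw : ∀ i, w₀ ≤ w i)
    (hμ : 0 < μ) (hη0 : 0 ≤ η) (hη1 : η < 1 / 2) (hL0 : 1 ≤ L) {a : ℕ} (ha : L ≤ a) (han : a < n)
    (d : ℕ) : poissonTail (upperClock (w a / (μ * (1 - 2 * η))) a n) d ≤
      ((1 - 2 * η)⁻¹) ^ d * poissonTail (w a / μ * (Real.log n - Real.log a)) d := by
  have hwa := hw₀.trans_le (hw a)
  have h1 : 0 < 1 - 2 * η := by linarith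
  have hκ : 0 ≤ w a / (μ * (1 - 2 * η)) := by positivity
  have ha1 : 1 ≤ a := hL0.trans ha
  have hlog : 0 ≤ Real.log n - Real.log a := by
    rw [sub_nonneg]
    exact Real.log_le_log (by exact_mod_cast ha1) (by exact_mod_cast han.le)
  have h2 : 0 ≤ upperClock (w a / (μ * (1 - 2 * η))) a n := by
    have := monotone_upperClock hκ ha1 (Nat.zero_le n)
    rwa [upperClock_zero] at this
  refine (poissonTail.mono_left h2 (upperClock_le hκ ha1 han) d).trans ?_
  have h3 := poissonTail.mul_left_le (t := w a / μ * (Real.log n - Real.log a)) (by positivity)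
    (one_le_inv_iff₀.2 ⟨h1, by linarith⟩ : 1 ≤ (1 - 2 * η)⁻¹) d
  refine le_trans (le_of_eq ?_) h3
  congr 1
  field_simp

/-- Upper bound for the degree tail of a vertex with a large label. -/
lemma bernoulliTail_attachProb_le (hw₀ : 0 < w₀) (hw : ∀ i, w₀ ≤ w i) (hw1 : ∀ i, w i ≤ 1)
    (hμ : 0 < μ) (hη0 : 0 ≤ η) (hη1 : η < 1 / 2) (hL0 : 1 ≤ L) (hL : 1 ≤ η * μ * L)
    (hG : GoodWeights μ η L n w) {a : ℕ} (ha : L ≤ a) (han : a < n) (d : ℕ) :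
    bernoulliTail (fun m => attachProb w m a) n d ≤
      ((1 - 2 * η)⁻¹) ^ d * poissonTail (w a / μ * (Real.log n - Real.log a)) d := by
  have hpos : ∀ i, 0 < w i := fun i => hw₀.trans_le (hw i)
  have hκ : 0 ≤ w a / (μ * (1 - 2 * η)) := by
    have : 0 < 1 - 2 * η := by linarith
    have := hpos a
    positivity
  refine le_trans ?_ (poissonTail_upperClock_le hw₀ hw hμ hη0 hη1 hL0 ha han d)
  exact bernoulliTail.le_poissonTail (fun m => attachProb_nonneg hpos m a)
    (fun m => attachProb_le_one hpos m a) (upperClock_zero _ _).ge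
    (monotone_upperClock hκ (hL0.trans ha))
    (fun m hm => attachProb_le_upperClock hw₀ hw hw1 hμ hη1 hL0 hL hG ha hm) le_rfl d

/-- Upper bound for the degree tail of an arbitrary vertex. -/
lemma bernoulliTail_attachProb_le_exp (hw₀ : 0 < w₀) (hw : ∀ i, w₀ ≤ w i) (hw1 : ∀ i, w i ≤ 1)
    (hμ : 0 < μ) (hη1 : η < 1 / 2)
    (hG : GoodWeights μ η L n w) {s : ℝ} (hs : 1 ≤ s) (a d : ℕ) :
    bernoulliTail (fun m => attachProb w m a) n d ≤ (s⁻¹) ^ d * Real.exp ((s - 1) *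
      (w₀⁻¹ * (1 + Real.log L) + (μ * (1 - η))⁻¹ * (1 + Real.log n))) := by
  have hpos : ∀ i, 0 < w i := fun i => hw₀.trans_le (hw i)
  have hs0 : 0 < s := by linarith
  have h1η : 0 < 1 - η := by linarith
  have h := bernoulliTail.le_pow_inv_mul_exp (q := fun m => attachProb w m a)
    (fun m => attachProb_nonneg hpos m a) (fun m => attachProb_le_one hpos m a) hs n d
  -- Steps before `L` only have the crude bound `w₀ * m` for the partial sum. They contribute a
  -- multiple of `1 + log L`, which will be a small fraction of `log n` up to a constant.
  have hsum : ∑ m ∈ Finset.range n, attachProb w m a ≤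
      w₀⁻¹ * (1 + Real.log L) + (μ * (1 - η))⁻¹ * (1 + Real.log n) := by
    have h1 : ∀ m ∈ Finset.range n, attachProb w m a ≤
        (if m ∈ Finset.range L then w₀⁻¹ * (m : ℝ)⁻¹ else 0) + (μ * (1 - η))⁻¹ * (m : ℝ)⁻¹ := by
      intro m hm
      split_ifs with h
      · exact (attachProb_le_inv hw₀ hw hw1 m a).trans (le_add_of_nonneg_right (by positivity))
      · have hLm : L ≤ m := by simpa using h
        rw [zero_add, attachProb]
        split_ifs with ham
        · have hm0 : (0 : ℝ) < m := by
            have : 0 < m := by omega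
            exact_mod_cast this
          rw [← mul_inv, ← one_div]
          refine div_le_div₀ zero_le_one (hw1 a) (by positivity) ?_
          have := (hG m hLm (Finset.mem_range.1 hm)).1
          linarith
        · positivity
    refine (Finset.sum_le_sum h1).trans ?_
    rw [Finset.sum_add_distrib, ← Finset.mul_sum, ← Finset.sum_filter]
    refine add_le_add ?_ (mul_le_mul_of_nonneg_left (sum_range_inv_le n) (by positivity))
    refine le_trans ?_ (mul_le_mul_of_nonneg_left (sum_range_inv_le L)
      (inv_nonneg.2 hw₀.le))
    rw [Finset.mul_sum]
    exact Finset.sum_le_sum_of_subset_of_nonneg (fun m hm => (Finset.mem_filter.1 hm).2)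
      fun m _ _ => by positivity
  have h2 : s ^ d * bernoulliTail (fun m => attachProb w m a) n d ≤ Real.exp ((s - 1) *
      (w₀⁻¹ * (1 + Real.log L) + (μ * (1 - η))⁻¹ * (1 + Real.log n))) :=
    h.trans (Real.exp_le_exp.2 (mul_le_mul_of_nonneg_left hsum (by linarith)))
  rw [inv_pow]
  rwa [le_inv_mul_iff₀ (by positivity)]

/-- Lower bound for the joint degree tail of vertices with large labels. -/
lemma le_jointTail_attachProb {ι : Type*} [Fintype ι] [DecidableEq ι]
    (hw₀ : 0 < w₀) (hw : ∀ i, w₀ ≤ w i) (hw1 : ∀ i, w i ≤ 1)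
    (hμ : 0 < μ) (hη0 : 0 ≤ η) (hη1 : η < 1 / 2) (hL0 : 1 ≤ L) (hL : 1 ≤ η * μ * L)
    (hG : GoodWeights μ η L n w) {a : ι → ℕ} (hinj : Function.Injective a)
    (ha : ∀ i, L ≤ a i) (han : ∀ i, a i < n) (d : ι → ℕ) :
    ((1 + η)⁻¹) ^ (∑ i, d i) *
        ∏ i, poissonTail (w (a i) / μ * (Real.log n - Real.log ((a i + 1 : ℕ) : ℝ))) (d i)
      - 6 * 2 ^ Fintype.card ι * (Fintype.card ι) ^ 2 * (w₀⁻¹) ^ 2 * (L : ℝ)⁻¹ *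
        (((1 - 2 * η)⁻¹) ^ (∑ i, d i) *
          ∏ i, poissonTail (w (a i) / μ * (Real.log n - Real.log (a i))) (d i - 2))
      ≤ jointTail (fun m i => attachProb w m (a i)) n d := by
  have hpos : ∀ i, 0 < w i := fun i => hw₀.trans_le (hw i)
  have h1η : 0 < 1 - 2 * η := by linarith
  have hκ : ∀ i, 0 ≤ w (a i) / (μ * (1 - 2 * η)) := fun i => by
    have := hpos (a i)
    positivity
  have hκ' : ∀ i, 0 ≤ w (a i) / (μ * (1 + η)) := fun i => by
    have := hpos (a i)
    positivity
  set K : ℝ := 6 * 2 ^ Fintype.card ι * (Fintype.card ι) ^ 2 * (w₀⁻¹) ^ 2 with hK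
  have hK0 : 0 ≤ K := by positivity
  have hLpos : (0 : ℝ) < L := by exact_mod_cast hL0
  -- The error `A` telescopes: two increments compete at step `m` with weight of order `1 / m ^ 2 ≤
  -- 2 * (1 / m - 1 / (m + 1))`, which turns the constant `3` into `6`. Up to `m = L` no vertex `a
  -- i` can be hit, so `A` stays zero, and afterwards it remains below `K / L`.
  have hmain := jointTail.prod_poissonTail_sub_le (p := fun m i => attachProb w m (a i))
    (t := fun i => lowerClock (w (a i) / (μ * (1 + η))) (a i))
    (τ := fun i => upperClock (w (a i) / (μ * (1 - 2 * η))) (a i))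
    (A := fun m => K * ((L : ℝ)⁻¹ - ((max m L : ℕ) : ℝ)⁻¹)) (N := n)
    (fun m i => attachProb_nonneg hpos m (a i)) (fun m => sum_attachProb_comp_le_one hpos m hinj)
    (fun i => lowerClock_zero _ _) (fun i => monotone_lowerClock (hκ' i) (a i))
    (fun i m hm => lowerClock_le_attachProb hw₀ hw hμ hη0 hL0 hG (ha i) hm)
    (fun i => upperClock_zero _ _) (fun i => monotone_upperClock (hκ i) (hL0.trans (ha i)))
    (fun i m hm => attachProb_le_upperClock hw₀ hw hw1 hμ hη1 hL0 hL hG (ha i) hm)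
    (by simp) (fun m => by
      rcases le_or_gt m L with hm | hm
      · have h0 : ∀ i, attachProb w m (a i) = 0 := fun i => if_neg (hm.trans (ha i)).not_gt
        simp only [h0, Finset.sum_const_zero]
        have h1 : ((max (m + 1) L : ℕ) : ℝ)⁻¹ ≤ ((max m L : ℕ) : ℝ)⁻¹ := by
          refine inv_anti₀ ?_ ?_
          · rw [max_eq_right hm]; exact hLpos
          · exact_mod_cast max_le_max (Nat.le_succ m) le_rfl
        have := mul_le_mul_of_nonneg_left (sub_le_sub_left h1 (L : ℝ)⁻¹) hK0
        simpa using this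
      · rw [max_eq_left hm.le, max_eq_left (by omega : L ≤ m + 1)]
        have hm0 : (0 : ℝ) < m := by
          have : 0 < m := by omega
          exact_mod_cast this
        have hm1 : (1 : ℝ) ≤ m := by
          have : 1 ≤ m := by omega
          exact_mod_cast this
        have hs : ∑ i, attachProb w m (a i) ≤ Fintype.card ι * (w₀⁻¹ * (m : ℝ)⁻¹) := by
          refine (Finset.sum_le_card_nsmul _ _ _ fun i _ =>
            attachProb_le_inv hw₀ hw hw1 m (a i)).trans_eq ?_
          rw [nsmul_eq_mul, Finset.card_univ]
        have hs0 : 0 ≤ ∑ i, attachProb w m (a i) :=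
          Finset.sum_nonneg fun i _ => attachProb_nonneg hpos m (a i)
        have hs2 := mul_le_mul_of_nonneg_left (pow_le_pow_left₀ hs0 hs 2)
          (by positivity : (0 : ℝ) ≤ 3 * 2 ^ Fintype.card ι)
        have h2 : (1 / 2) * ((m : ℝ)⁻¹) ^ 2 ≤ (m : ℝ)⁻¹ - ((m + 1 : ℕ) : ℝ)⁻¹ := by
          push_cast
          rw [inv_sub_inv hm0.ne' (by positivity), add_sub_cancel_left, inv_pow,
            ← one_div ((m : ℝ) ^ 2), div_mul_div_comm]
          exact div_le_div₀ (by norm_num) (by norm_num) (by positivity) (by nlinarith)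
        have h3 := mul_le_mul_of_nonneg_left h2 hK0
        have h4 : 3 * 2 ^ Fintype.card ι * ((Fintype.card ι : ℝ) * (w₀⁻¹ * (m : ℝ)⁻¹)) ^ 2
            = K * ((1 / 2) * ((m : ℝ)⁻¹) ^ 2) := by
          rw [hK]; ring
        linarith)
    le_rfl d
  refine le_trans (sub_le_sub ?_ ?_) hmain
  · rw [← Finset.prod_pow_eq_pow_sum, ← Finset.prod_mul_distrib]
    refine Finset.prod_le_prod (fun i _ => ?_) fun i _ => ?_
    · have := hpos (a i)
      have hlog : 0 ≤ Real.log n - Real.log ((a i + 1 : ℕ) : ℝ) := by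
        rw [sub_nonneg]
        exact Real.log_le_log (by positivity) (by exact_mod_cast (han i))
      exact mul_nonneg (by positivity) (poissonTail.nonneg (by positivity) _)
    · have := hpos (a i)
      have hlog : 0 ≤ Real.log n - Real.log ((a i + 1 : ℕ) : ℝ) := by
        rw [sub_nonneg]
        exact Real.log_le_log (by positivity) (by exact_mod_cast (han i))
      rw [lowerClock_eq (han i), inv_pow, inv_mul_le_iff₀ (by positivity)]
      have h3 := poissonTail.mul_left_le (t := w (a i) / (μ * (1 + η)) *
        (Real.log n - Real.log ((a i + 1 : ℕ) : ℝ))) (by positivity)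
        (by linarith : 1 ≤ 1 + η) (d i)
      refine le_trans (le_of_eq ?_) h3
      congr 1
      field_simp
  · refine mul_le_mul ?_ ?_ ?_ ?_
    · refine mul_le_mul_of_nonneg_left ?_ hK0
      have : (0 : ℝ) ≤ ((max n L : ℕ) : ℝ)⁻¹ := by positivity
      linarith
    · rw [← Finset.prod_pow_eq_pow_sum, ← Finset.prod_mul_distrib]
      refine Finset.prod_le_prod (fun i _ => ?_) fun i _ => ?_
      · refine poissonTail.nonneg ?_ _
        have := monotone_upperClock (hκ i) (hL0.trans (ha i)) (Nat.zero_le n)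
        rwa [upperClock_zero] at this
      · have hlog : 0 ≤ Real.log n - Real.log (a i) := by
          rw [sub_nonneg]
          exact Real.log_le_log (by exact_mod_cast hL0.trans (ha i))
            (by exact_mod_cast (han i).le)
        refine (poissonTail_upperClock_le hw₀ hw hμ hη0 hη1 hL0 (ha i) (han i) _).trans ?_
        refine mul_le_mul_of_nonneg_right ?_ (poissonTail.nonneg ?_ _)
        · exact pow_le_pow_right₀ (one_le_inv_iff₀.2 ⟨h1η, by linarith⟩) (Nat.sub_le _ _)
        · have := hpos (a i)
          positivity
    · refine Finset.prod_nonneg fun i _ => poissonTail.nonneg ?_ _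
      have := monotone_upperClock (hκ i) (hL0.trans (ha i)) (Nat.zero_le n)
      rwa [upperClock_zero] at this
    · positivity

end Bounds

end WRT

/-! ### The limiting model: a mixed Poisson process at an exponential time -/

/-- The probability that a Poisson variable of random mean `X * t / μ`, where `X` has law `ν`, is
at least `d`. -/
noncomputable def mixedTail (ν : Measure ℝ) (μ : ℝ) (d : ℕ) (t : ℝ) : ℝ :=
  ∫ x, poissonTail (x / μ * t) d ∂ν

/-- The probability that a Poisson variable of mean `X * T / μ` is at least `d`, where `X` has
law `ν` and `T` is an independent standard exponential variable. -/
noncomputable def mixedMass (ν : Measure ℝ) (μ : ℝ) (d : ℕ) : ℝ :=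
  ∫ t in Set.Ioi (0 : ℝ), Real.exp (-t) * mixedTail ν μ d t

section Mixed

variable {ν : Measure ℝ} [IsProbabilityMeasure ν] {w₀ μ : ℝ}

lemma integrable_poissonTail_mul (hw₀ : 0 < w₀) (hν : ∀ᵐ x ∂ν, w₀ ≤ x ∧ x ≤ 1) (hμ : 0 < μ)
    (d : ℕ) {t : ℝ} (ht : 0 ≤ t) : Integrable (fun x => poissonTail (x / μ * t) d) ν := by
  refine Integrable.of_bound (C := 1) ?_ ?_
  · have := poissonTail.continuous d
    exact Continuous.aestronglyMeasurable (by fun_prop)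
  · filter_upwards [hν] with x hx
    have h0 : 0 ≤ x / μ * t := by
      have := hw₀.trans_le hx.1
      positivity
    rw [Real.norm_eq_abs, abs_of_nonneg (poissonTail.nonneg h0 d)]
    exact poissonTail.le_one h0 d

namespace mixedTail

omit [IsProbabilityMeasure ν] in
lemma nonneg (hw₀ : 0 < w₀) (hν : ∀ᵐ x ∂ν, w₀ ≤ x ∧ x ≤ 1) (hμ : 0 < μ) (d : ℕ) {t : ℝ}
    (ht : 0 ≤ t) : 0 ≤ mixedTail ν μ d t := by
  refine integral_nonneg_of_ae ?_
  filter_upwards [hν] with x hx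
  have := hw₀.trans_le hx.1
  exact poissonTail.nonneg (by positivity) d

lemma mono (hw₀ : 0 < w₀) (hν : ∀ᵐ x ∂ν, w₀ ≤ x ∧ x ≤ 1) (hμ : 0 < μ) (d : ℕ) {s t : ℝ}
    (hs : 0 ≤ s) (hst : s ≤ t) : mixedTail ν μ d s ≤ mixedTail ν μ d t := by
  refine integral_mono_ae (integrable_poissonTail_mul hw₀ hν hμ d hs)
    (integrable_poissonTail_mul hw₀ hν hμ d (hs.trans hst)) ?_
  filter_upwards [hν] with x hx
  have := hw₀.trans_le hx.1
  exact poissonTail.mono_left (by positivity) (by gcongr) d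

lemma le_poissonTail (hw₀ : 0 < w₀) (hν : ∀ᵐ x ∂ν, w₀ ≤ x ∧ x ≤ 1) (hμ : 0 < μ) (d : ℕ) {t : ℝ}
    (ht : 0 ≤ t) : mixedTail ν μ d t ≤ poissonTail (1 / μ * t) d := by
  have h : ∫ _, poissonTail (1 / μ * t) d ∂ν = poissonTail (1 / μ * t) d := by simp
  rw [← h]
  refine integral_mono_ae (integrable_poissonTail_mul hw₀ hν hμ d ht) (integrable_const _) ?_
  filter_upwards [hν] with x hx
  have := hw₀.trans_le hx.1
  exact poissonTail.mono_left (by positivity)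
    (mul_le_mul_of_nonneg_right (div_le_div_of_nonneg_right hx.2 hμ.le) ht) d

lemma le_one (hw₀ : 0 < w₀) (hν : ∀ᵐ x ∂ν, w₀ ≤ x ∧ x ≤ 1) (hμ : 0 < μ) (d : ℕ) {t : ℝ}
    (ht : 0 ≤ t) : mixedTail ν μ d t ≤ 1 :=
  (le_poissonTail hw₀ hν hμ d ht).trans (poissonTail.le_one (by positivity) d)

lemma stronglyMeasurable (d : ℕ) : StronglyMeasurable (mixedTail ν μ d) := by
  have h : StronglyMeasurable (Function.uncurry fun t x : ℝ => poissonTail (x / μ * t) d) := by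
    have := poissonTail.continuous d
    refine Continuous.stronglyMeasurable ?_
    unfold Function.uncurry
    fun_prop
  exact h.integral_prod_right

lemma integrableOn_cexp_mul (hw₀ : 0 < w₀) (hν : ∀ᵐ x ∂ν, w₀ ≤ x ∧ x ≤ 1) (hμ : 0 < μ) (d : ℕ)
    {z : ℂ} (hz : 0 < z.re) :
    IntegrableOn (fun t : ℝ => Complex.exp (-z * t) * (mixedTail ν μ d t : ℂ)) (Set.Ioi 0) := by
  refine Integrable.mono' (g := fun t : ℝ => Real.exp (-z.re * t)) ?_ ?_ ?_
  · exact integrableOn_exp_mul_Ioi (by linarith) 0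
  · refine AEStronglyMeasurable.mul (Continuous.aestronglyMeasurable (by fun_prop)) ?_
    exact Complex.continuous_ofReal.comp_aestronglyMeasurable
      (stronglyMeasurable d).aestronglyMeasurable
  · refine (ae_restrict_iff' measurableSet_Ioi).2 (Eventually.of_forall fun t ht => ?_)
    have ht : 0 < t := ht
    rw [norm_mul, Complex.norm_exp, Complex.norm_real, Real.norm_eq_abs,
      abs_of_nonneg (nonneg hw₀ hν hμ d ht.le)]
    have h1 : (-z * (t : ℂ)).re = -z.re * t := by simp
    rw [h1]
    exact mul_le_of_le_one_right (Real.exp_pos _).le (le_one hw₀ hν hμ d ht.le)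

/-- Fubini, then the Poisson transform at rate `x / μ`. Complex `z` is allowed so that the same
formula yields both the mass of the event and the characteristic function of the time. -/
lemma integral_cexp_mul (hw₀ : 0 < w₀) (hν : ∀ᵐ x ∂ν, w₀ ≤ x ∧ x ≤ 1) (hμ : 0 < μ) (d : ℕ)
    {z : ℂ} (hz : 0 < z.re) :
    ∫ t in Set.Ioi (0 : ℝ), Complex.exp (-z * t) * (mixedTail ν μ d t : ℂ)
      = z⁻¹ * ∫ x : ℝ, ((x : ℂ) / (x + μ * z)) ^ d ∂ν := by
  have hint : Integrable (Function.uncurry fun (t x : ℝ) =>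
      Complex.exp (-z * t) * (poissonTail (x / μ * t) d : ℂ))
      ((volume.restrict (Set.Ioi 0)).prod ν) := by
    have hg : Integrable (fun t : ℝ => Real.exp (-z.re * t)) (volume.restrict (Set.Ioi 0)) :=
      integrableOn_exp_mul_Ioi (by linarith) 0
    refine Integrable.mono' (hg.comp_fst ν) ?_ ?_
    · have := poissonTail.continuous d
      refine Continuous.aestronglyMeasurable ?_
      unfold Function.uncurry
      fun_prop
    · have h1 : ∀ᵐ p ∂((volume.restrict (Set.Ioi (0 : ℝ))).prod ν), 0 < p.1 :=
        Measure.quasiMeasurePreserving_fst.ae (ae_restrict_mem measurableSet_Ioi)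
      have h2 : ∀ᵐ p ∂((volume.restrict (Set.Ioi (0 : ℝ))).prod ν), w₀ ≤ p.2 ∧ p.2 ≤ 1 :=
        Measure.quasiMeasurePreserving_snd.ae hν
      filter_upwards [h1, h2] with p hp1 hp2
      have h0 : 0 ≤ p.2 / μ * p.1 := by
        have := hw₀.trans_le hp2.1
        positivity
      simp only [Function.uncurry]
      rw [norm_mul, Complex.norm_exp, Complex.norm_real, Real.norm_eq_abs,
        abs_of_nonneg (poissonTail.nonneg h0 d)]
      have h1 : (-z * (p.1 : ℂ)).re = -z.re * p.1 := by simp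
      rw [h1]
      exact mul_le_of_le_one_right (Real.exp_pos _).le (poissonTail.le_one h0 d)
  have h1 : ∀ t : ℝ, Complex.exp (-z * t) * (mixedTail ν μ d t : ℂ)
      = ∫ x, Complex.exp (-z * t) * (poissonTail (x / μ * t) d : ℂ) ∂ν := fun t => by
    rw [integral_const_mul, mixedTail, integral_complex_ofReal]
  simp_rw [h1]
  rw [integral_integral_swap hint, ← integral_const_mul]
  refine integral_congr_ae ?_
  filter_upwards [hν] with x hx
  have hx0 := hw₀.trans_le hx.1
  rw [poissonTail.integral_cexp_mul hz (by positivity : 0 ≤ x / μ) d]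
  congr 2
  push_cast
  have hμ' : (μ : ℂ) ≠ 0 := by exact_mod_cast hμ.ne'
  have h2 : (x : ℂ) / μ + z = (x + μ * z) / μ := by field_simp
  rw [h2, div_div_div_cancel_right₀ hμ']

lemma integrableOn_exp_mul (hw₀ : 0 < w₀) (hν : ∀ᵐ x ∂ν, w₀ ≤ x ∧ x ≤ 1) (hμ : 0 < μ) (d : ℕ) :
    IntegrableOn (fun t : ℝ => Real.exp (-t) * mixedTail ν μ d t) (Set.Ioi 0) := by
  have h := (integrableOn_cexp_mul hw₀ hν hμ d (z := 1) (by simp)).re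
  refine h.congr (Eventually.of_forall fun t => ?_)
  have : Complex.exp (-1 * t) * (mixedTail ν μ d t : ℂ)
      = ((Real.exp (-t) * mixedTail ν μ d t : ℝ) : ℂ) := by push_cast; ring_nf
  simp only [this]
  exact Complex.ofReal_re _

end mixedTail

namespace mixedMass

/-- Given `x`, the points arriving before a unit-rate exponential time form a geometric count, each
one winning the race with probability `x / (x + μ)`. This is the transform at `z = 1`. -/
lemma eq_integral (hw₀ : 0 < w₀) (hν : ∀ᵐ x ∂ν, w₀ ≤ x ∧ x ≤ 1) (hμ : 0 < μ) (d : ℕ) :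
    mixedMass ν μ d = ∫ x, (x / (x + μ)) ^ d ∂ν := by
  have h := mixedTail.integral_cexp_mul hw₀ hν hμ d (z := 1) (by simp)
  have h1 : ∀ t : ℝ, Complex.exp (-1 * t) * (mixedTail ν μ d t : ℂ)
      = ((Real.exp (-t) * mixedTail ν μ d t : ℝ) : ℂ) := fun t => by push_cast; ring_nf
  have h2 : ∀ x : ℝ, ((x : ℂ) / (x + μ * 1)) ^ d = (((x / (x + μ)) ^ d : ℝ) : ℂ) := fun x => by
    push_cast; ring_nf
  simp_rw [h1, h2] at h
  rw [integral_complex_ofReal, integral_complex_ofReal, inv_one, one_mul] at h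
  exact_mod_cast h

lemma integrable_pow (hw₀ : 0 < w₀) (hν : ∀ᵐ x ∂ν, w₀ ≤ x ∧ x ≤ 1) (hμ : 0 < μ) (d : ℕ) :
    Integrable (fun x => (x / (x + μ)) ^ d) ν := by
  refine Integrable.of_bound (C := 1) (Measurable.aestronglyMeasurable (by fun_prop)) ?_
  filter_upwards [hν] with x hx
  have hx0 := hw₀.trans_le hx.1
  rw [Real.norm_eq_abs, abs_of_nonneg (by positivity)]
  exact pow_le_one₀ (by positivity) ((div_le_one (by positivity)).2 (by linarith))

lemma pos (hw₀ : 0 < w₀) (hν : ∀ᵐ x ∂ν, w₀ ≤ x ∧ x ≤ 1) (hμ : 0 < μ) (d : ℕ) :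
    (w₀ / (1 + μ)) ^ d ≤ mixedMass ν μ d := by
  rw [eq_integral hw₀ hν hμ]
  have h : ∫ _, (w₀ / (1 + μ)) ^ d ∂ν = (w₀ / (1 + μ)) ^ d := by simp
  rw [← h]
  refine integral_mono_ae (integrable_const _) (integrable_pow hw₀ hν hμ d) ?_
  filter_upwards [hν] with x hx
  have hx0 := hw₀.trans_le hx.1
  exact pow_le_pow_left₀ (by positivity) (div_le_div₀ hx0.le hx.1 (by positivity)
    (by linarith)) d

/-- One power costs at most the factor `(1 + μ) / w₀`, as the weights stay away from zero. It makes
the error terms at level `d - 2` comparable with the main term. -/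
lemma sub_two_le (hw₀ : 0 < w₀) (hν : ∀ᵐ x ∂ν, w₀ ≤ x ∧ x ≤ 1) (hμ : 0 < μ) (d : ℕ) :
    mixedMass ν μ (d - 2) ≤ ((1 + μ) / w₀) ^ 2 * mixedMass ν μ d := by
  rw [eq_integral hw₀ hν hμ, eq_integral hw₀ hν hμ, ← integral_const_mul]
  refine integral_mono_ae (integrable_pow hw₀ hν hμ _) ((integrable_pow hw₀ hν hμ d).const_mul _) ?_
  filter_upwards [hν] with x hx
  have hx0 := hw₀.trans_le hx.1
  have h1 : x / (x + μ) ≤ 1 := (div_le_one (by positivity)).2 (by linarith)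
  have h2 : (x / (x + μ)) ^ (d - 2 + 2) ≤ (x / (x + μ)) ^ d :=
    pow_le_pow_of_le_one (by positivity) h1 (by omega)
  have h3 : 1 ≤ (1 + μ) / w₀ * (x / (x + μ)) := by
    rw [div_mul_div_comm, one_le_div (by positivity)]
    nlinarith
  have h4 : 1 ≤ ((1 + μ) / w₀ * (x / (x + μ))) ^ 2 := one_le_pow₀ h3
  have h5 : 0 ≤ (x / (x + μ)) ^ (d - 2) := by positivity
  calc (x / (x + μ)) ^ (d - 2)
      ≤ (x / (x + μ)) ^ (d - 2) * ((1 + μ) / w₀ * (x / (x + μ))) ^ 2 :=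
        le_mul_of_one_le_right h5 h4
    _ = ((1 + μ) / w₀) ^ 2 * (x / (x + μ)) ^ (d - 2 + 2) := by rw [pow_add]; ring
    _ ≤ _ := mul_le_mul_of_nonneg_left h2 (by positivity)

end mixedMass

/-- The part of `mixedMass` carried by `n e^{-t} ∈ [j, j + 1)`. -/
noncomputable def cellMass (ν : Measure ℝ) (μ : ℝ) (n d j : ℕ) : ℝ :=
  ∫ t in (Real.log n - Real.log ((j + 1 : ℕ) : ℝ))..(Real.log n - Real.log (j : ℝ)),
    Real.exp (-t) * mixedTail ν μ d t

/-! ### Cutting the exponential time into cells, one per vertex -/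

section Cells

variable (hw₀ : 0 < w₀) (hν : ∀ᵐ x ∂ν, w₀ ≤ x ∧ x ≤ 1) (hμ : 0 < μ)

include hw₀ hν hμ

lemma setIntegral_mixedTail_le_mixedMass (d : ℕ) {s : Set ℝ}
    (hs0 : s ⊆ Set.Ioi 0) :
    ∫ t in s, Real.exp (-t) * mixedTail ν μ d t ≤ mixedMass ν μ d := by
  refine setIntegral_mono_set (mixedTail.integrableOn_exp_mul hw₀ hν hμ d) ?_ hs0.eventuallyLE
  refine (ae_restrict_iff' measurableSet_Ioi).2 (Eventually.of_forall fun t ht => ?_)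
  exact mul_nonneg (Real.exp_pos _).le (mixedTail.nonneg hw₀ hν hμ d (le_of_lt ht))

lemma intervalIntegrable_exp_mul_mixedTail (d : ℕ) {a b : ℝ} (ha : 0 ≤ a) (hb : 0 ≤ b) :
    IntervalIntegrable (fun t => Real.exp (-t) * mixedTail ν μ d t) volume a b :=
  ⟨(mixedTail.integrableOn_exp_mul hw₀ hν hμ d).mono_set
      fun _ hx => Set.mem_Ioi.2 (ha.trans_lt hx.1),
    (mixedTail.integrableOn_exp_mul hw₀ hν hμ d).mono_set
      fun _ hx => Set.mem_Ioi.2 (hb.trans_lt hx.1)⟩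

omit hw₀ hν hμ in
-- Every cell has the exponential mass of a single uniformly chosen vertex.
lemma integral_exp_neg_cell {n j : ℕ} (hn : 0 < n) (hj : 0 < j) :
    ∫ t in (Real.log n - Real.log ((j + 1 : ℕ) : ℝ))..(Real.log n - Real.log (j : ℝ)),
      Real.exp (-t) = (n : ℝ)⁻¹ := by
  have hn' : (0 : ℝ) < n := by exact_mod_cast hn
  have hj' : (0 : ℝ) < j := by exact_mod_cast hj
  rw [intervalIntegral.integral_comp_neg (fun t => Real.exp t), integral_exp, neg_sub, neg_sub,
    Real.exp_sub, Real.exp_sub, Real.exp_log hn', Real.exp_log hj', Real.exp_log (by positivity)]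
  push_cast
  field_simp
  ring

omit hw₀ hν hμ in
lemma log_sub_log_nonneg {n j : ℕ} (hj : 0 < j) (hjn : j ≤ n) :
    0 ≤ Real.log n - Real.log (j : ℝ) :=
  sub_nonneg.2 (Real.log_le_log (by exact_mod_cast hj) (by exact_mod_cast hjn))

omit hw₀ hν hμ in
lemma cell_le {n j : ℕ} (hj : 0 < j) :
    Real.log n - Real.log ((j + 1 : ℕ) : ℝ) ≤ Real.log n - Real.log (j : ℝ) :=
  sub_le_sub_left (Real.log_le_log (by exact_mod_cast hj) (by exact_mod_cast Nat.le_succ j)) _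

omit [IsProbabilityMeasure ν] in
lemma cellMass_nonneg (d : ℕ) {n j : ℕ} (hj : 0 < j) (hjn : j < n) :
    0 ≤ cellMass ν μ n d j := by
  refine intervalIntegral.integral_nonneg (cell_le hj) fun t ht => ?_
  exact mul_nonneg (Real.exp_pos _).le
    (mixedTail.nonneg hw₀ hν hμ d ((log_sub_log_nonneg (Nat.succ_pos j) hjn).trans ht.1))

lemma cellMass_le (d : ℕ) {n j : ℕ} (hj : 0 < j) (hjn : j < n) :
    cellMass ν μ n d j ≤ (n : ℝ)⁻¹ * mixedTail ν μ d (Real.log n - Real.log (j : ℝ)) := by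
  rw [← integral_exp_neg_cell (hj.trans hjn) hj, ← intervalIntegral.integral_mul_const]
  have h0 := log_sub_log_nonneg (Nat.succ_pos j) hjn
  refine intervalIntegral.integral_mono_on (cell_le hj)
    (intervalIntegrable_exp_mul_mixedTail hw₀ hν hμ d h0 (h0.trans (cell_le hj)))
    (Continuous.intervalIntegrable (by fun_prop) _ _) fun t ht => ?_
  exact mul_le_mul_of_nonneg_left (mixedTail.mono hw₀ hν hμ d (h0.trans ht.1) ht.2)
    (Real.exp_pos _).le

/-- Monotonicity in `t` brackets a cell by the values at its ends. The upper bound above matches the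
lower clock of vertex `j - 1`, and this one the upper clock of vertex `j + 1`. -/
lemma le_cellMass (d : ℕ) {n j : ℕ} (hj : 0 < j) (hjn : j < n) :
    (n : ℝ)⁻¹ * mixedTail ν μ d (Real.log n - Real.log ((j + 1 : ℕ) : ℝ))
      ≤ cellMass ν μ n d j := by
  rw [← integral_exp_neg_cell (hj.trans hjn) hj, ← intervalIntegral.integral_mul_const]
  have h0 := log_sub_log_nonneg (Nat.succ_pos j) hjn
  refine intervalIntegral.integral_mono_on (cell_le hj)
    (Continuous.intervalIntegrable (by fun_prop) _ _)
    (intervalIntegrable_exp_mul_mixedTail hw₀ hν hμ d h0 (h0.trans (cell_le hj))) fun t ht => ?_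
  exact mul_le_mul_of_nonneg_left (mixedTail.mono hw₀ hν hμ d h0 ht.1) (Real.exp_pos _).le

omit [IsProbabilityMeasure ν] hw₀ hν hμ in
lemma sum_integral_cell {E : Type*} [NormedAddCommGroup E] [NormedSpace ℝ E] {f : ℝ → E}
    (hf : IntegrableOn f (Set.Ioi 0)) {n J : ℕ} (hJ : 1 ≤ J) (hJn : J ≤ n) :
    ∑ j ∈ Finset.Ico 1 J,
        ∫ t in (Real.log n - Real.log ((j + 1 : ℕ) : ℝ))..(Real.log n - Real.log (j : ℝ)), f t
      = ∫ t in Set.Ioc (Real.log n - Real.log (J : ℝ)) (Real.log n), f t := by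
  have hle : Real.log n - Real.log (J : ℝ) ≤ Real.log n :=
    sub_le_self _ (Real.log_nonneg (by exact_mod_cast hJ))
  have hint : ∀ {a b : ℝ}, 0 ≤ a → 0 ≤ b → IntervalIntegrable f volume a b := fun ha hb =>
    ⟨hf.mono_set fun _ hx => Set.mem_Ioi.2 (ha.trans_lt hx.1),
      hf.mono_set fun _ hx => Set.mem_Ioi.2 (hb.trans_lt hx.1)⟩
  rw [← intervalIntegral.integral_of_le hle]
  induction J, hJ using Nat.le_induction with
  | base => simp
  | succ J hJ ih =>
    rw [Finset.sum_Ico_succ_top hJ, ih (by omega)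
      (sub_le_self _ (Real.log_nonneg (by exact_mod_cast hJ))), add_comm]
    refine intervalIntegral.integral_add_adjacent_intervals ?_ ?_
    · exact hint (log_sub_log_nonneg (Nat.succ_pos J) hJn) (log_sub_log_nonneg hJ (by omega))
    · exact hint (log_sub_log_nonneg hJ (by omega)) (Real.log_natCast_nonneg n)

lemma sum_cellMass_eq (d : ℕ) {n J : ℕ} (hJ : 1 ≤ J) (hJn : J ≤ n) :
    ∑ j ∈ Finset.Ico 1 J, cellMass ν μ n d j
      = ∫ t in Set.Ioc (Real.log n - Real.log (J : ℝ)) (Real.log n),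
          Real.exp (-t) * mixedTail ν μ d t :=
  sum_integral_cell (mixedTail.integrableOn_exp_mul hw₀ hν hμ d) hJ hJn

lemma sum_cellMass_le (d : ℕ) {n : ℕ} (hn : 1 ≤ n) :
    ∑ j ∈ Finset.Ico 1 n, cellMass ν μ n d j ≤ mixedMass ν μ d := by
  rw [sum_cellMass_eq hw₀ hν hμ d hn le_rfl, sub_self]
  exact setIntegral_mixedTail_le_mixedMass hw₀ hν hμ d fun t ht => ht.1

/-- By monotonicity all times beyond `t₀ = log (n / j)` contribute at least the tail at `t₀`, and
together they have exponential mass `j / n`. So no cell far from the root dominates, and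
coincidences among sampled vertices are negligible. -/
lemma cellMass_le_mixedMass_div (d : ℕ) {n j : ℕ} (hj : 0 < j) (hjn : j < n) :
    cellMass ν μ n d j ≤ (j : ℝ)⁻¹ * mixedMass ν μ d := by
  have hj' : (0 : ℝ) < j := by exact_mod_cast hj
  have hn' : (0 : ℝ) < n := by exact_mod_cast hj.trans hjn
  refine (cellMass_le hw₀ hν hμ d hj hjn).trans ?_
  have h0 := log_sub_log_nonneg hj hjn.le
  set t₀ := Real.log n - Real.log (j : ℝ)
  have h1 : ∫ t in Set.Ioi t₀, Real.exp (-t) * mixedTail ν μ d t₀ ≤ mixedMass ν μ d := by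
    refine le_trans ?_ (setIntegral_mixedTail_le_mixedMass hw₀ hν hμ d
      (Set.Ioi_subset_Ioi h0))
    refine setIntegral_mono_on ?_ ?_ measurableSet_Ioi fun t ht => ?_
    · exact (integrableOn_exp_neg_Ioi t₀).mul_const _
    · exact (mixedTail.integrableOn_exp_mul hw₀ hν hμ d).mono_set (Set.Ioi_subset_Ioi h0)
    · exact mul_le_mul_of_nonneg_left (mixedTail.mono hw₀ hν hμ d h0 (le_of_lt ht))
        (Real.exp_pos _).le
  rw [integral_mul_const, integral_exp_neg_Ioi] at h1
  have h2 : Real.exp (-t₀) = j / n := by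
    rw [neg_sub, Real.exp_sub, Real.exp_log hn', Real.exp_log hj']
  rw [h2] at h1
  rw [le_inv_mul_iff₀ hj']
  refine le_trans (le_of_eq ?_) h1
  ring

/-- The Chernoff bound at the largest weight `1`; the condition `s < 1 + μ` keeps the remaining
exponential integrable. -/
lemma setIntegral_Ioi_mixedTail_le (d : ℕ) {s t₀ : ℝ} (hs1 : 1 ≤ s) (hsμ : s < 1 + μ)
    (ht₀ : 0 ≤ t₀) :
    ∫ t in Set.Ioi t₀, Real.exp (-t) * mixedTail ν μ d t
      ≤ (s⁻¹) ^ d * (1 - (s - 1) / μ)⁻¹ * Real.exp (-(1 - (s - 1) / μ) * t₀) := by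
  have hb : 0 < 1 - (s - 1) / μ := by
    rw [sub_pos, div_lt_one hμ]; linarith
  have hs0 : 0 < s := by linarith
  have h1 : ∫ t in Set.Ioi t₀, Real.exp (-t) * mixedTail ν μ d t
      ≤ ∫ t in Set.Ioi t₀, (s⁻¹) ^ d * Real.exp (-(1 - (s - 1) / μ) * t) := by
    refine setIntegral_mono_on ?_ ?_ measurableSet_Ioi fun t ht => ?_
    · exact (mixedTail.integrableOn_exp_mul hw₀ hν hμ d).mono_set (Set.Ioi_subset_Ioi ht₀)
    · exact (integrableOn_exp_mul_Ioi (by linarith) t₀).const_mul _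
    · have ht0 : 0 ≤ t := ht₀.trans (le_of_lt ht)
      have h2 := poissonTail.pow_mul_le_exp hs1 (by positivity : 0 ≤ 1 / μ * t) d
      have h3 := mixedTail.le_poissonTail hw₀ hν hμ d ht0
      have h4 : mixedTail ν μ d t ≤ (s⁻¹) ^ d * Real.exp ((s - 1) * (1 / μ * t)) := by
        refine h3.trans ?_
        rwa [inv_pow, le_inv_mul_iff₀ (by positivity)]
      refine (mul_le_mul_of_nonneg_left h4 (Real.exp_pos _).le).trans_eq ?_
      rw [mul_left_comm, ← Real.exp_add]
      congr 2
      ring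
  refine h1.trans_eq ?_
  rw [integral_const_mul, integral_exp_mul_Ioi (by linarith)]
  field_simp

end Cells

end Mixed

/-! ### The biased weight concentrates near one -/

section Tilt

/-- On `[0, 1]` the map `x ↦ x / (x + μ)` has slope at least `μ / (1 + μ) ^ 2`, and its values are
at most one. Raised to the power `d`, a weight smaller by `y` is penalised exponentially in `d * y`.
-/
lemma div_add_le_mul_exp {μ a b : ℝ} (hμ : 0 < μ) (ha : 0 ≤ a) (hab : a ≤ b) (hb : b ≤ 1) :
    a / (a + μ) ≤ b / (b + μ) * Real.exp (-(μ / (1 + μ) ^ 2 * (b - a))) := by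
  have hb0 : 0 ≤ b := ha.trans hab
  have h1 : b / (b + μ) - a / (a + μ) = μ * (b - a) / ((b + μ) * (a + μ)) := by
    field_simp
    ring
  have h2 : μ / (1 + μ) ^ 2 * (b - a) ≤ μ * (b - a) / ((b + μ) * (a + μ)) := by
    rw [div_mul_eq_mul_div]
    refine div_le_div_of_nonneg_left (mul_nonneg hμ.le (by linarith)) (by positivity) ?_
    rw [pow_two]
    exact mul_le_mul (by linarith) (by linarith) (by positivity) (by positivity)
  have h3 : b / (b + μ) ≤ 1 := (div_le_one (by positivity)).2 (by linarith)
  have h4 : 0 ≤ b / (b + μ) := by positivity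
  have h5 : 0 ≤ μ / (1 + μ) ^ 2 * (b - a) := mul_nonneg (by positivity) (by linarith)
  have h6 := Real.add_one_le_exp (-(μ / (1 + μ) ^ 2 * (b - a)))
  have h7 := mul_le_mul_of_nonneg_left h6 h4
  nlinarith

lemma div_add_mono {μ a b : ℝ} (hμ : 0 < μ) (ha : 0 ≤ a) (hab : a ≤ b) :
    a / (a + μ) ≤ b / (b + μ) := by
  rw [div_le_div_iff₀ (by positivity) (by linarith [ha.trans hab])]
  nlinarith

variable {ν : Measure ℝ} [IsProbabilityMeasure ν] {w₀ μ C : ℝ} {q : ℕ}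
  (hw₀ : 0 < w₀) (hν : ∀ᵐ x ∂ν, w₀ ≤ x ∧ x ≤ 1) (hμ : 0 < μ)
  (hC : 0 < C) (htail : ∀ y, 0 < y → y ≤ 1 → C * y ^ q ≤ ν.real (Set.Ici (1 - y)))

include hw₀ hν hμ htail in
lemma mixedMass.ge_tail (d : ℕ) {y : ℝ} (hy0 : 0 < y) (hy1 : y ≤ 1) :
    C * y ^ q * ((1 - y) / (1 - y + μ)) ^ d ≤ mixedMass ν μ d := by
  rw [mixedMass.eq_integral hw₀ hν hμ]
  have hr : 0 ≤ ((1 - y) / (1 - y + μ)) ^ d := by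
    have : 0 ≤ 1 - y := by linarith
    positivity
  refine (mul_le_mul_of_nonneg_right (htail y hy0 hy1) hr).trans ?_
  have h1 : ∫ x in Set.Ici (1 - y), (x / (x + μ)) ^ d ∂ν ≤ ∫ x, (x / (x + μ)) ^ d ∂ν := by
    refine setIntegral_le_integral (mixedMass.integrable_pow hw₀ hν hμ d) ?_
    filter_upwards [hν] with x hx
    have := hw₀.trans_le hx.1
    positivity
  refine le_trans ?_ h1
  have h2 : ∫ _ in Set.Ici (1 - y), ((1 - y) / (1 - y + μ)) ^ d ∂ν
      = ν.real (Set.Ici (1 - y)) * ((1 - y) / (1 - y + μ)) ^ d := by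
    simp
  rw [← h2]
  refine setIntegral_mono_on (integrable_const _).integrableOn
    (mixedMass.integrable_pow hw₀ hν hμ d).integrableOn measurableSet_Ici fun x hx => ?_
  have h0 : 0 ≤ 1 - y := by linarith
  exact pow_le_pow_left₀ (by positivity) (div_add_mono hμ h0 hx) d

include hw₀ hν hμ hC htail in
-- Weights within `1 / d` of the maximum already suffice: `(1 - 1 / d) ^ d ≥ 1 / 4`, by Bernoulli's
-- inequality on half of the exponent. Only a polynomial factor is lost against `(1 + μ)⁻¹ ^ d`.
lemma mixedMass.ge_pow {d : ℕ} (hd : 2 ≤ d) :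
    C / 4 * ((d : ℝ)⁻¹) ^ q * ((1 + μ)⁻¹) ^ d ≤ mixedMass ν μ d := by
  have hd' : (2 : ℝ) ≤ d := by exact_mod_cast hd
  have hd0 : (0 : ℝ) < d := by linarith
  have hy1 : (d : ℝ)⁻¹ ≤ 1 / 2 := by
    rw [inv_le_comm₀ hd0 (by norm_num)]; simpa using hd'
  have hy0 : 0 < (d : ℝ)⁻¹ := by positivity
  refine le_trans ?_ (mixedMass.ge_tail hw₀ hν hμ htail d hy0 (by linarith))
  set y := (d : ℝ)⁻¹
  have h1 : (1 - y) * (1 + μ)⁻¹ ≤ (1 - y) / (1 - y + μ) := by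
    rw [div_eq_mul_inv]
    exact mul_le_mul_of_nonneg_left (inv_anti₀ (by linarith) (by linarith)) (by linarith)
  have h2 : (1 / 4 : ℝ) ≤ (1 - y) ^ d := by
    have hdy : (d : ℝ) * y = 1 := mul_inv_cancel₀ hd0.ne'
    obtain ⟨m, hm | hm⟩ := Nat.even_or_odd' d
    · have h5 := one_add_mul_le_pow (a := -y) (by linarith) m
      have h6 : (m : ℝ) * y = 1 / 2 := by
        have : (d : ℝ) = 2 * m := by rw [hm]; push_cast; ring
        rw [this] at hdy; linarith
      have h7 : (1 / 2 : ℝ) ≤ (1 - y) ^ m := by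
        have : 1 + (m : ℝ) * -y = 1 / 2 := by linarith
        rw [this] at h5
        rwa [← sub_eq_add_neg] at h5
      rw [hm, mul_comm, pow_mul, pow_two]
      nlinarith
    · have h5 := one_add_mul_le_pow (a := -y) (by linarith) m
      have h6 : (m : ℝ) * y = (1 - y) / 2 := by
        have : (d : ℝ) = 2 * m + 1 := by rw [hm]; push_cast; ring
        rw [this] at hdy; linarith
      have h7 : (1 + y) / 2 ≤ (1 - y) ^ m := by
        have : 1 + (m : ℝ) * -y = (1 + y) / 2 := by linarith
        rw [this] at h5
        rwa [← sub_eq_add_neg] at h5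
      have h9 : y ≤ 1 / 3 := by
        have h3 : 3 ≤ d := by omega
        have h3' : (3 : ℝ) ≤ d := by exact_mod_cast h3
        nlinarith
      have h8 : (1 - y) ^ d = ((1 - y) ^ m) ^ 2 * (1 - y) := by
        rw [hm, pow_succ, mul_comm 2 m, pow_mul]
      rw [h8]
      have h10 : ((1 + y) / 2) ^ 2 ≤ ((1 - y) ^ m) ^ 2 := pow_le_pow_left₀ (by linarith) h7 2
      nlinarith
  calc C / 4 * y ^ q * ((1 + μ)⁻¹) ^ d = C * y ^ q * (1 / 4 * ((1 + μ)⁻¹) ^ d) := by ring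
    _ ≤ C * y ^ q * ((1 - y) ^ d * ((1 + μ)⁻¹) ^ d) := by gcongr
    _ = C * y ^ q * ((1 - y) * (1 + μ)⁻¹) ^ d := by rw [mul_pow]
    _ ≤ _ := by
      refine mul_le_mul_of_nonneg_left (pow_le_pow_left₀ ?_ h1 d) (by positivity)
      exact mul_nonneg (by linarith) (by positivity)

include hw₀ hν hμ hC htail in
/-- Under the measure biased by `(x / (x + μ)) ^ d` the deficit `1 - x` is `o (d ^ (-1/2))` in
mean. -/
lemma tendsto_sqrt_mul_tilted_deficit :
    Tendsto (fun d : ℕ => Real.sqrt d * ((∫ x, (1 - x) * (x / (x + μ)) ^ d ∂ν) / mixedMass ν μ d))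
      atTop (𝓝 0) := by
  set c : ℝ := μ / (1 + μ) ^ 2 with hc
  have hc0 : 0 < c := by positivity
  -- Two scales are used: deficits are cut at `δ = d ^ (-3/4)` and the mass is bounded below by
  -- weights with deficit at most `y = 1 / d`. Then `√d * δ = d ^ (-1/4)` vanishes, and beyond the
  -- cut the exponential gain in `d * δ = d ^ (1/4)` beats the polynomial cost of `y ^ q`.
  set X : ℕ → ℝ := fun d => (d : ℝ) ^ (1 / 4 : ℝ) with hX
  have hXtop : Tendsto X atTop atTop :=
    (tendsto_rpow_atTop (by norm_num)).comp tendsto_natCast_atTop_atTop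
  have hlim : Tendsto (fun d => (X d)⁻¹ + C⁻¹ * Real.exp c * (X d ^ (4 * q + 2) *
      Real.exp (-c * X d))) atTop (𝓝 0) := by
    have h1 : Tendsto (fun x : ℝ => x ^ (4 * q + 2) * Real.exp (-c * x)) atTop (𝓝 0) := by
      have h := Real.tendsto_pow_mul_exp_neg_atTop_nhds_zero (4 * q + 2)
      have h2 := (h.comp (tendsto_id.const_mul_atTop hc0)).const_mul ((c ^ (4 * q + 2))⁻¹)
      rw [mul_zero] at h2
      refine h2.congr fun x => ?_
      simp only [Function.comp, id, mul_pow, neg_mul]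
      rw [← mul_assoc, ← mul_assoc, inv_mul_cancel₀ (by positivity), one_mul]
    have h3 := (h1.comp hXtop).const_mul (C⁻¹ * Real.exp c)
    simpa using (tendsto_inv_atTop_zero.comp hXtop).add h3
  have hMpos : ∀ d, 0 < mixedMass ν μ d := fun d =>
    lt_of_lt_of_le (by positivity) (mixedMass.pos hw₀ hν hμ d)
  have hint1 : ∀ d : ℕ, Integrable (fun x => (1 - x) * (x / (x + μ)) ^ d) ν := fun d => by
    refine Integrable.of_bound (C := 1) (Measurable.aestronglyMeasurable (by fun_prop)) ?_
    filter_upwards [hν] with x hx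
    have hx0 := hw₀.trans_le hx.1
    have h1 : (x / (x + μ)) ^ d ≤ 1 :=
      pow_le_one₀ (by positivity) ((div_le_one (by positivity)).2 (by linarith))
    have h2 : 0 ≤ (x / (x + μ)) ^ d := by positivity
    rw [Real.norm_eq_abs, abs_of_nonneg (mul_nonneg (by linarith) h2)]
    nlinarith
  refine squeeze_zero' (Eventually.of_forall fun d => ?_) ?_ hlim
  · refine mul_nonneg (Real.sqrt_nonneg _) (div_nonneg (integral_nonneg_of_ae ?_) (hMpos d).le)
    filter_upwards [hν] with x hx
    have hx0 := hw₀.trans_le hx.1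
    exact mul_nonneg (by linarith) (by positivity)
  · filter_upwards [hXtop.eventually_gt_atTop 1] with d hd
    have hd4 : X d ^ 4 = d := by
      simp only [hX]
      rw [← Real.rpow_natCast, ← Real.rpow_mul (Nat.cast_nonneg d)]
      norm_num
    set x₀ := X d with hx₀
    have hx0 : 0 < x₀ := by linarith
    have hsqrt : Real.sqrt d = x₀ ^ 2 := by
      rw [← hd4, show x₀ ^ 4 = (x₀ ^ 2) ^ 2 by ring, Real.sqrt_sq (by positivity)]
    have hδ1 : (x₀⁻¹) ^ 3 ≤ 1 := pow_le_one₀ (by positivity) (inv_le_one_of_one_le₀ hd.le)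
    have hy1 : (x₀⁻¹) ^ 4 < 1 := pow_lt_one₀ (by positivity) (inv_lt_one_of_one_lt₀ hd) (by simp)
    have hδy : (x₀⁻¹) ^ 4 ≤ (x₀⁻¹) ^ 3 :=
      pow_le_pow_of_le_one (by positivity) (inv_le_one_of_one_le₀ hd.le) (by norm_num)
    set δ := (x₀⁻¹) ^ 3
    set y := (x₀⁻¹) ^ 4
    have hnum : ∫ x, (1 - x) * (x / (x + μ)) ^ d ∂ν
        ≤ δ * mixedMass ν μ d + ((1 - δ) / (1 - δ + μ)) ^ d := by
      have h1 : ∫ x, (δ * (x / (x + μ)) ^ d + ((1 - δ) / (1 - δ + μ)) ^ d) ∂ν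
          = δ * mixedMass ν μ d + ((1 - δ) / (1 - δ + μ)) ^ d := by
        rw [integral_add ((mixedMass.integrable_pow hw₀ hν hμ d).const_mul _) (integrable_const _),
          integral_const_mul, mixedMass.eq_integral hw₀ hν hμ]
        simp
      rw [← h1]
      refine integral_mono_ae (hint1 d)
        (((mixedMass.integrable_pow hw₀ hν hμ d).const_mul _).add (integrable_const _)) ?_
      filter_upwards [hν] with x hx
      have hx0 := hw₀.trans_le hx.1
      have h2 : 0 ≤ (x / (x + μ)) ^ d := by positivity
      have h3 : 0 ≤ ((1 - δ) / (1 - δ + μ)) ^ d := by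
        have : 0 ≤ 1 - δ := by linarith
        positivity
      rcases le_or_gt (1 - x) δ with h | h
      · have := mul_le_mul_of_nonneg_right h h2
        linarith
      · have h4 : (x / (x + μ)) ^ d ≤ ((1 - δ) / (1 - δ + μ)) ^ d :=
          pow_le_pow_left₀ (by positivity) (div_add_mono hμ hx0.le (by linarith)) d
        have hδ0 : 0 ≤ δ := by positivity
        have h5 : (1 - x) * (x / (x + μ)) ^ d ≤ (x / (x + μ)) ^ d :=
          mul_le_of_le_one_left h2 (by linarith)
        have := mul_nonneg hδ0 h2
        linarith
    have hden : C * y ^ q * ((1 - y) / (1 - y + μ)) ^ d ≤ mixedMass ν μ d :=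
      mixedMass.ge_tail hw₀ hν hμ htail d (by positivity) hy1.le
    have hr : ((1 - δ) / (1 - δ + μ)) ^ d ≤
        ((1 - y) / (1 - y + μ)) ^ d * (Real.exp c * Real.exp (-c * x₀)) := by
      have h1 := div_add_le_mul_exp hμ (by linarith : 0 ≤ 1 - δ) (by linarith : 1 - δ ≤ 1 - y)
        (by linarith [show 0 < y by positivity])
      have h0 : 0 ≤ (1 - δ) / (1 - δ + μ) := by
        have : 0 ≤ 1 - δ := by linarith
        positivity
      have h2 := pow_le_pow_left₀ h0 h1 d
      rw [mul_pow, ← Real.exp_nat_mul] at h2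
      refine h2.trans_eq ?_
      rw [← Real.exp_add]
      congr 2
      rw [← hd4, ← hc]
      have h3 : x₀ ^ 4 * δ = x₀ := by
        simp only [δ]; field_simp
      have h4 : x₀ ^ 4 * y = 1 := by
        simp only [y]; field_simp
      linear_combination (-c) * h3 + c * h4
    have hyr : 0 < C * y ^ q * ((1 - y) / (1 - y + μ)) ^ d := by
      have : 0 < 1 - y := by linarith
      positivity
    have h7 : ((1 - δ) / (1 - δ + μ)) ^ d / mixedMass ν μ d ≤
        C⁻¹ * Real.exp c * (x₀ ^ (4 * q) * Real.exp (-c * x₀)) := by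
      rw [div_le_iff₀ (hMpos d)]
      refine hr.trans ?_
      refine le_trans (le_of_eq ?_) (mul_le_mul_of_nonneg_left hden
        (by positivity : 0 ≤ C⁻¹ * Real.exp c * (x₀ ^ (4 * q) * Real.exp (-c * x₀))))
      have h8 : x₀ ^ (4 * q) * y ^ q = 1 := by
        simp only [y]
        rw [pow_mul, ← mul_pow, ← mul_pow, mul_inv_cancel₀ hx0.ne']
        simp
      calc _ = ((1 - y) / (1 - y + μ)) ^ d * (Real.exp c * Real.exp (-c * x₀)) *
            (C⁻¹ * C) * (x₀ ^ (4 * q) * y ^ q) := by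
              rw [h8, inv_mul_cancel₀ hC.ne']; ring
        _ = _ := by ring
    rw [hsqrt]
    calc x₀ ^ 2 * ((∫ x, (1 - x) * (x / (x + μ)) ^ d ∂ν) / mixedMass ν μ d)
        ≤ x₀ ^ 2 * (δ + ((1 - δ) / (1 - δ + μ)) ^ d / mixedMass ν μ d) := by
          refine mul_le_mul_of_nonneg_left ?_ (by positivity)
          rw [div_le_iff₀ (hMpos d), add_mul, div_mul_cancel₀ _ (hMpos d).ne']
          exact hnum
      _ ≤ x₀ ^ 2 * (δ + C⁻¹ * Real.exp c * (x₀ ^ (4 * q) * Real.exp (-c * x₀))) := by gcongr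
      _ = x₀⁻¹ + C⁻¹ * Real.exp c * (x₀ ^ (4 * q + 2) * Real.exp (-c * x₀)) := by
          have h9 : x₀ ^ 2 * δ = x₀⁻¹ := by
            simp only [δ]; field_simp
          rw [mul_add, h9, pow_add]
          ring

end Tilt

/-! ### Central limit theorem for Gamma variables -/

section GammaLimit

/-- The linear terms of `exp (-y)` and `1 + y` cancel, which reflects the centring; the quadratic
term carries the variance. -/
lemma norm_exp_neg_mul_one_add_sub_le {y : ℂ} (hy : ‖y‖ ≤ 1) :
    ‖Complex.exp (-y) * (1 + y) - 1 + y ^ 2 / 2‖ ≤ 3 * ‖y‖ ^ 3 := by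
  have h := Complex.exp_bound (x := -y) (by simpa using hy) (n := 3) (by norm_num)
  simp only [Finset.sum_range_succ, Finset.sum_range_zero] at h
  set R := Complex.exp (-y) - (0 + (-y) ^ 0 / (Nat.factorial 0 : ℂ) + (-y) ^ 1 /
    (Nat.factorial 1 : ℂ) + (-y) ^ 2 / (Nat.factorial 2 : ℂ)) with hR
  have hR' : ‖R‖ ≤ ‖y‖ ^ 3 := by
    refine h.trans ?_
    rw [norm_neg]
    refine mul_le_of_le_one_right (by positivity) ?_
    norm_num [Nat.factorial]
  have hexp : Complex.exp (-y) = 1 - y + y ^ 2 / 2 + R := by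
    rw [hR]
    simp [Nat.factorial]
    ring
  have heq : Complex.exp (-y) * (1 + y) - 1 + y ^ 2 / 2 = y ^ 3 / 2 + R * (1 + y) := by
    rw [hexp]; ring
  rw [heq]
  have h1 : ‖1 + y‖ ≤ 2 := (norm_add_le _ _).trans (by simp; linarith)
  calc ‖y ^ 3 / 2 + R * (1 + y)‖ ≤ ‖y ^ 3 / 2‖ + ‖R * (1 + y)‖ := norm_add_le _ _
    _ ≤ ‖y‖ ^ 3 / 2 + ‖y‖ ^ 3 * 2 := by
        refine add_le_add ?_ ?_
        · rw [norm_div, norm_pow]; simp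
        · rw [norm_mul]
          exact mul_le_mul hR' h1 (norm_nonneg _) (by positivity)
    _ ≤ _ := by
        have : 0 ≤ ‖y‖ ^ 3 := by positivity
        linarith

/-- The characteristic function of a standardised sum of exponential variables converges to that
of a standard Gaussian variable. -/
lemma tendsto_charFun_gamma (u : ℝ) :
    Tendsto (fun d : ℕ => Complex.exp (Complex.I * (u * Real.sqrt d : ℝ)) *
      ((1 + Complex.I * (u / Real.sqrt d : ℝ))⁻¹) ^ d) atTop
      (𝓝 (Complex.exp (-(u : ℂ) ^ 2 / 2))) := by
  have hsqrt : Tendsto (fun d : ℕ => Real.sqrt d) atTop atTop :=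
    Real.tendsto_sqrt_atTop.comp tendsto_natCast_atTop_atTop
  have hdiv : Tendsto (fun d : ℕ => u / Real.sqrt d) atTop (𝓝 0) :=
    tendsto_const_nhds.div_atTop hsqrt
  -- The reciprocal of the characteristic function is treated first: it is the `d`-th power of `exp
  -- (-y) * (1 + y)` with `y = I * u / √d`, so the limit of `(1 + g / d) ^ d` applies.
  have hg : Tendsto (fun d : ℕ => (d : ℂ) * (Complex.exp (-(Complex.I * (u / Real.sqrt d : ℝ))) *
      (1 + Complex.I * (u / Real.sqrt d : ℝ)) - 1)) atTop (𝓝 ((u : ℂ) ^ 2 / 2)) := by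
    rw [tendsto_iff_norm_sub_tendsto_zero]
    have hb : Tendsto (fun d : ℕ => 3 * |u| ^ 3 / Real.sqrt d) atTop (𝓝 0) :=
      tendsto_const_nhds.div_atTop hsqrt
    refine squeeze_zero' (Eventually.of_forall fun d => norm_nonneg _) ?_ hb
    have hsmall : ∀ᶠ d : ℕ in atTop, |u / Real.sqrt d| < 1 := by
      have := (hdiv.abs).eventually (gt_mem_nhds (by simp : |(0 : ℝ)| < 1))
      simpa using this
    filter_upwards [hsmall, eventually_gt_atTop 0] with d hd hd0
    have hd0' : (0 : ℝ) < d := by exact_mod_cast hd0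
    have hs0 : 0 < Real.sqrt d := Real.sqrt_pos.2 hd0'
    have hnorm : ‖Complex.I * ((u / Real.sqrt d : ℝ) : ℂ)‖ = |u| / Real.sqrt d := by
      rw [norm_mul, Complex.norm_I, one_mul, Complex.norm_real, Real.norm_eq_abs, abs_div,
        abs_of_pos hs0]
    have h := norm_exp_neg_mul_one_add_sub_le (y := Complex.I * ((u / Real.sqrt d : ℝ) : ℂ)) (by
      rw [hnorm]
      rw [abs_div, abs_of_pos hs0] at hd
      exact hd.le)
    have hy2 : (d : ℂ) * (Complex.I * ((u / Real.sqrt d : ℝ) : ℂ)) ^ 2 = -(u : ℂ) ^ 2 := by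
      rw [mul_pow, Complex.I_sq, ← Complex.ofReal_pow, div_pow, Real.sq_sqrt hd0'.le]
      push_cast
      have : (d : ℂ) ≠ 0 := by exact_mod_cast hd0.ne'
      field_simp
    have heq : (d : ℂ) * (Complex.exp (-(Complex.I * (u / Real.sqrt d : ℝ))) *
        (1 + Complex.I * (u / Real.sqrt d : ℝ)) - 1) - (u : ℂ) ^ 2 / 2
        = (d : ℂ) * (Complex.exp (-(Complex.I * (u / Real.sqrt d : ℝ))) *
        (1 + Complex.I * (u / Real.sqrt d : ℝ)) - 1 +
          (Complex.I * (u / Real.sqrt d : ℝ)) ^ 2 / 2) := by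
      linear_combination (-1 / 2 : ℂ) * hy2
    rw [heq, norm_mul, Complex.norm_natCast]
    refine (mul_le_mul_of_nonneg_left h hd0'.le).trans_eq ?_
    rw [hnorm, div_pow]
    have h3 : Real.sqrt d ^ 3 = d * Real.sqrt d := by
      rw [pow_succ, Real.sq_sqrt hd0'.le]
    rw [h3]
    field_simp
  have h1 := Complex.tendsto_one_add_pow_exp_of_tendsto hg
  have h2 := h1.inv₀ (Complex.exp_ne_zero _)
  rw [← Complex.exp_neg] at h2
  have h3 : -((u : ℂ) ^ 2 / 2) = -(u : ℂ) ^ 2 / 2 := by ring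
  rw [h3] at h2
  refine h2.congr' ?_
  filter_upwards [eventually_gt_atTop 0] with d hd0
  have hd0' : (0 : ℝ) < d := by exact_mod_cast hd0
  rw [add_sub_cancel, mul_pow, mul_inv, inv_pow, ← Complex.exp_nat_mul, ← Complex.exp_neg]
  congr 2
  have h4 : (d : ℝ) * (u / Real.sqrt d) = u * Real.sqrt d := by
    have hs : Real.sqrt d * Real.sqrt d = d := Real.mul_self_sqrt hd0'.le
    have hs0 : 0 < Real.sqrt d := Real.sqrt_pos.2 hd0'
    field_simp
    rw [pow_two, hs, mul_comm]
  rw [← h4]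
  push_cast
  ring

lemma norm_pow_sub_pow_le_of_norm_le_one {a b : ℂ} (ha : ‖a‖ ≤ 1) (hb : ‖b‖ ≤ 1) (n : ℕ) :
    ‖a ^ n - b ^ n‖ ≤ n * ‖a - b‖ := by
  induction n with
  | zero => simp
  | succ n ih =>
    have h : a ^ (n + 1) - b ^ (n + 1) = a * (a ^ n - b ^ n) + (a - b) * b ^ n := by ring
    rw [h]
    refine (norm_add_le _ _).trans ?_
    rw [norm_mul, norm_mul, norm_pow]
    have h1 : ‖b‖ ^ n ≤ 1 := pow_le_one₀ (norm_nonneg _) hb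
    have h2 := mul_le_of_le_one_left (norm_nonneg (a ^ n - b ^ n)) ha
    have h3 := mul_le_of_le_one_right (norm_nonneg (a - b)) h1
    push_cast
    linarith

lemma norm_inv_one_add_I_mul_le_one (v : ℝ) : ‖(1 + Complex.I * (v : ℂ))⁻¹‖ ≤ 1 := by
  rw [norm_inv]
  refine inv_le_one_of_one_le₀ ?_
  have := Complex.abs_re_le_norm (1 + Complex.I * (v : ℂ))
  simpa using this

lemma norm_inv_one_add_I_mul_sub_le (v v' : ℝ) :
    ‖(1 + Complex.I * (v : ℂ))⁻¹ - (1 + Complex.I * (v' : ℂ))⁻¹‖ ≤ |v - v'| := by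
  have hne : ∀ v : ℝ, 1 + Complex.I * (v : ℂ) ≠ 0 := fun v h => by
    have := congrArg Complex.re h
    simp at this
  have h : (1 + Complex.I * (v : ℂ))⁻¹ - (1 + Complex.I * (v' : ℂ))⁻¹
      = (1 + Complex.I * (v : ℂ))⁻¹ * (1 + Complex.I * (v' : ℂ))⁻¹ *
        (Complex.I * ((v' - v : ℝ) : ℂ)) := by
    rw [inv_sub_inv (hne v) (hne v')]
    push_cast
    field_simp
    ring
  rw [h, norm_mul, norm_mul, norm_mul, Complex.norm_I, one_mul, Complex.norm_real,
    Real.norm_eq_abs, abs_sub_comm]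
  refine mul_le_of_le_one_left (abs_nonneg _) ?_
  exact mul_le_one₀ (norm_inv_one_add_I_mul_le_one v) (norm_nonneg _)
    (norm_inv_one_add_I_mul_le_one v')

end GammaLimit

/-! ### Central limit theorem for the mixed model -/

section MixedLimit

variable {ν : Measure ℝ} [IsProbabilityMeasure ν] {w₀ μ C : ℝ} {q : ℕ}
  (hw₀ : 0 < w₀) (hν : ∀ᵐ x ∂ν, w₀ ≤ x ∧ x ≤ 1) (hμ : 0 < μ)

include hw₀ hν hμ in
-- The integrand splits into the real bias `x / (x + μ)` and a factor `(1 + I * v)⁻¹` with `v = u /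
-- √d * ((1 + μ) / (x + μ))`, equal to `u / √d` at `x = 1`. Freezing `x = 1` in the second factor
-- costs at most `d * |u| / √d * (1 - x) / μ`, the biased deficit times `√d`.
lemma norm_integral_pow_sub_le {d : ℕ} (hd : 0 < d) (u : ℝ) :
    ‖∫ x : ℝ, ((x : ℂ) / (x + μ * (1 + Complex.I *
        (u / (μ / (1 + μ) * Real.sqrt d) : ℝ)))) ^ d ∂ν
      - (mixedMass ν μ d : ℂ) * ((1 + Complex.I * (u / Real.sqrt d : ℝ))⁻¹) ^ d‖
      ≤ |u| / μ * (Real.sqrt d * ∫ x, (1 - x) * (x / (x + μ)) ^ d ∂ν) := by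
  have hd0 : (0 : ℝ) < d := by exact_mod_cast hd
  have hs0 : 0 < Real.sqrt d := Real.sqrt_pos.2 hd0
  have hfac : ∀ x : ℝ, 0 < x → (x : ℂ) / (x + μ * (1 + Complex.I *
        (u / (μ / (1 + μ) * Real.sqrt d) : ℝ)))
      = ((x / (x + μ) : ℝ) : ℂ) *
        (1 + Complex.I * ((u / Real.sqrt d * ((1 + μ) / (x + μ)) : ℝ) : ℂ))⁻¹ := by
    intro x hx
    have hxμ : (x : ℂ) + μ ≠ 0 := by
      have : x + μ ≠ 0 := by positivity
      exact_mod_cast this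
    have h1 : (x : ℂ) + μ * (1 + Complex.I * (u / (μ / (1 + μ) * Real.sqrt d) : ℝ))
        = (x + μ) * (1 + Complex.I * ((u / Real.sqrt d * ((1 + μ) / (x + μ)) : ℝ) : ℂ)) := by
      have h2 : ((μ : ℂ)) * ((u / (μ / (1 + μ) * Real.sqrt d) : ℝ) : ℂ)
          = (x + μ) * ((u / Real.sqrt d * ((1 + μ) / (x + μ)) : ℝ) : ℂ) := by
        have h3 : μ * (u / (μ / (1 + μ) * Real.sqrt d))
            = (x + μ) * (u / Real.sqrt d * ((1 + μ) / (x + μ))) := by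
          field_simp
        exact_mod_cast h3
      linear_combination Complex.I * h2
    rw [h1]
    push_cast
    rw [div_mul_eq_div_div, div_eq_mul_inv (x / (x + μ) : ℂ)]
  have hM : (mixedMass ν μ d : ℂ) * ((1 + Complex.I * (u / Real.sqrt d : ℝ))⁻¹) ^ d
      = ∫ x : ℝ, (((x / (x + μ)) ^ d : ℝ) : ℂ) *
          ((1 + Complex.I * (u / Real.sqrt d : ℝ))⁻¹) ^ d ∂ν := by
    rw [integral_mul_const, integral_complex_ofReal, mixedMass.eq_integral hw₀ hν hμ]
  have hi1 : Integrable (fun x : ℝ => ((x : ℂ) / (x + μ * (1 + Complex.I *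
        (u / (μ / (1 + μ) * Real.sqrt d) : ℝ)))) ^ d) ν := by
    refine Integrable.of_bound (C := 1) (Measurable.aestronglyMeasurable (by fun_prop)) ?_
    filter_upwards [hν] with x hx
    have hx0 := hw₀.trans_le hx.1
    rw [hfac x hx0, norm_pow, norm_mul, Complex.norm_real, Real.norm_eq_abs,
      abs_of_nonneg (by positivity)]
    refine pow_le_one₀ (by positivity) (mul_le_one₀ ((div_le_one (by positivity)).2
      (by linarith)) (norm_nonneg _) (norm_inv_one_add_I_mul_le_one _))
  have hi2 : Integrable (fun x : ℝ => (((x / (x + μ)) ^ d : ℝ) : ℂ) *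
          ((1 + Complex.I * (u / Real.sqrt d : ℝ))⁻¹) ^ d) ν :=
    (mixedMass.integrable_pow hw₀ hν hμ d).ofReal.mul_const _
  rw [hM, ← integral_sub hi1 hi2, ← integral_const_mul, ← integral_const_mul]
  have hi3 : Integrable (fun x => |u| / μ * (Real.sqrt d * ((1 - x) * (x / (x + μ)) ^ d))) ν := by
    refine Integrable.const_mul (Integrable.const_mul ?_ _) _
    refine Integrable.of_bound (C := 1) (Measurable.aestronglyMeasurable (by fun_prop)) ?_
    filter_upwards [hν] with x hx
    have hx0 := hw₀.trans_le hx.1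
    have h1 : (x / (x + μ)) ^ d ≤ 1 :=
      pow_le_one₀ (by positivity) ((div_le_one (by positivity)).2 (by linarith))
    have h2 : 0 ≤ (x / (x + μ)) ^ d := by positivity
    rw [Real.norm_eq_abs, abs_of_nonneg (mul_nonneg (by linarith) h2)]
    nlinarith
  refine norm_integral_le_of_norm_le hi3 ?_
  filter_upwards [hν] with x hx
  have hx0 := hw₀.trans_le hx.1
  rw [hfac x hx0, mul_pow, ← Complex.ofReal_pow, ← mul_sub, norm_mul, Complex.norm_real,
    Real.norm_eq_abs, abs_of_nonneg (by positivity)]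
  have h1 := norm_pow_sub_pow_le_of_norm_le_one
    (norm_inv_one_add_I_mul_le_one (u / Real.sqrt d * ((1 + μ) / (x + μ))))
    (norm_inv_one_add_I_mul_le_one (u / Real.sqrt d)) d
  have h2 := norm_inv_one_add_I_mul_sub_le (u / Real.sqrt d * ((1 + μ) / (x + μ)))
    (u / Real.sqrt d)
  have h3 : u / Real.sqrt d * ((1 + μ) / (x + μ)) - u / Real.sqrt d
      = u / Real.sqrt d * ((1 - x) / (x + μ)) := by
    field_simp
    ring
  rw [h3, abs_mul, abs_div, abs_of_pos hs0,
    abs_of_nonneg (div_nonneg (by linarith : 0 ≤ 1 - x) (by positivity : 0 ≤ x + μ))] at h2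
  have h4 : (1 - x) / (x + μ) ≤ (1 - x) / μ :=
    div_le_div_of_nonneg_left (by linarith) hμ (by linarith)
  have h5 : (d : ℝ) * (|u| / Real.sqrt d * ((1 - x) / μ)) = |u| / μ * (Real.sqrt d * (1 - x)) := by
    have hs : Real.sqrt d * Real.sqrt d = d := Real.mul_self_sqrt hd0.le
    field_simp
    rw [pow_two, hs, mul_comm (d : ℝ)]
  calc (x / (x + μ)) ^ d * ‖_‖ ≤ (x / (x + μ)) ^ d *
        (d * (|u| / Real.sqrt d * ((1 - x) / μ))) := by
        refine mul_le_mul_of_nonneg_left ?_ (by positivity)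
        refine h1.trans (mul_le_mul_of_nonneg_left ?_ hd0.le)
        exact h2.trans (mul_le_mul_of_nonneg_left h4 (by positivity))
    _ = _ := by rw [h5]; ring

variable (hC : 0 < C) (htail : ∀ y, 0 < y → y ≤ 1 → C * y ^ q ≤ ν.real (Set.Ici (1 - y)))

include hw₀ hν hμ hC htail in
/-- Central limit theorem for the exponential time biased by `mixedTail`. -/
lemma tendsto_charFun_mixedTail (u : ℝ) :
    Tendsto (fun d : ℕ => (mixedMass ν μ d : ℂ)⁻¹ * ∫ t in Set.Ioi (0 : ℝ),
      ((Real.exp (-t) * mixedTail ν μ d t : ℝ) : ℂ) *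
        Complex.exp (Complex.I * (u * ((μ / (1 + μ) * d - t) / (μ / (1 + μ) * Real.sqrt d)) : ℝ)))
      atTop (𝓝 (Complex.exp (-(u : ℂ) ^ 2 / 2))) := by
  set b := μ / (1 + μ) with hb
  have hb0 : 0 < b := by positivity
  have hsqrt : Tendsto (fun d : ℕ => Real.sqrt d) atTop atTop :=
    Real.tendsto_sqrt_atTop.comp tendsto_natCast_atTop_atTop
  set z : ℕ → ℂ := fun d => 1 + Complex.I * (u / (b * Real.sqrt d) : ℝ) with hz
  have hzre : ∀ d, 0 < (z d).re := fun d => by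
    simp only [hz, Complex.add_re, Complex.one_re, Complex.mul_re, Complex.I_re, Complex.I_im,
      Complex.ofReal_im]
    norm_num
  have hz0 : ∀ d, z d ≠ 0 := fun d h => by
    have := hzre d
    rw [h] at this
    simp at this
  have hzlim : Tendsto z atTop (𝓝 1) := by
    have h1 : Tendsto (fun d : ℕ => u / (b * Real.sqrt d)) atTop (𝓝 0) :=
      tendsto_const_nhds.div_atTop (hsqrt.const_mul_atTop hb0)
    have h2 := ((Complex.continuous_ofReal.tendsto 0).comp h1).const_mul Complex.I
    simpa [hz] using h2.const_add (1 : ℂ)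
  have hMpos : ∀ d, 0 < mixedMass ν μ d := fun d =>
    lt_of_lt_of_le (by positivity) (mixedMass.pos hw₀ hν hμ d)
  -- The part of the phase linear in `t` joins `exp (-t)` to form `exp (-z d * t)`, so the closed
  -- transform applies; the constant part is the centring `exp (I * u * √d)`.
  have hrep : ∀ᶠ d : ℕ in atTop, (mixedMass ν μ d : ℂ)⁻¹ * ∫ t in Set.Ioi (0 : ℝ),
      ((Real.exp (-t) * mixedTail ν μ d t : ℝ) : ℂ) *
        Complex.exp (Complex.I * (u * ((b * d - t) / (b * Real.sqrt d)) : ℝ))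
      = (z d)⁻¹ * (Complex.exp (Complex.I * (u * Real.sqrt d : ℝ)) *
        ((mixedMass ν μ d : ℂ)⁻¹ * ∫ x : ℝ, ((x : ℂ) / (x + μ * z d)) ^ d ∂ν)) := by
    filter_upwards [eventually_gt_atTop 0] with d hd
    have hd0 : (0 : ℝ) < d := by exact_mod_cast hd
    have hs0 : 0 < Real.sqrt d := Real.sqrt_pos.2 hd0
    have h1 : ∀ t : ℝ, ((Real.exp (-t) * mixedTail ν μ d t : ℝ) : ℂ) *
        Complex.exp (Complex.I * (u * ((b * d - t) / (b * Real.sqrt d)) : ℝ))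
        = Complex.exp (Complex.I * (u * Real.sqrt d : ℝ)) *
          (Complex.exp (-(z d) * t) * (mixedTail ν μ d t : ℂ)) := fun t => by
      have h2 : u * ((b * d - t) / (b * Real.sqrt d))
          = u * Real.sqrt d - u / (b * Real.sqrt d) * t := by
        have hs : Real.sqrt d * Real.sqrt d = d := Real.mul_self_sqrt hd0.le
        field_simp
        linear_combination (-u * b) * hs
      rw [h2]
      push_cast
      have h3 : Complex.exp (-(t : ℂ)) * Complex.exp (Complex.I * (u * (Real.sqrt d : ℂ)
          - u / (b * (Real.sqrt d : ℂ)) * t)) =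
          Complex.exp (Complex.I * (u * (Real.sqrt d : ℂ))) * Complex.exp (-(z d) * t) := by
        rw [← Complex.exp_add, ← Complex.exp_add]
        congr 1
        simp only [hz]
        push_cast
        ring
      linear_combination (mixedTail ν μ d t : ℂ) * h3
    simp_rw [h1]
    rw [integral_const_mul, mixedTail.integral_cexp_mul hw₀ hν hμ d (hzre d)]
    ring
  refine Tendsto.congr' (hrep.mono fun d h => h.symm) ?_
  have hmain : Tendsto (fun d : ℕ => Complex.exp (Complex.I * (u * Real.sqrt d : ℝ)) *
        ((mixedMass ν μ d : ℂ)⁻¹ * ∫ x : ℝ, ((x : ℂ) / (x + μ * z d)) ^ d ∂ν)) atTop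
        (𝓝 (Complex.exp (-(u : ℂ) ^ 2 / 2))) := by
    have hψ := tendsto_charFun_gamma u
    have hT := (tendsto_sqrt_mul_tilted_deficit hw₀ hν hμ hC htail).const_mul (|u| / μ)
    rw [mul_zero] at hT
    have hdiff : Tendsto (fun d : ℕ => Complex.exp (Complex.I * (u * Real.sqrt d : ℝ)) *
        ((mixedMass ν μ d : ℂ)⁻¹ * ∫ x : ℝ, ((x : ℂ) / (x + μ * z d)) ^ d ∂ν)
        - Complex.exp (Complex.I * (u * Real.sqrt d : ℝ)) *
          ((1 + Complex.I * (u / Real.sqrt d : ℝ))⁻¹) ^ d) atTop (𝓝 0) := by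
      rw [tendsto_zero_iff_norm_tendsto_zero]
      refine squeeze_zero' (Eventually.of_forall fun d => norm_nonneg _) ?_ hT
      filter_upwards [eventually_gt_atTop 0] with d hd
      have h := norm_integral_pow_sub_le hw₀ hν hμ hd u
      have hM0 : (mixedMass ν μ d : ℂ) ≠ 0 := by exact_mod_cast (hMpos d).ne'
      have heq : Complex.exp (Complex.I * (u * Real.sqrt d : ℝ)) *
        ((mixedMass ν μ d : ℂ)⁻¹ * ∫ x : ℝ, ((x : ℂ) / (x + μ * z d)) ^ d ∂ν)
        - Complex.exp (Complex.I * (u * Real.sqrt d : ℝ)) *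
          ((1 + Complex.I * (u / Real.sqrt d : ℝ))⁻¹) ^ d
        = Complex.exp (Complex.I * (u * Real.sqrt d : ℝ)) * (mixedMass ν μ d : ℂ)⁻¹ *
          (∫ x : ℝ, ((x : ℂ) / (x + μ * z d)) ^ d ∂ν - (mixedMass ν μ d : ℂ) *
            ((1 + Complex.I * (u / Real.sqrt d : ℝ))⁻¹) ^ d) := by
        field_simp
      rw [heq, norm_mul, norm_mul, Complex.norm_exp_I_mul_ofReal, one_mul, norm_inv,
        Complex.norm_real, Real.norm_eq_abs, abs_of_pos (hMpos d)]
      refine (mul_le_mul_of_nonneg_left h (inv_nonneg.2 (hMpos d).le)).trans_eq ?_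
      ring
    simpa using hdiff.add hψ
  simpa using (hzlim.inv₀ one_ne_zero).mul hmain

include hw₀ hν hμ in
-- A Riemann-sum comparison. A cell has length at most one, so the phase varies in it by at most
-- `|u| / (b * √d)`; times beyond `log n` belong to no cell and form the second error.
lemma norm_sum_cellMass_mul_cexp_sub_le {d n : ℕ} (hd : 0 < d) (hn : 1 ≤ n) {b : ℝ} (hb : 0 < b)
    (u : ℝ) :
    ‖∑ j ∈ Finset.Ico 1 n, (cellMass ν μ n d j : ℂ) * Complex.exp (Complex.I *
        (u * ((b * d - (Real.log n - Real.log (j : ℝ))) / (b * Real.sqrt d)) : ℝ))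
      - ∫ t in Set.Ioi (0 : ℝ), ((Real.exp (-t) * mixedTail ν μ d t : ℝ) : ℂ) *
        Complex.exp (Complex.I * (u * ((b * d - t) / (b * Real.sqrt d)) : ℝ))‖
      ≤ |u| / (b * Real.sqrt d) * mixedMass ν μ d
        + ∫ t in Set.Ioi (Real.log n), Real.exp (-t) * mixedTail ν μ d t := by
  have hd0 : (0 : ℝ) < d := by exact_mod_cast hd
  have hs0 : 0 < Real.sqrt d := Real.sqrt_pos.2 hd0
  set X : ℝ → ℝ := fun t => u * ((b * d - t) / (b * Real.sqrt d)) with hX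
  have hXc : Continuous fun t => Complex.exp (Complex.I * (X t : ℝ)) := by
    simp only [hX]; fun_prop
  set f : ℝ → ℂ := fun t => ((Real.exp (-t) * mixedTail ν μ d t : ℝ) : ℂ) *
        Complex.exp (Complex.I * (X t : ℝ)) with hf
  have hI := mixedTail.integrableOn_exp_mul hw₀ hν hμ d
  have hfI : IntegrableOn f (Set.Ioi 0) := by
    refine Integrable.mul_bdd (c := 1) hI.ofReal hXc.aestronglyMeasurable
      (Eventually.of_forall fun t => ?_)
    rw [Complex.norm_exp_I_mul_ofReal]
  have hnonneg : ∀ t, 0 ≤ t → 0 ≤ Real.exp (-t) * mixedTail ν μ d t := fun t ht =>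
    mul_nonneg (Real.exp_pos _).le (mixedTail.nonneg hw₀ hν hμ d ht)
  have hfnorm : ∀ t, 0 ≤ t → ‖f t‖ = Real.exp (-t) * mixedTail ν μ d t := fun t ht => by
    rw [hf]
    simp only
    rw [norm_mul, Complex.norm_exp_I_mul_ofReal, mul_one, Complex.norm_real, Real.norm_eq_abs,
      abs_of_nonneg (hnonneg t ht)]
  have hlog := Real.log_natCast_nonneg n
  have hsplit : ∫ t in Set.Ioi (0 : ℝ), f t
      = (∑ j ∈ Finset.Ico 1 n, ∫ t in (Real.log n - Real.log ((j + 1 : ℕ) : ℝ))..(Real.log n -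
          Real.log (j : ℝ)), f t) + ∫ t in Set.Ioi (Real.log n), f t := by
    rw [sum_integral_cell hfI hn le_rfl, sub_self, ← setIntegral_union
      Set.Ioc_disjoint_Ioi_same measurableSet_Ioi
      (hfI.mono_set Set.Ioc_subset_Ioi_self) (hfI.mono_set (Set.Ioi_subset_Ioi hlog)),
      Set.Ioc_union_Ioi_eq_Ioi hlog]
  rw [hsplit, ← sub_sub, ← Finset.sum_sub_distrib]
  refine (norm_sub_le _ _).trans (add_le_add ?_ ?_)
  · refine (norm_sum_le _ _).trans ?_
    refine le_trans ?_ (mul_le_mul_of_nonneg_left (sum_cellMass_le hw₀ hν hμ d hn)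
      (by positivity))
    rw [Finset.mul_sum]
    refine Finset.sum_le_sum fun j hj => ?_
    obtain ⟨hj1, hjn⟩ := Finset.mem_Ico.1 hj
    have h0 : 0 ≤ Real.log n - Real.log ((j + 1 : ℕ) : ℝ) :=
      log_sub_log_nonneg (Nat.succ_pos j) hjn
    have hle := cell_le (n := n) (j := j) hj1
    have hreal := intervalIntegrable_exp_mul_mixedTail hw₀ hν hμ d h0 (h0.trans hle)
    have hfi : IntervalIntegrable f volume (Real.log n - Real.log ((j + 1 : ℕ) : ℝ))
        (Real.log n - Real.log (j : ℝ)) :=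
      ⟨hfI.mono_set fun _ hx => Set.mem_Ioi.2 (h0.trans_lt hx.1),
        hfI.mono_set fun _ hx => Set.mem_Ioi.2 ((h0.trans hle).trans_lt hx.1)⟩
    have hcomplex : IntervalIntegrable
        (fun t => ((Real.exp (-t) * mixedTail ν μ d t : ℝ) : ℂ)) volume
        (Real.log n - Real.log ((j + 1 : ℕ) : ℝ)) (Real.log n - Real.log (j : ℝ)) :=
      ⟨hreal.1.ofReal, hreal.2.ofReal⟩
    rw [cellMass, ← intervalIntegral.integral_ofReal, ← intervalIntegral.integral_mul_const,
      ← intervalIntegral.integral_sub (hcomplex.mul_const _) hfi,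
      ← intervalIntegral.integral_const_mul]
    refine intervalIntegral.norm_integral_le_of_norm_le hle ?_ (hreal.const_mul _)
    refine Eventually.of_forall fun t ht => ?_
    have ht0 : 0 ≤ t := h0.trans ht.1.le
    simp only [hf]
    rw [← mul_sub, norm_mul, Complex.norm_real, Real.norm_eq_abs, abs_of_nonneg (hnonneg t ht0),
      mul_comm]
    refine mul_le_mul_of_nonneg_right ?_ (hnonneg t ht0)
    have h1 : ∀ x y : ℝ, ‖Complex.exp (Complex.I * (x : ℂ)) - Complex.exp (Complex.I * (y : ℂ))‖
        ≤ |x - y| := fun x y => by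
      have h2 : Complex.exp (Complex.I * (x : ℂ)) - Complex.exp (Complex.I * (y : ℂ))
          = Complex.exp (Complex.I * (y : ℂ)) *
            (Complex.exp (Complex.I * ((x - y : ℝ) : ℂ)) - 1) := by
        rw [mul_sub, ← Complex.exp_add, mul_one]
        push_cast
        ring_nf
      rw [h2, norm_mul, Complex.norm_exp_I_mul_ofReal, one_mul]
      exact Real.norm_exp_I_mul_ofReal_sub_one_le
    refine (h1 _ _).trans ?_
    have h3 : u * ((b * d - (Real.log n - Real.log (j : ℝ))) / (b * Real.sqrt d)) - X t
        = u / (b * Real.sqrt d) * (t - (Real.log n - Real.log (j : ℝ))) := by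
      simp only [hX]
      ring
    rw [h3, abs_mul, abs_div, abs_of_pos (by positivity : 0 < b * Real.sqrt d)]
    refine mul_le_of_le_one_right (by positivity) ?_
    have hj0 : (0 : ℝ) < j := by exact_mod_cast hj1
    have h4 := WRT.log_succ_sub_log_le_inv hj1
    have h5 : (j : ℝ)⁻¹ ≤ 1 := inv_le_one_of_one_le₀ (by exact_mod_cast hj1)
    rw [abs_le]
    constructor
    · linarith [ht.1]
    · linarith [ht.2]
  · refine norm_integral_le_of_norm_le (hI.mono_set (Set.Ioi_subset_Ioi hlog)) ?_
    refine (ae_restrict_iff' measurableSet_Ioi).2 (Eventually.of_forall fun t ht => ?_)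
    rw [hfnorm t (hlog.trans (le_of_lt ht))]

end MixedLimit

/-! ### Concentration of the partial weight sums -/

namespace WRT

section GoodEvent

variable {Ω : Type*} [mΩ : MeasurableSpace Ω] {P : Measure Ω} [IsProbabilityMeasure P]
  {ν : Measure ℝ} {W : ℕ → Ω → ℝ} {parent : ℕ → Ω → ℕ} {w₀ μ : ℝ}

/-- The event that the weights are good. -/
def goodEvent (W : ℕ → Ω → ℝ) (μ η : ℝ) (L n : ℕ) : Set Ω :=
  {ω | GoodWeights μ η L n fun i => W i ω}

omit mΩ in
lemma measurableSet_goodEvent (μ η : ℝ) (L n : ℕ) :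
    MeasurableSet[weightSigma W] (goodEvent W μ η L n) := by
  have h : goodEvent W μ η L n = ⋂ m, ⋂ (_ : L ≤ m), ⋂ (_ : m < n),
      ({ω | (1 - η) * μ * m ≤ ∑ j ∈ Finset.range m, W j ω} ∩
        {ω | ∑ j ∈ Finset.range m, W j ω ≤ (1 + η) * μ * m}) := by
    ext ω
    simp [goodEvent, GoodWeights]
  rw [h]
  have hS : ∀ m, Measurable[weightSigma W] fun ω => ∑ j ∈ Finset.range m, W j ω := fun m =>
    Finset.measurable_sum _ fun j _ => measurable_weight_weightSigma j
  refine MeasurableSet.iInter fun m => MeasurableSet.iInter fun _ => MeasurableSet.iInter fun _ =>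
    MeasurableSet.inter ?_ ?_
  · exact (hS m) measurableSet_Ici
  · exact (hS m) measurableSet_Iic

omit [IsProbabilityMeasure P] in
lemma ae_weights_mem (hT : IsWeightedRecursiveTree P ν W parent)
    (hν : ∀ᵐ x ∂ν, w₀ ≤ x ∧ x ≤ 1) : ∀ᵐ ω ∂P, ∀ i, w₀ ≤ W i ω ∧ W i ω ≤ 1 := by
  rw [ae_all_iff]
  intro i
  have h := hT.weight_law i
  rw [← h] at hν
  exact ae_of_ae_map (hT.measurable_weight i).aemeasurable hν

omit [IsProbabilityMeasure P] in
lemma integral_weight (hT : IsWeightedRecursiveTree P ν W parent) (i : ℕ) :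
    ∫ ω, W i ω ∂P = ∫ x, x ∂ν := by
  rw [← hT.weight_law i]
  exact (integral_map (f := fun x => x) (hT.measurable_weight i).aemeasurable
    aestronglyMeasurable_id).symm

/-- The partial sums of the weights concentrate. -/
lemma measureReal_compl_goodEvent_le (hT : IsWeightedRecursiveTree P ν W parent)
    (hw₀ : 0 < w₀) (hν : ∀ᵐ x ∂ν, w₀ ≤ x ∧ x ≤ 1) (hμ : 0 < μ) (hμν : ∫ x, x ∂ν = μ) {η : ℝ}
    (hη : 0 ≤ η) {L n : ℕ} (hL : 1 ≤ L) :
    P.real (goodEvent W μ η L n)ᶜ ≤ n * (2 * Real.exp (-2 * (η * μ) ^ 2 * L)) := by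
  have hW := ae_weights_mem hT hν
  set X : ℕ → Ω → ℝ := fun i ω => W i ω - μ with hX
  have hXind : iIndepFun X P :=
    hT.weight_indep.comp (fun _ x => x - μ) fun _ => measurable_id.sub_const μ
  have hXneg : iIndepFun (fun i ω => -X i ω) P :=
    hXind.comp (fun _ x => -x) fun _ => measurable_neg
  -- Hoeffding's lemma for values in `[0, 1]`, with variance proxy `1 / 4`; a union bound over `m <
  -- n` and both signs follows.
  have hsub : ∀ i, HasSubgaussianMGF (X i) ((‖(1 : ℝ) - 0‖₊ / 2) ^ 2) P := fun i => by
    have h := hasSubgaussianMGF_of_mem_Icc (a := 0) (b := 1) (μ := P) (X := W i)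
      (hT.measurable_weight i).aemeasurable (by
        filter_upwards [hW] with ω hω
        exact ⟨hw₀.le.trans (hω i).1, (hω i).2⟩)
    rwa [integral_weight hT, hμν] at h
  have hpair : ∀ m, L ≤ m → P.real {ω | η * μ * m ≤ ∑ j ∈ Finset.range m, X j ω}
      ≤ Real.exp (-2 * (η * μ) ^ 2 * L) ∧
      P.real {ω | η * μ * m ≤ ∑ j ∈ Finset.range m, -X j ω}
      ≤ Real.exp (-2 * (η * μ) ^ 2 * L) := by
    intro m hm
    have hm0 : (0 : ℝ) < m := by
      have : 0 < m := by omega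
      exact_mod_cast this
    have hLm : (L : ℝ) ≤ m := by exact_mod_cast hm
    have hexp : Real.exp (-(η * μ * m) ^ 2 / (2 * m * ((‖(1 : ℝ) - 0‖₊ / 2) ^ 2 : NNReal)))
        ≤ Real.exp (-2 * (η * μ) ^ 2 * L) := by
      rw [Real.exp_le_exp]
      have : -(η * μ * m) ^ 2 / (2 * m * ((‖(1 : ℝ) - 0‖₊ / 2) ^ 2 : NNReal))
          = -2 * (η * μ) ^ 2 * m := by
        simp
        field_simp
      rw [this]
      nlinarith [sq_nonneg (η * μ)]
    exact ⟨(HasSubgaussianMGF.measure_sum_range_ge_le_of_iIndepFun hXind (fun i _ => hsub i)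
        (by positivity)).trans hexp,
      (HasSubgaussianMGF.measure_sum_range_ge_le_of_iIndepFun hXneg (fun i _ => (hsub i).neg)
        (by positivity)).trans hexp⟩
  have hsum : ∀ m ω, ∑ j ∈ Finset.range m, X j ω = ∑ j ∈ Finset.range m, W j ω - m * μ :=
    fun m ω => by simp [hX, Finset.sum_sub_distrib]
  have hcover : (goodEvent W μ η L n)ᶜ ⊆ ⋃ m ∈ (Finset.range n).filter (L ≤ ·),
      ({ω | η * μ * m ≤ ∑ j ∈ Finset.range m, X j ω} ∪
        {ω | η * μ * m ≤ ∑ j ∈ Finset.range m, -X j ω}) := by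
    intro ω hω
    simp only [goodEvent, GoodWeights, Set.mem_compl_iff, Set.mem_ofPred_eq, not_forall] at hω
    obtain ⟨m, hm, hmn, h⟩ := hω
    refine Set.mem_biUnion (x := m) (by simp [hm, hmn]) ?_
    rw [not_and_or, not_le, not_le] at h
    simp only [Set.mem_union, Set.mem_ofPred_eq, Finset.sum_neg_distrib, hsum]
    rcases h with h | h
    · right; linarith
    · left; linarith
  refine (measureReal_mono hcover (measure_ne_top P _)).trans ((measureReal_biUnion_finset_le _ _).trans ?_)
  refine (Finset.sum_le_card_nsmul _ _ (2 * Real.exp (-2 * (η * μ) ^ 2 * L))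
    fun m hm => ?_).trans ?_
  · have h := hpair m (Finset.mem_filter.1 hm).2
    refine (measureReal_union_le _ _).trans ?_
    linarith [h.1, h.2]
  · rw [nsmul_eq_mul]
    refine mul_le_mul_of_nonneg_right ?_ (by positivity)
    have := Finset.card_filter_le (Finset.range n) (L ≤ ·)
    rw [Finset.card_range] at this
    exact_mod_cast this

end GoodEvent

/-! ### Averaging the degree tails over the weights -/

section Expectation

variable {Ω : Type*} [mΩ : MeasurableSpace Ω] {P : Measure Ω} [IsProbabilityMeasure P]
  {ν : Measure ℝ} {W : ℕ → Ω → ℝ} {parent : ℕ → Ω → ℕ} {w₀ μ η : ℝ} {L n : ℕ}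
  {ι : Type*} [Fintype ι] [DecidableEq ι]

omit [IsProbabilityMeasure P] [DecidableEq ι] in
lemma integral_prod_weights (hT : IsWeightedRecursiveTree P ν W parent)
    {a : ι → ℕ} (ha : Function.Injective a) {f : ι → ℝ → ℝ} (hf : ∀ i, Measurable (f i)) :
    ∫ ω, ∏ i, f i (W (a i) ω) ∂P = ∏ i, ∫ x, f i x ∂ν := by
  have h := (hT.weight_indep.precomp ha).integral_fun_prod_comp (f := f)
    (fun i => (hT.measurable_weight (a i)).aemeasurable)
    (fun i => (hf i).aestronglyMeasurable)
  rw [h]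
  refine Finset.prod_congr rfl fun i _ => ?_
  rw [← hT.weight_law (a i), integral_map (hT.measurable_weight (a i)).aemeasurable
    (hf i).aestronglyMeasurable]

omit [DecidableEq ι] in
lemma integrable_prod_weights (hT : IsWeightedRecursiveTree P ν W parent)
    (hν : ∀ᵐ x ∂ν, w₀ ≤ x ∧ x ≤ 1)
    (a : ι → ℕ) {f : ι → ℝ → ℝ} (hf : ∀ i, Measurable (f i)) {K : ι → ℝ}
    (hK : ∀ i x, w₀ ≤ x → x ≤ 1 → |f i x| ≤ K i) :
    Integrable (fun ω => ∏ i, f i (W (a i) ω)) P := by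
  refine integrable_of_ae_abs_le (C := ∏ i, K i)
    (Finset.measurable_prod _ fun i _ => (hf i).comp (hT.measurable_weight (a i))) ?_
  filter_upwards [ae_weights_mem hT hν] with ω hω
  rw [Finset.abs_prod]
  exact Finset.prod_le_prod (fun i _ => abs_nonneg _) fun i _ =>
    hK i _ (hω (a i)).1 (hω (a i)).2

/-- Upper bound for the degree tail of the vertex `a`, averaged over its weight. -/
noncomputable def upperFactor (ν : Measure ℝ) (w₀ μ η s : ℝ) (L n d a : ℕ) : ℝ :=
  if a < L then (s⁻¹) ^ d * Real.exp ((s - 1) *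
      (w₀⁻¹ * (1 + Real.log L) + (μ * (1 - η))⁻¹ * (1 + Real.log n)))
  else ((1 - 2 * η)⁻¹) ^ d * mixedTail ν μ d (Real.log n - Real.log a)

lemma abs_poissonTail_le_one (hw₀ : 0 < w₀) (hμ : 0 < μ) {x t : ℝ} (hx : w₀ ≤ x) (ht : 0 ≤ t)
    (d : ℕ) : |poissonTail (x / μ * t) d| ≤ 1 := by
  have h0 : 0 ≤ x / μ * t := by
    have := hw₀.trans_le hx
    positivity
  rw [abs_of_nonneg (poissonTail.nonneg h0 d)]
  exact poissonTail.le_one h0 d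

lemma measurable_poissonTail_mul (μ t : ℝ) (d : ℕ) :
    Measurable fun x : ℝ => poissonTail (x / μ * t) d := by
  have := poissonTail.continuous d
  exact Continuous.measurable (by fun_prop)

lemma integral_indicator_goodEvent_mul (hT : IsWeightedRecursiveTree P ν W parent)
    (hw₀ : 0 < w₀) (hν : ∀ᵐ x ∂ν, w₀ ≤ x ∧ x ≤ 1) (μ η : ℝ) (L n : ℕ)
    {a : ι → ℕ} (ha : Function.Injective a) (d : ι → ℕ) :
    Integrable (fun ω => (goodEvent W μ η L n).indicator (fun _ => (1 : ℝ)) ω *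
      jointTail (fun m i => attachProb (fun j => W j ω) m (a i)) n d) P ∧
    ∫ ω, (goodEvent W μ η L n).indicator (fun _ => (1 : ℝ)) ω *
      jointTail (fun m i => attachProb (fun j => W j ω) m (a i)) n d ∂P
      = P.real (goodEvent W μ η L n ∩ vertexDegreeEvent parent n a d) := by
  have hpos : ∀ᵐ ω ∂P, ∀ i, 0 < W i ω := by
    filter_upwards [ae_weights_mem hT hν] with ω hω i
    exact hw₀.trans_le (hω i).1
  have h := integral_mul_indicator_vertexDegreeEvent hT hpos ha n d (C := 1)
    (measurable_const.indicator (measurableSet_goodEvent (W := W) μ η L n) :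
      Measurable[weightSigma W] ((goodEvent W μ η L n).indicator fun _ => (1 : ℝ)))
    (Eventually.of_forall fun ω => by
      by_cases h : ω ∈ goodEvent W μ η L n <;> simp [h])
  refine ⟨h.1, h.2.symm.trans ?_⟩
  have hG : MeasurableSet (goodEvent W μ η L n) :=
    weightSigma_le hT _ (measurableSet_goodEvent μ η L n)
  have hE : MeasurableSet (vertexDegreeEvent parent n a d) :=
    history_le hT n _ (measurableSet_vertexDegreeEvent n a d)
  rw [← integral_indicator_one (hG.inter hE), Set.inter_indicator_one]
  rfl

/-- Given good weights, the joint tail is at most a product whose factors are deterministic for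
small labels and depend on the vertex's own weight otherwise. Independence of the weights then
factorises the expectation. -/
lemma measureReal_vertexDegreeEvent_le (hT : IsWeightedRecursiveTree P ν W parent)
    (hw₀ : 0 < w₀) (hν : ∀ᵐ x ∂ν, w₀ ≤ x ∧ x ≤ 1) (hμ : 0 < μ)
    (hη0 : 0 ≤ η) (hη1 : η < 1 / 2) (hL0 : 1 ≤ L) (hL : 1 ≤ η * μ * L) {s : ℝ} (hs : 1 ≤ s)
    {a : ι → ℕ} (ha : Function.Injective a) (han : ∀ i, a i < n) (d : ι → ℕ) :
    P.real (vertexDegreeEvent parent n a d) ≤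
      ∏ i, upperFactor ν w₀ μ η s L n (d i) (a i) + P.real (goodEvent W μ η L n)ᶜ := by
  have hνp : IsProbabilityMeasure ν := by
    rw [← hT.weight_law 0]
    exact Measure.isProbabilityMeasure_map (hT.measurable_weight 0).aemeasurable
  have hGm : MeasurableSet (goodEvent W μ η L n) :=
    weightSigma_le hT _ (measurableSet_goodEvent μ η L n)
  have hsplit : P.real (vertexDegreeEvent parent n a d) ≤
      P.real (goodEvent W μ η L n ∩ vertexDegreeEvent parent n a d)
        + P.real (goodEvent W μ η L n)ᶜ := by
    refine (measureReal_mono ?_).trans (measureReal_union_le _ _)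
    intro ω hω
    by_cases h : ω ∈ goodEvent W μ η L n
    · exact Or.inl ⟨h, hω⟩
    · exact Or.inr h
  refine hsplit.trans (add_le_add_left ?_ _)
  obtain ⟨hint, heq⟩ := integral_indicator_goodEvent_mul hT hw₀ hν μ η L n ha d
  rw [← heq]
  set B : ℕ → ℝ := fun d => (s⁻¹) ^ d * Real.exp ((s - 1) *
      (w₀⁻¹ * (1 + Real.log L) + (μ * (1 - η))⁻¹ * (1 + Real.log n))) with hB
  set f : ι → ℝ → ℝ := fun i x => if a i < L then B (d i) else
    ((1 - 2 * η)⁻¹) ^ (d i) * poissonTail (x / μ * (Real.log n - Real.log (a i))) (d i) with hf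
  have hlog : ∀ i, ¬ a i < L → 0 ≤ Real.log n - Real.log (a i) := fun i hi =>
    log_sub_log_nonneg (by omega) (han i).le
  have hη' : 0 < 1 - 2 * η := by linarith
  have hfm : ∀ i, Measurable (f i) := fun i => by
    simp only [hf]
    split_ifs
    · exact measurable_const
    · exact (measurable_poissonTail_mul _ _ _).const_mul _
  have hfi : ∀ i, ∫ x, f i x ∂ν = upperFactor ν w₀ μ η s L n (d i) (a i) := fun i => by
    simp only [hf, upperFactor]
    split_ifs
    · simp [hB]
    · rw [integral_const_mul, mixedTail]
  rw [← Finset.prod_congr rfl fun i _ => hfi i, ← integral_prod_weights hT ha hfm]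
  refine integral_mono_ae hint (integrable_prod_weights hT hν a hfm
    (K := fun i => |B (d i)| + ((1 - 2 * η)⁻¹) ^ (d i)) fun i x hx _ => ?_) ?_
  · simp only [hf]
    split_ifs with h
    · exact le_add_of_nonneg_right (by positivity)
    · rw [abs_mul, abs_of_nonneg (by positivity : (0 : ℝ) ≤ ((1 - 2 * η)⁻¹) ^ (d i))]
      exact (mul_le_of_le_one_right (by positivity)
        (abs_poissonTail_le_one hw₀ hμ hx (hlog i h) _)).trans
        (le_add_of_nonneg_left (abs_nonneg _))
  · filter_upwards [ae_weights_mem hT hν] with ω hω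
    have hf0 : 0 ≤ ∏ i, f i (W (a i) ω) := by
      refine Finset.prod_nonneg fun i _ => ?_
      simp only [hf]
      split_ifs with h
      · simp only [hB]; positivity
      · have := hw₀.trans_le (hω (a i)).1
        have := hlog i h
        exact mul_nonneg (by positivity) (poissonTail.nonneg (by positivity) _)
    by_cases h : ω ∈ goodEvent W μ η L n
    · rw [Set.indicator_of_mem h, one_mul]
      have hpos : ∀ i, 0 < W i ω := fun i => hw₀.trans_le (hω i).1
      refine (jointTail.le_prod_bernoulliTail (fun m i => attachProb_nonneg hpos m (a i))
        (fun m => sum_attachProb_comp_le_one hpos m ha) n d).trans ?_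
      refine Finset.prod_le_prod (fun i _ => (bernoulliTail.nonneg_and_le_pred
        (fun m => attachProb_nonneg hpos m (a i)) (fun m => attachProb_le_one hpos m (a i))
        n (d i)).1) fun i _ => ?_
      simp only [hf]
      split_ifs with hi
      · exact bernoulliTail_attachProb_le_exp hw₀ (fun i => (hω i).1) (fun i => (hω i).2) hμ hη1
          h hs (a i) (d i)
      · exact bernoulliTail_attachProb_le hw₀ (fun i => (hω i).1) (fun i => (hω i).2) hμ hη0 hη1
          hL0 hL h (not_lt.1 hi) (han i) (d i)
    · rw [Set.indicator_of_notMem h, zero_mul]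
      exact hf0

/-- The lower bound for good weights is averaged over all weights, so that independence can be used
without conditioning on the good event. The subtracted probability compensates for the bad weights.
-/
lemma le_measureReal_vertexDegreeEvent (hT : IsWeightedRecursiveTree P ν W parent)
    (hw₀ : 0 < w₀) (hν : ∀ᵐ x ∂ν, w₀ ≤ x ∧ x ≤ 1) (hμ : 0 < μ)
    (hη0 : 0 ≤ η) (hη1 : η < 1 / 2) (hL0 : 1 ≤ L) (hL : 1 ≤ η * μ * L)
    {a : ι → ℕ} (ha : Function.Injective a) (haL : ∀ i, L ≤ a i) (han : ∀ i, a i < n)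
    (d : ι → ℕ) :
    ((1 + η)⁻¹) ^ (∑ i, d i) *
        ∏ i, mixedTail ν μ (d i) (Real.log n - Real.log ((a i + 1 : ℕ) : ℝ))
      - 6 * 2 ^ Fintype.card ι * (Fintype.card ι) ^ 2 * (w₀⁻¹) ^ 2 * (L : ℝ)⁻¹ *
        (((1 - 2 * η)⁻¹) ^ (∑ i, d i) *
          ∏ i, mixedTail ν μ (d i - 2) (Real.log n - Real.log (a i)))
      - P.real (goodEvent W μ η L n)ᶜ
      ≤ P.real (vertexDegreeEvent parent n a d) := by
  have hGm : MeasurableSet (goodEvent W μ η L n) :=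
    weightSigma_le hT _ (measurableSet_goodEvent μ η L n)
  obtain ⟨hint, heq⟩ := integral_indicator_goodEvent_mul hT hw₀ hν μ η L n ha d
  refine le_trans ?_ (measureReal_mono
    (Set.inter_subset_right : goodEvent W μ η L n ∩ vertexDegreeEvent parent n a d ⊆ _))
  rw [← heq]
  have hη' : 0 < 1 - 2 * η := by linarith
  set K : ℝ := 6 * 2 ^ Fintype.card ι * (Fintype.card ι) ^ 2 * (w₀⁻¹) ^ 2 * (L : ℝ)⁻¹ with hK
  have hK0 : 0 ≤ K := by positivity
  set f : ι → ℝ → ℝ := fun i x =>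
    poissonTail (x / μ * (Real.log n - Real.log ((a i + 1 : ℕ) : ℝ))) (d i) with hf
  set g : ι → ℝ → ℝ := fun i x =>
    poissonTail (x / μ * (Real.log n - Real.log (a i))) (d i - 2) with hg
  have hlog1 : ∀ i, 0 ≤ Real.log n - Real.log ((a i + 1 : ℕ) : ℝ) := fun i =>
    log_sub_log_nonneg (Nat.succ_pos _) (han i)
  have hlog : ∀ i, 0 ≤ Real.log n - Real.log (a i) := fun i =>
    log_sub_log_nonneg (hL0.trans (haL i)) (han i).le
  have hfm : ∀ i, Measurable (f i) := fun i => measurable_poissonTail_mul _ _ _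
  have hgm : ∀ i, Measurable (g i) := fun i => measurable_poissonTail_mul _ _ _
  have hfI : Integrable (fun ω => ∏ i, f i (W (a i) ω)) P :=
    integrable_prod_weights hT hν a hfm (K := fun _ => 1) fun i x hx _ =>
      abs_poissonTail_le_one hw₀ hμ hx (hlog1 i) _
  have hgI : Integrable (fun ω => ∏ i, g i (W (a i) ω)) P :=
    integrable_prod_weights hT hν a hgm (K := fun _ => 1) fun i x hx _ =>
      abs_poissonTail_le_one hw₀ hμ hx (hlog i) _
  have hcI : Integrable ((goodEvent W μ η L n)ᶜ.indicator fun _ => (1 : ℝ)) P :=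
    (integrable_const 1).indicator hGm.compl
  have hfe : ∏ i, mixedTail ν μ (d i) (Real.log n - Real.log ((a i + 1 : ℕ) : ℝ))
      = ∫ ω, ∏ i, f i (W (a i) ω) ∂P := by
    rw [integral_prod_weights hT ha hfm]
    rfl
  have hge : ∏ i, mixedTail ν μ (d i - 2) (Real.log n - Real.log (a i))
      = ∫ ω, ∏ i, g i (W (a i) ω) ∂P := by
    rw [integral_prod_weights hT ha hgm]
    rfl
  have hce : P.real (goodEvent W μ η L n)ᶜ
      = ∫ ω, (goodEvent W μ η L n)ᶜ.indicator (fun _ => (1 : ℝ)) ω ∂P :=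
    (integral_indicator_one hGm.compl).symm
  have h1 := hfI.const_mul (((1 + η)⁻¹) ^ (∑ i, d i))
  have h2 := (hgI.const_mul (((1 - 2 * η)⁻¹) ^ (∑ i, d i))).const_mul K
  rw [hfe, hge, hce, ← integral_const_mul, ← integral_const_mul, ← integral_const_mul,
    ← integral_sub h1 h2]
  refine (integral_sub (h1.sub h2) hcI).symm.trans_le ?_
  refine integral_mono_ae ((h1.sub h2).sub hcI) hint ?_
  filter_upwards [ae_weights_mem hT hν] with ω hω
  have hpos : ∀ i, 0 < W i ω := fun i => hw₀.trans_le (hω i).1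
  have hg0 : 0 ≤ ∏ i, g i (W (a i) ω) := Finset.prod_nonneg fun i _ => by
    have := hpos (a i)
    have := hlog i
    exact poissonTail.nonneg (by positivity) _
  simp only [Pi.sub_apply]
  by_cases h : ω ∈ goodEvent W μ η L n
  · rw [Set.indicator_of_mem h, one_mul,
      Set.indicator_of_notMem (by simpa using h), sub_zero]
    exact le_jointTail_attachProb hw₀ (fun i => (hω i).1) (fun i => (hω i).2) hμ hη0 hη1 hL0 hL
      h ha haL han d
  -- For bad weights the main term is at most one and the subtracted indicator equals one, so the
  -- integrand on the left is at most zero.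
  · rw [Set.indicator_of_notMem h, zero_mul, Set.indicator_of_mem (by simpa using h)]
    have hf1 : ∏ i, f i (W (a i) ω) ≤ 1 := by
      refine Finset.prod_le_one (fun i _ => ?_) fun i _ => ?_
      · have := hpos (a i)
        have := hlog1 i
        exact poissonTail.nonneg (by positivity) _
      · exact (le_abs_self _).trans
          (abs_poissonTail_le_one hw₀ hμ (hω (a i)).1 (hlog1 i) _)
    have hρ : ((1 + η)⁻¹) ^ (∑ i, d i) ≤ 1 :=
      pow_le_one₀ (by positivity) (inv_le_one_of_one_le₀ (by linarith))
    have h3 : ((1 + η)⁻¹) ^ (∑ i, d i) * ∏ i, f i (W (a i) ω) ≤ 1 := by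
      refine (mul_le_mul_of_nonneg_left hf1 (by positivity)).trans ?_
      simpa using hρ
    have h4 : 0 ≤ K * (((1 - 2 * η)⁻¹) ^ (∑ i, d i) * ∏ i, g i (W (a i) ω)) := by positivity
    linarith

end Expectation

end WRT

/-! ### Mass of the truncated Beta law near one -/

section TruncatedBeta

variable {α β w : ℝ}

/-- The Beta distribution charges every left neighbourhood of one at least polynomially. -/
lemma betaMeasure_Ici_ge (hα : 0 < α) (hβ : 0 < β) {y : ℝ} (hy : 0 < y) (hy2 : y ≤ 1 / 2) :
    ENNReal.ofReal (1 / beta α β * (1 / 2 : ℝ) ^ α * (y / 2) ^ (⌈β⌉₊ + 1))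
      ≤ betaMeasure α β (Set.Ici (1 - y)) := by
  have hB := beta_pos hα hβ
  set κ : ℝ := 1 / beta α β * (1 / 2 : ℝ) ^ α * (y / 2) ^ ⌈β⌉₊ with hκ
  have hκ0 : 0 ≤ κ := by positivity
  have hdens : ∀ x ∈ Set.Icc (1 - y) (1 - y / 2), ENNReal.ofReal κ ≤ betaPDF α β x := by
    intro x hx
    have hx0 : 0 < x := by linarith [hx.1]
    have hx1 : x < 1 := by linarith [hx.2]
    rw [betaPDF_of_pos_lt_one hx0 hx1]
    refine ENNReal.ofReal_le_ofReal ?_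
    -- For bases in `(0, 1)` a larger exponent gives a smaller power. Using `α` and `⌈β⌉₊` instead
    -- of `α - 1` and `β - 1` avoids cases on their signs.
    have h1 : (1 / 2 : ℝ) ^ α ≤ x ^ (α - 1) :=
      (Real.rpow_le_rpow (by norm_num) (by linarith [hx.1]) hα.le).trans
        (Real.rpow_le_rpow_of_exponent_ge hx0 hx1.le (by linarith))
    have h2 : (y / 2) ^ ⌈β⌉₊ ≤ (1 - x) ^ (β - 1) := by
      refine (pow_le_pow_left₀ (by positivity) (by linarith [hx.2] : y / 2 ≤ 1 - x) _).trans ?_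
      rw [← Real.rpow_natCast]
      exact Real.rpow_le_rpow_of_exponent_ge (by linarith) (by linarith)
        (by linarith [Nat.le_ceil β])
    have h3 : 0 ≤ (1 / 2 : ℝ) ^ α := by positivity
    have h4 : 0 ≤ x ^ (α - 1) := by positivity
    exact mul_le_mul (mul_le_mul_of_nonneg_left h1 (by positivity)) h2 (by positivity)
      (by positivity)
  calc ENNReal.ofReal (1 / beta α β * (1 / 2 : ℝ) ^ α * (y / 2) ^ (⌈β⌉₊ + 1))
      = ENNReal.ofReal κ * volume (Set.Icc (1 - y) (1 - y / 2)) := by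
        rw [Real.volume_Icc, ← ENNReal.ofReal_mul hκ0]
        congr 1
        rw [hκ]
        ring
    _ ≤ ∫⁻ x in Set.Icc (1 - y) (1 - y / 2), betaPDF α β x := by
        rw [← setLIntegral_const]
        exact setLIntegral_mono' measurableSet_Icc hdens
    _ ≤ ∫⁻ x in Set.Ici (1 - y), betaPDF α β x := lintegral_mono_set fun x hx => hx.1
    _ = betaMeasure α β (Set.Ici (1 - y)) := by
        rw [betaMeasure, withDensity_apply _ measurableSet_Ici]

lemma betaMeasure_Ici_pos (hα : 0 < α) (hβ : 0 < β) (hw1 : w < 1) :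
    0 < betaMeasure α β (Set.Ici w) := by
  have hB := beta_pos hα hβ
  have hy : 0 < min (1 - w) (1 / 2) := lt_min (by linarith) (by norm_num)
  refine lt_of_lt_of_le ?_ ((betaMeasure_Ici_ge hα hβ hy (min_le_right _ _)).trans
    (measure_mono (Set.Ici_subset_Ici.2 (by linarith [min_le_left (1 - w) (1 / 2)]))))
  rw [ENNReal.ofReal_pos]
  positivity

lemma isProbabilityMeasure_truncatedBeta (hα : 0 < α) (hβ : 0 < β) (hw1 : w < 1) :
    IsProbabilityMeasure (truncatedBeta α β w) := by
  have := isProbabilityMeasureBeta hα hβ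
  exact cond_isProbabilityMeasure (betaMeasure_Ici_pos hα hβ hw1).ne'

lemma ae_mem_truncatedBeta : ∀ᵐ x ∂(truncatedBeta α β w), w ≤ x ∧ x ≤ 1 := by
  have h1 : ∀ᵐ x ∂(truncatedBeta α β w), w ≤ x := ae_cond_mem measurableSet_Ici
  have h2 : ∀ᵐ x ∂(betaMeasure α β), x ≤ 1 := by
    rw [betaMeasure, ae_withDensity_iff' (by
      exact ((measurable_betaPDFReal α β).ennreal_ofReal).aemeasurable)]
    refine Eventually.of_forall fun x hx => ?_
    by_contra h
    exact hx (betaPDF_eq_zero_of_one_le (not_le.1 h).le)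
  have h3 : ∀ᵐ x ∂(truncatedBeta α β w), x ≤ 1 := cond_absolutelyContinuous.ae_le h2
  exact h1.and h3

lemma truncatedBeta_tail (hα : 0 < α) (hβ : 0 < β) (hw0 : 0 < w) (hw1 : w < 1) :
    ∃ C : ℝ, 0 < C ∧ ∃ q : ℕ, ∀ y : ℝ, 0 < y → y ≤ 1 →
      C * y ^ q ≤ (truncatedBeta α β w).real (Set.Ici (1 - y)) := by
  have := isProbabilityMeasureBeta hα hβ
  have hB := beta_pos hα hβ
  have hw : 0 < 1 - w := by linarith
  have := isProbabilityMeasure_truncatedBeta hα hβ hw1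
  refine ⟨1 / beta α β * (1 / 2 : ℝ) ^ α * ((1 - w) / 4) ^ (⌈β⌉₊ + 1), by positivity,
    ⌈β⌉₊ + 1, fun y hy hy1 => ?_⟩
  -- The rescaled deficit is at most `1 / 2`, and one minus it is at least `w`, so the interval
  -- survives the truncation. Dividing by the conditioning probability can only help.
  have hy' : 0 < y * ((1 - w) / 2) := by positivity
  have hle : y * ((1 - w) / 2) ≤ (1 - w) / 2 := by nlinarith
  rw [measureReal_def, ← ENNReal.ofReal_le_iff_le_toReal (measure_ne_top _ _)]
  have h := betaMeasure_Ici_ge hα hβ hy' (by linarith)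
  have heq : 1 / beta α β * (1 / 2 : ℝ) ^ α * ((1 - w) / 4) ^ (⌈β⌉₊ + 1) * y ^ (⌈β⌉₊ + 1)
      = 1 / beta α β * (1 / 2 : ℝ) ^ α * (y * ((1 - w) / 2) / 2) ^ (⌈β⌉₊ + 1) := by
    rw [mul_assoc, ← mul_pow]
    congr 2
    ring
  rw [heq]
  refine h.trans ?_
  rw [truncatedBeta, cond_apply measurableSet_Ici]
  have hsub : Set.Ici (1 - y * ((1 - w) / 2)) ⊆ Set.Ici w ∩ Set.Ici (1 - y) := by
    intro x hx
    have hx' : 1 - y * ((1 - w) / 2) ≤ x := hx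
    have h1 : w ≤ x := by linarith
    have h2 : 1 - y ≤ x := by nlinarith
    exact ⟨h1, h2⟩
  refine (measure_mono hsub).trans ?_
  refine le_mul_of_one_le_left (by positivity) ?_
  rw [ENNReal.one_le_inv]
  exact prob_le_one

lemma integral_truncatedBeta_ge (hα : 0 < α) (hβ : 0 < β) (hw0 : 0 < w) (hw1 : w < 1) :
    w ≤ ∫ x, x ∂(truncatedBeta α β w) := by
  have := isProbabilityMeasure_truncatedBeta hα hβ hw1
  have hint : Integrable (fun x : ℝ => x) (truncatedBeta α β w) := by
    refine Integrable.of_bound aestronglyMeasurable_id 1 ?_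
    filter_upwards [ae_mem_truncatedBeta (α := α) (β := β) (w := w)] with x hx
    rw [Real.norm_eq_abs, abs_of_nonneg (hw0.le.trans hx.1)]
    exact hx.2
  have h := integral_mono_ae (integrable_const w) hint (by
    filter_upwards [ae_mem_truncatedBeta (α := α) (β := β) (w := w)] with x hx
    exact hx.1)
  simpa using h

end TruncatedBeta

/-! ### Finite sums: total variation and product weights -/

section FiniteSums

/-- As in Scheffé's lemma, the negative part of `p - q` is at most `r` and the total of `p - q` at
most `δ`. No pointwise upper bound for `p` is needed. -/
lemma sum_abs_sub_le {ι : Type*} (S : Finset ι) {p q r : ι → ℝ} {δ : ℝ} (hr : ∀ a ∈ S, 0 ≤ r a)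
    (hlow : ∀ a ∈ S, q a - r a ≤ p a) (hsum : ∑ a ∈ S, p a ≤ ∑ a ∈ S, q a + δ) :
    ∑ a ∈ S, |p a - q a| ≤ δ + 2 * ∑ a ∈ S, r a := by
  have h : ∀ a ∈ S, |p a - q a| ≤ p a - q a + 2 * r a := fun a ha => by
    rw [abs_le]
    constructor <;> linarith [hr a ha, hlow a ha]
  refine (Finset.sum_le_sum h).trans ?_
  rw [Finset.sum_add_distrib, Finset.sum_sub_distrib, ← Finset.mul_sum]
  linarith

variable {ι κ : Type*} [Fintype ι] [DecidableEq ι] [Fintype κ]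

lemma sum_pi_prod {R : Type*} [CommSemiring R] (f : ι → κ → R) :
    ∑ a : ι → κ, ∏ i, f i (a i) = ∏ i, ∑ b, f i b := by
  classical
  rw [Finset.prod_univ_sum, Fintype.piFinset_univ]

/-- If `c` is a product of subprobability vectors, then a set of configurations whose fibres in
direction `i` have mass at most `δ` has mass at most `δ`. -/
lemma sum_prod_filter_le {c : ι → κ → ℝ} (hc : ∀ i b, 0 ≤ c i b) (hc1 : ∀ i, ∑ b, c i b ≤ 1)
    (i : ι) (B : (ι → κ) → Prop) [DecidablePred B] {δ : ℝ} (hδ : 0 ≤ δ)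
    (hB : ∀ a : ι → κ, ∑ b, (if B (Function.update a i b) then c i b else 0) ≤ δ) :
    ∑ a : ι → κ, (if B a then ∏ j, c j (a j) else 0) ≤ δ := by
  classical
  rw [← (Equiv.funSplitAt i κ).symm.sum_comp, Fintype.sum_prod_type_right]
  have hterm : ∀ (b : κ) (x : {j // j ≠ i} → κ),
      (if B ((Equiv.funSplitAt i κ).symm (b, x)) then
        ∏ j, c j ((Equiv.funSplitAt i κ).symm (b, x) j) else 0)
      = (if B ((Equiv.funSplitAt i κ).symm (b, x)) then c i b else 0) *
        ∏ j : {j // j ≠ i}, c j (x j) := by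
    intro b x
    rw [ite_mul, zero_mul]
    refine if_congr Iff.rfl ?_ rfl
    rw [Fintype.prod_eq_mul_prod_subtype_ne _ i]
    congr 1
    · simp [Equiv.funSplitAt, Equiv.piSplitAt]
    · refine Finset.prod_congr rfl fun j _ => ?_
      simp [Equiv.funSplitAt, Equiv.piSplitAt, j.2]
  simp only [hterm, ← Finset.sum_mul]
  have hprod : ∑ x : {j // j ≠ i} → κ, ∏ j : {j // j ≠ i}, c j (x j) ≤ 1 := by
    rw [sum_pi_prod fun (j : {j // j ≠ i}) b => c j b]
    exact Finset.prod_le_one (fun j _ => Finset.sum_nonneg fun b _ => hc j b) fun j _ => hc1 j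
  have hfib : ∀ x : {j // j ≠ i} → κ,
      ∑ b, (if B ((Equiv.funSplitAt i κ).symm (b, x)) then c i b else 0) ≤ δ := by
    intro x
    by_cases hκ : Nonempty κ
    · obtain ⟨b₀⟩ := hκ
      refine le_of_eq_of_le (Finset.sum_congr rfl fun b _ => ?_)
        (hB ((Equiv.funSplitAt i κ).symm (b₀, x)))
      have : (Equiv.funSplitAt i κ).symm (b, x)
          = Function.update ((Equiv.funSplitAt i κ).symm (b₀, x)) i b := by
        funext j
        by_cases hj : j = i
        · subst hj; simp [Equiv.funSplitAt, Equiv.piSplitAt]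
        · simp [Equiv.funSplitAt, Equiv.piSplitAt, hj]
      rw [this]
    · rw [not_nonempty_iff] at hκ
      simpa using hδ
  calc _ ≤ ∑ x : {j // j ≠ i} → κ, δ * ∏ j : {j // j ≠ i}, c j (x j) :=
        Finset.sum_le_sum fun x _ => mul_le_mul_of_nonneg_right (hfib x)
          (Finset.prod_nonneg fun j _ => hc _ _)
    _ ≤ δ := by
        rw [← Finset.mul_sum]
        exact mul_le_of_le_one_right hδ hprod

end FiniteSums

/-! ### Sampling vertices without replacement -/

namespace WRT

section Sampling

variable {Ω : Type*} [mΩ : MeasurableSpace Ω] {P : Measure Ω} [IsProbabilityMeasure P]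
  {ν : Measure ℝ} {W : ℕ → Ω → ℝ} {parent : ℕ → Ω → ℕ} {n k : ℕ} {v : Fin k → Ω → ℕ}

/-- The event that the sampled vertices are `a` and satisfy the degree constraints. -/
def sampleEvent (parent : ℕ → Ω → ℕ) (n : ℕ) {k : ℕ} (v : Fin k → Ω → ℕ) (d : Fin k → ℤ)
    (a : Fin k → ℕ) : Set Ω :=
  {ω | ∀ i, v i ω = a i} ∩ degreeEvent parent n v d

omit mΩ in
lemma sampleEvent_eq (d : Fin k → ℤ) (a : Fin k → ℕ) :
    sampleEvent parent n v d a
      = {ω | ∀ i, v i ω = a i} ∩ vertexDegreeEvent parent n a fun i => (d i).toNat := by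
  ext ω
  simp only [sampleEvent, degreeEvent, vertexDegreeEvent, Set.mem_inter_iff, Set.mem_ofPred_eq]
  refine and_congr_right fun h => forall_congr' fun i => ?_
  rw [h i, Int.toNat_le]

omit mΩ in
lemma measurableSet_vertices_eq {m : MeasurableSpace Ω} (hv : ∀ i, Measurable[m] (v i))
    (a : Fin k → ℕ) : MeasurableSet[m] {ω | ∀ i, v i ω = a i} := by
  rw [Set.ofPred_forall]
  exact MeasurableSet.iInter fun i => hv i (measurableSet_singleton (a i))

omit [IsProbabilityMeasure P] in
lemma measurableSet_sampleEvent (hT : IsWeightedRecursiveTree P ν W parent)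
    (hv : IsUniformSample P W parent n k v) (d : Fin k → ℤ) (a : Fin k → ℕ) :
    MeasurableSet (sampleEvent parent n v d a) := by
  rw [sampleEvent_eq]
  exact (measurableSet_vertices_eq hv.measurable a).inter
    (history_le hT n _ (measurableSet_vertexDegreeEvent n a _))

omit [IsProbabilityMeasure P] in
lemma measurableSet_degreeEvent (hT : IsWeightedRecursiveTree P ν W parent)
    (hv : IsUniformSample P W parent n k v) (d : Fin k → ℤ) :
    MeasurableSet (degreeEvent parent n v d) := by
  have : degreeEvent parent n v d = ⋃ a : Fin k → ℕ, sampleEvent parent n v d a := by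
    ext ω
    simp only [Set.mem_iUnion, sampleEvent, Set.mem_inter_iff, Set.mem_ofPred_eq]
    exact ⟨fun h => ⟨fun i => v i ω, fun _ => rfl, h⟩, fun ⟨_, _, h⟩ => h⟩
  rw [this]
  exact MeasurableSet.iUnion fun a => measurableSet_sampleEvent hT hv d a

/-- There are `n.descFactorial k` embeddings and their prescribed probabilities add up to one, so
repeated or out-of-range samples are null. -/
lemma ae_exists_embedding (hkn : k ≤ n) (hv : IsUniformSample P W parent n k v) :
    ∀ᵐ ω ∂P, ∃ a : Fin k ↪ Fin n, ∀ i, v i ω = (a i : ℕ) := by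
  have hm : ∀ a : Fin k ↪ Fin n, MeasurableSet {ω | ∀ i, v i ω = (a i : ℕ)} := fun a =>
    measurableSet_vertices_eq hv.measurable _
  have hset : {ω | ∃ a : Fin k ↪ Fin n, ∀ i, v i ω = (a i : ℕ)}
      = ⋃ a : Fin k ↪ Fin n, {ω | ∀ i, v i ω = (a i : ℕ)} := by
    ext ω; simp
  have hdisj : Pairwise (Function.onFun Disjoint
      fun a : Fin k ↪ Fin n => {ω | ∀ i, v i ω = (a i : ℕ)}) := by
    intro a b hab
    refine Set.disjoint_left.2 fun ω h1 h2 => hab ?_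
    ext i
    rw [← h1 i, ← h2 i]
  have hne : (n.descFactorial k : ENNReal) ≠ 0 := by
    have := Nat.pos_of_ne_zero (fun h => (Nat.descFactorial_eq_zero_iff_lt.1 h).not_ge hkn)
    exact_mod_cast this.ne'
  have h1 : P {ω | ∃ a : Fin k ↪ Fin n, ∀ i, v i ω = (a i : ℕ)} = 1 := by
    rw [hset, measure_iUnion hdisj hm, tsum_fintype]
    simp only [hv.uniform, Finset.sum_const, Finset.card_univ, Fintype.card_embedding_eq,
      Fintype.card_fin, nsmul_eq_mul, one_div]
    exact ENNReal.mul_inv_cancel hne (ENNReal.natCast_ne_top _)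
  refine (mem_ae_iff_prob_eq_one ?_).2 h1
  rw [hset]
  exact MeasurableSet.iUnion hm

omit [IsProbabilityMeasure P] in
lemma measureReal_sampleEvent (hv : IsUniformSample P W parent n k v)
    (d : Fin k → ℤ) {a : Fin k → Fin n} (ha : Function.Injective a) :
    P.real (sampleEvent parent n v d fun i => (a i : ℕ))
      = (n.descFactorial k : ℝ)⁻¹ *
        P.real (vertexDegreeEvent parent n (fun i => (a i : ℕ)) fun i => (d i).toNat) := by
  have hmeas : ∀ i, Measurable[⨆ i, MeasurableSpace.comap (v i) inferInstance] (v i) := fun i =>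
    Measurable.mono (comap_measurable (v i))
      (le_iSup (fun i => MeasurableSpace.comap (v i) inferInstance) i) le_rfl
  have h := (Indep_iff _ _ P).1 hv.indep {ω | ∀ i, v i ω = ((a i : Fin n) : ℕ)} _
    (measurableSet_vertices_eq hmeas _)
    ((le_iSup (fun m => history W parent m) n) _
      (measurableSet_vertexDegreeEvent (W := W) n (fun i => (a i : ℕ)) fun i => (d i).toNat))
  rw [sampleEvent_eq, measureReal_def, h, ENNReal.toReal_mul, measureReal_def]
  have hu := hv.uniform ⟨a, ha⟩
  simp only [Function.Embedding.coeFn_mk] at hu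
  rw [hu]
  simp

lemma measureReal_sampleEvent_of_not_injective (hkn : k ≤ n)
    (hv : IsUniformSample P W parent n k v) (d : Fin k → ℤ) {a : Fin k → Fin n}
    (ha : ¬ Function.Injective a) : P.real (sampleEvent parent n v d fun i => (a i : ℕ)) = 0 := by
  rw [measureReal_eq_zero_iff]
  refine measure_mono_null ?_ (ae_exists_embedding hkn hv)
  rintro ω ⟨h, -⟩ ⟨b, hb⟩
  refine ha fun i j hij => b.injective ?_
  ext
  rw [← hb i, ← hb j, h i, h j]
  exact congrArg _ hij

/-- Integrals of functions of the sampled vertices over the degree event are finite sums. -/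
lemma setIntegral_degreeEvent (hT : IsWeightedRecursiveTree P ν W parent) (hkn : k ≤ n)
    (hv : IsUniformSample P W parent n k v) (d : Fin k → ℤ) {E : Type*} [NormedAddCommGroup E]
    [NormedSpace ℝ E] [CompleteSpace E] (g : (Fin k → ℕ) → E) :
    ∫ ω in degreeEvent parent n v d, g (fun i => v i ω) ∂P
      = ∑ a : Fin k → Fin n,
          P.real (sampleEvent parent n v d fun i => (a i : ℕ)) • g fun i => (a i : ℕ) := by
  have hm : ∀ a : Fin k → Fin n, MeasurableSet (sampleEvent parent n v d fun i => (a i : ℕ)) :=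
    fun a => measurableSet_sampleEvent hT hv d _
  rw [← integral_indicator (measurableSet_degreeEvent hT hv d)]
  have hae : ∀ᵐ ω ∂P, (degreeEvent parent n v d).indicator (fun ω => g fun i => v i ω) ω
      = ∑ a : Fin k → Fin n, (sampleEvent parent n v d fun i => (a i : ℕ)).indicator
          (fun _ => g fun i => (a i : ℕ)) ω := by
    filter_upwards [ae_exists_embedding hkn hv] with ω hω
    obtain ⟨a, ha⟩ := hω
    rw [Finset.sum_eq_single (fun i => a i)]
    · have h1 : (fun i => v i ω) = fun i => (a i : ℕ) := funext ha
      by_cases h : ω ∈ degreeEvent parent n v d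
      · rw [Set.indicator_of_mem h, Set.indicator_of_mem
          (show ω ∈ sampleEvent parent n v d fun i => (a i : ℕ) from ⟨ha, h⟩), h1]
      · rw [Set.indicator_of_notMem h, Set.indicator_of_notMem fun h' => h h'.2]
    · intro b _ hb
      refine Set.indicator_of_notMem (fun h' => hb ?_) _
      funext i
      ext
      exact (h'.1 i).symm.trans (ha i)
    · simp
  rw [integral_congr_ae hae, integral_finsetSum _ fun a _ =>
    (integrable_const _).indicator (hm a)]
  exact Finset.sum_congr rfl fun a _ => integral_indicator_const _ (hm a)

lemma measureReal_degreeEvent (hT : IsWeightedRecursiveTree P ν W parent) (hkn : k ≤ n)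
    (hv : IsUniformSample P W parent n k v) (d : Fin k → ℤ) :
    P.real (degreeEvent parent n v d)
      = ∑ a : Fin k → Fin n, P.real (sampleEvent parent n v d fun i => (a i : ℕ)) := by
  have h := setIntegral_degreeEvent hT hkn hv d (fun _ => (1 : ℝ))
  simpa using h

end Sampling

end WRT

/-! ### The limiting law on vertex indices -/

/-- The normalised mass of the cell of the vertex with index `b`. -/
noncomputable def cellWeight (ν : Measure ℝ) (μ : ℝ) (n d b : ℕ) : ℝ :=
  if b + 1 < n then (mixedMass ν μ d)⁻¹ * cellMass ν μ n d (b + 1) else 0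

/-- Vertices are numbered from zero and cells from one. The last vertex is dropped, since its cell
would lie at negative times. -/
lemma sum_fin_shift {R : Type*} [AddCommMonoid R] (n : ℕ) (f : ℕ → R) :
    ∑ b : Fin n, (if (b : ℕ) + 1 < n then f (b + 1) else 0) = ∑ j ∈ Finset.Ico 1 n, f j := by
  rw [Fin.sum_univ_eq_sum_range fun b => if b + 1 < n then f (b + 1) else 0,
    Finset.sum_Ico_eq_sum_range]
  cases n with
  | zero => simp
  | succ n =>
    rw [Finset.sum_range_succ, if_neg (lt_irrefl _), add_zero, Nat.add_sub_cancel]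
    refine Finset.sum_congr rfl fun b hb => ?_
    rw [if_pos (by simpa using Finset.mem_range.1 hb), add_comm]

section CellWeight

variable {ν : Measure ℝ} [IsProbabilityMeasure ν] {w₀ μ : ℝ}
  (hw₀ : 0 < w₀) (hν : ∀ᵐ x ∂ν, w₀ ≤ x ∧ x ≤ 1) (hμ : 0 < μ)

include hw₀ hν hμ

lemma mixedMass_pos (d : ℕ) : 0 < mixedMass ν μ d :=
  (by positivity : 0 < (w₀ / (1 + μ)) ^ d).trans_le (mixedMass.pos hw₀ hν hμ d)

lemma cellWeight_nonneg (n d b : ℕ) : 0 ≤ cellWeight ν μ n d b := by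
  rw [cellWeight]
  split_ifs with h
  · exact mul_nonneg (inv_nonneg.2 (mixedMass_pos hw₀ hν hμ d).le)
      (cellMass_nonneg hw₀ hν hμ d (Nat.succ_pos b) h)
  · exact le_rfl

omit hw₀ hν hμ [IsProbabilityMeasure ν] in
lemma sum_cellWeight (n d : ℕ) : ∑ b : Fin n, cellWeight ν μ n d b
    = (mixedMass ν μ d)⁻¹ * ∑ j ∈ Finset.Ico 1 n, cellMass ν μ n d j := by
  rw [Finset.mul_sum, ← sum_fin_shift n fun j => (mixedMass ν μ d)⁻¹ * cellMass ν μ n d j]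
  rfl

lemma sum_cellWeight_le_one {n : ℕ} (hn : 1 ≤ n) (d : ℕ) :
    ∑ b : Fin n, cellWeight ν μ n d b ≤ 1 := by
  have hM := mixedMass_pos hw₀ hν hμ d
  rw [sum_cellWeight, inv_mul_le_iff₀ hM, mul_one]
  exact sum_cellMass_le hw₀ hν hμ d hn

lemma le_sum_cellWeight {n : ℕ} (hn : 1 ≤ n) (d : ℕ) :
    1 - (mixedMass ν μ d)⁻¹ * ∫ t in Set.Ioi (Real.log n), Real.exp (-t) * mixedTail ν μ d t
      ≤ ∑ b : Fin n, cellWeight ν μ n d b := by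
  have hM := mixedMass_pos hw₀ hν hμ d
  have hint := mixedTail.integrableOn_exp_mul hw₀ hν hμ d
  have hlog : 0 ≤ Real.log n := Real.log_natCast_nonneg n
  have hsplit : mixedMass ν μ d
      = (∫ t in Set.Ioc 0 (Real.log n), Real.exp (-t) * mixedTail ν μ d t)
        + ∫ t in Set.Ioi (Real.log n), Real.exp (-t) * mixedTail ν μ d t := by
    rw [mixedMass, ← Set.Ioc_union_Ioi_eq_Ioi hlog]
    exact setIntegral_union (Set.Ioc_disjoint_Ioi le_rfl) measurableSet_Ioi
      (hint.mono_set Set.Ioc_subset_Ioi_self) (hint.mono_set (Set.Ioi_subset_Ioi hlog))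
  rw [sum_cellWeight, sum_cellMass_eq hw₀ hν hμ d hn le_rfl, sub_self]
  have : (mixedMass ν μ d)⁻¹ * mixedMass ν μ d = 1 := inv_mul_cancel₀ hM.ne'
  rw [← this]
  nth_rewrite 2 [hsplit]
  rw [mul_add, add_sub_cancel_right]

lemma sum_cellWeight_low_le {n L : ℕ} (hLn : L + 1 ≤ n) (d : ℕ) :
    ∑ b : Fin n, (if (b : ℕ) < L then cellWeight ν μ n d b else 0)
      ≤ (mixedMass ν μ d)⁻¹ * ∫ t in Set.Ioi (Real.log n - Real.log ((L + 1 : ℕ) : ℝ)),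
          Real.exp (-t) * mixedTail ν μ d t := by
  have hM := mixedMass_pos hw₀ hν hμ d
  have hint := mixedTail.integrableOn_exp_mul hw₀ hν hμ d
  have h0 := log_sub_log_nonneg (Nat.succ_pos L) hLn
  have h1 : ∑ b : Fin n, (if (b : ℕ) < L then cellWeight ν μ n d b else 0)
      = (mixedMass ν μ d)⁻¹ * ∑ j ∈ Finset.Ico 1 (L + 1), cellMass ν μ n d j := by
    rw [Fin.sum_univ_eq_sum_range fun b => if b < L then cellWeight ν μ n d b else 0,
      ← Finset.sum_filter]
    have : (Finset.range n).filter (· < L) = Finset.range L := by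
      ext b
      simp only [Finset.mem_filter, Finset.mem_range]
      omega
    rw [this, Finset.sum_Ico_eq_sum_range, Nat.add_sub_cancel, Finset.mul_sum]
    refine Finset.sum_congr rfl fun b hb => ?_
    rw [cellWeight, if_pos (by have := Finset.mem_range.1 hb; omega), add_comm]
  rw [h1, sum_cellMass_eq hw₀ hν hμ d (Nat.succ_pos L) hLn]
  refine mul_le_mul_of_nonneg_left ?_ (inv_nonneg.2 hM.le)
  refine setIntegral_mono_set (hint.mono_set (Set.Ioi_subset_Ioi h0)) ?_
    Set.Ioc_subset_Ioi_self.eventuallyLE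
  refine (ae_restrict_iff' measurableSet_Ioi).2 (Eventually.of_forall fun t ht => ?_)
  exact mul_nonneg (Real.exp_pos _).le (mixedTail.nonneg hw₀ hν hμ d (h0.trans (le_of_lt ht)))

lemma cellWeight_le_inv {n L b : ℕ} (hL : 1 ≤ L) (hb : L ≤ b) (d : ℕ) :
    cellWeight ν μ n d b ≤ (L : ℝ)⁻¹ := by
  have hM := mixedMass_pos hw₀ hν hμ d
  have hL' : (0 : ℝ) < L := by exact_mod_cast hL
  rw [cellWeight]
  split_ifs with h
  · rw [inv_mul_le_iff₀ hM, mul_comm]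
    refine (cellMass_le_mixedMass_div hw₀ hν hμ d (Nat.succ_pos b) h).trans
      (mul_le_mul_of_nonneg_right ?_ hM.le)
    exact inv_anti₀ hL' (by exact_mod_cast hb.trans (Nat.le_succ b))
  · positivity

/-- The term of `b` fits into the cell `b - 1`, and these cells are distinct. The bound `2 ≤ L`
ensures that this cell has a positive index. -/
lemma sum_mixedTail_le {n L : ℕ} (hL : 2 ≤ L) (d : ℕ) :
    ∑ b : Fin n, (if (b : ℕ) < L then 0 else
      (n : ℝ)⁻¹ * mixedTail ν μ d (Real.log n - Real.log ((b : ℕ) : ℝ))) ≤ mixedMass ν μ d := by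
  rcases Nat.eq_zero_or_pos n with rfl | hn
  · simpa using (mixedMass_pos hw₀ hν hμ d).le
  refine le_trans ?_ (sum_cellMass_le hw₀ hν hμ d hn)
  rw [Fin.sum_univ_eq_sum_range fun b => if b < L then 0 else
      (n : ℝ)⁻¹ * mixedTail ν μ d (Real.log n - Real.log (b : ℝ)), Finset.sum_ite,
    Finset.sum_const_zero, zero_add]
  have hinj : Set.InjOn (fun b : ℕ => b - 1) ((Finset.range n).filter fun b => ¬ b < L) := by
    intro x hx y hy hxy
    simp only [Finset.coe_filter, Finset.mem_range, Set.mem_ofPred_eq] at hx hy hxy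
    omega
  calc ∑ b ∈ (Finset.range n).filter fun b => ¬ b < L,
        (n : ℝ)⁻¹ * mixedTail ν μ d (Real.log n - Real.log (b : ℝ))
      ≤ ∑ b ∈ (Finset.range n).filter fun b => ¬ b < L, cellMass ν μ n d (b - 1) := by
        refine Finset.sum_le_sum fun b hb => ?_
        simp only [Finset.mem_filter, Finset.mem_range] at hb
        have h := le_cellMass hw₀ hν hμ d (n := n) (j := b - 1) (by omega) (by omega)
        rwa [Nat.sub_add_cancel (by omega)] at h
    _ = ∑ j ∈ ((Finset.range n).filter fun b => ¬ b < L).image fun b => b - 1,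
          cellMass ν μ n d j := (Finset.sum_image hinj).symm
    _ ≤ ∑ j ∈ Finset.Ico 1 n, cellMass ν μ n d j := by
        refine Finset.sum_le_sum_of_subset_of_nonneg ?_ fun j hj _ => ?_
        · intro j hj
          simp only [Finset.mem_image, Finset.mem_filter, Finset.mem_range] at hj
          obtain ⟨b, hb, rfl⟩ := hj
          rw [Finset.mem_Ico]
          omega
        · rw [Finset.mem_Ico] at hj
          exact cellMass_nonneg hw₀ hν hμ d hj.1 hj.2

omit [IsProbabilityMeasure ν] in
lemma upperFactor_nonneg {η s : ℝ} (hη : η < 1 / 2) (hs : 1 ≤ s) {L n : ℕ} (hL : 1 ≤ L) (d : ℕ)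
    {b : ℕ} (hb : b < n) : 0 ≤ WRT.upperFactor ν w₀ μ η s L n d b := by
  rw [WRT.upperFactor]
  have : 0 < 1 - 2 * η := by linarith
  split_ifs with h
  · positivity
  · exact mul_nonneg (by positivity)
      (mixedTail.nonneg hw₀ hν hμ d (log_sub_log_nonneg (by omega) hb.le))

lemma sum_upperFactor_le {η s : ℝ} (hη : η < 1 / 2) {n L : ℕ} (hL : 2 ≤ L)
    (hLn : L ≤ n) (d : ℕ) :
    (n : ℝ)⁻¹ * ∑ b : Fin n, WRT.upperFactor ν w₀ μ η s L n d b
      ≤ ((1 - 2 * η)⁻¹) ^ d * mixedMass ν μ d + L / n * ((s⁻¹) ^ d * Real.exp ((s - 1) *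
        (w₀⁻¹ * (1 + Real.log L) + (μ * (1 - η))⁻¹ * (1 + Real.log n)))) := by
  have hη' : 0 < 1 - 2 * η := by linarith
  set B : ℝ := (s⁻¹) ^ d * Real.exp ((s - 1) *
        (w₀⁻¹ * (1 + Real.log L) + (μ * (1 - η))⁻¹ * (1 + Real.log n))) with hB
  have hterm : ∀ b : Fin n, (n : ℝ)⁻¹ * WRT.upperFactor ν w₀ μ η s L n d b
      = (if (b : ℕ) < L then (n : ℝ)⁻¹ * B else 0) + ((1 - 2 * η)⁻¹) ^ d *
        (if (b : ℕ) < L then 0 else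
          (n : ℝ)⁻¹ * mixedTail ν μ d (Real.log n - Real.log ((b : ℕ) : ℝ))) := fun b => by
    rw [WRT.upperFactor]
    split_ifs
    · rw [hB]; ring
    · ring
  rw [Finset.mul_sum, Finset.sum_congr rfl fun b _ => hterm b, Finset.sum_add_distrib,
    ← Finset.mul_sum, add_comm]
  refine add_le_add (mul_le_mul_of_nonneg_left (sum_mixedTail_le hw₀ hν hμ hL d)
    (by positivity)) (le_of_eq ?_)
  rw [Fin.sum_univ_eq_sum_range fun b => if b < L then (n : ℝ)⁻¹ * B else 0,
    ← Finset.sum_filter, Finset.sum_const, nsmul_eq_mul]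
  have : (Finset.range n).filter (· < L) = Finset.range L := by
    ext b
    simp only [Finset.mem_filter, Finset.mem_range]
    omega
  rw [this, Finset.card_range]
  ring

end CellWeight

/-! ### Comparison of the sampled law with the limiting law -/

namespace WRT

section Comparison

variable {Ω : Type*} [mΩ : MeasurableSpace Ω] {P : Measure Ω} [IsProbabilityMeasure P]
  {ν : Measure ℝ} [IsProbabilityMeasure ν] {W : ℕ → Ω → ℝ} {parent : ℕ → Ω → ℕ} {n k : ℕ}
  {v : Fin k → Ω → ℕ} {w₀ μ η s : ℝ} {L : ℕ}

lemma descFactorial_pos (hkn : k ≤ n) : (0 : ℝ) < n.descFactorial k := by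
  have := Nat.pos_of_ne_zero (fun h => (Nat.descFactorial_eq_zero_iff_lt.1 h).not_ge hkn)
  exact_mod_cast this

/-- Upper bound for the probability of the degree event. -/
lemma sum_measureReal_sampleEvent_le (hT : IsWeightedRecursiveTree P ν W parent)
    (hw₀ : 0 < w₀) (hν : ∀ᵐ x ∂ν, w₀ ≤ x ∧ x ≤ 1) (hμ : 0 < μ)
    (hη0 : 0 ≤ η) (hη1 : η < 1 / 2) (hL2 : 2 ≤ L) (hL : 1 ≤ η * μ * L) (hs : 1 ≤ s)
    (hLn : L ≤ n) (hkn : k ≤ n) (hv : IsUniformSample P W parent n k v) {d : Fin k → ℤ}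
    {D : Fin k → ℕ} (hD : D = fun i => (d i).toNat) :
    (∏ i, mixedMass ν μ (D i))⁻¹ *
      ∑ a : Fin k → Fin n, P.real (sampleEvent parent n v d fun i => (a i : ℕ)) ≤
      (n : ℝ) ^ k / n.descFactorial k *
        (∏ i, (((1 - 2 * η)⁻¹) ^ (D i) + (mixedMass ν μ (D i))⁻¹ * (L / n *
          ((s⁻¹) ^ (D i) * Real.exp ((s - 1) *
            (w₀⁻¹ * (1 + Real.log L) + (μ * (1 - η))⁻¹ * (1 + Real.log n))))))
        + (∏ i, mixedMass ν μ (D i))⁻¹ * P.real (goodEvent W μ η L n)ᶜ) := by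
  set Pc := P.real (goodEvent W μ η L n)ᶜ with hPc
  have hPc0 : 0 ≤ Pc := measureReal_nonneg
  have hf0 := descFactorial_pos hkn
  have hn0 : (0 : ℝ) < n := by
    have : 0 < n := by omega
    exact_mod_cast this
  have hM : ∀ i, 0 < mixedMass ν μ (D i) := fun i => mixedMass_pos hw₀ hν hμ _
  have hMt : 0 < ∏ i, mixedMass ν μ (D i) := Finset.prod_pos fun i _ => hM i
  have hU : ∀ i (b : Fin n), 0 ≤ upperFactor ν w₀ μ η s L n (D i) b := fun i b =>
    upperFactor_nonneg hw₀ hν hμ hη1 hs (by omega) _ b.2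
  have hpt : ∀ a : Fin k → Fin n, P.real (sampleEvent parent n v d fun i => (a i : ℕ)) ≤
      (n.descFactorial k : ℝ)⁻¹ * (∏ i, upperFactor ν w₀ μ η s L n (D i) (a i) + Pc) := by
    intro a
    by_cases ha : Function.Injective a
    · rw [measureReal_sampleEvent hv d ha, ← hD]
      refine mul_le_mul_of_nonneg_left ?_ (inv_nonneg.2 hf0.le)
      exact measureReal_vertexDegreeEvent_le hT hw₀ hν hμ hη0 hη1 (by omega) hL hs
        (a := fun i => (a i : ℕ)) (Fin.val_injective.comp ha) (fun i => (a i).2) D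
    · rw [measureReal_sampleEvent_of_not_injective hkn hv d ha]
      exact mul_nonneg (inv_nonneg.2 hf0.le)
        (add_nonneg (Finset.prod_nonneg fun i _ => hU i (a i)) hPc0)
  have hsum : ∑ a : Fin k → Fin n, P.real (sampleEvent parent n v d fun i => (a i : ℕ)) ≤
      (n : ℝ) ^ k / n.descFactorial k *
        (∏ i, ((n : ℝ)⁻¹ * ∑ b : Fin n, upperFactor ν w₀ μ η s L n (D i) b) + Pc) := by
    refine (Finset.sum_le_sum fun a _ => hpt a).trans (le_of_eq ?_)
    rw [← Finset.mul_sum, Finset.sum_add_distrib,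
      sum_pi_prod fun i (b : Fin n) => upperFactor ν w₀ μ η s L n (D i) b,
      Finset.prod_mul_distrib]
    simp only [Finset.sum_const, Finset.card_univ, Fintype.card_fun, Fintype.card_fin,
      Finset.prod_const, nsmul_eq_mul, Nat.cast_pow]
    have hnk : (n : ℝ) ^ k * ((n : ℝ)⁻¹) ^ k = 1 := by
      rw [inv_pow, mul_inv_cancel₀ (by positivity)]
    rw [div_eq_mul_inv]
    linear_combination (-(n.descFactorial k : ℝ)⁻¹ *
      ∏ i, ∑ b : Fin n, upperFactor ν w₀ μ η s L n (D i) b) * hnk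
  rw [inv_mul_le_iff₀ hMt]
  refine hsum.trans ?_
  have hfac : ∏ i, ((n : ℝ)⁻¹ * ∑ b : Fin n, upperFactor ν w₀ μ η s L n (D i) b) ≤
      (∏ i, mixedMass ν μ (D i)) * ∏ i, (((1 - 2 * η)⁻¹) ^ (D i) + (mixedMass ν μ (D i))⁻¹ *
        (L / n * ((s⁻¹) ^ (D i) * Real.exp ((s - 1) *
            (w₀⁻¹ * (1 + Real.log L) + (μ * (1 - η))⁻¹ * (1 + Real.log n)))))) := by
    rw [← Finset.prod_mul_distrib]
    refine Finset.prod_le_prod (fun i _ => mul_nonneg (by positivity)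
      (Finset.sum_nonneg fun b _ => hU i b)) fun i _ => ?_
    refine (sum_upperFactor_le hw₀ hν hμ hη1 hL2 hLn (D i)).trans (le_of_eq ?_)
    generalize (L / n * ((s⁻¹) ^ (D i) * Real.exp ((s - 1) *
      (w₀⁻¹ * (1 + Real.log L) + (μ * (1 - η))⁻¹ * (1 + Real.log n)))) : ℝ) = B
    have := mul_inv_cancel₀ (hM i).ne'
    linear_combination -B * this
  have hRn : (0 : ℝ) ≤ (n : ℝ) ^ k / n.descFactorial k := by positivity
  calc _ ≤ (n : ℝ) ^ k / n.descFactorial k * (_ + Pc) :=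
        mul_le_mul_of_nonneg_left (add_le_add_left hfac Pc) hRn
    _ = _ := by
        have := mul_inv_cancel₀ hMt.ne'
        linear_combination (-((n : ℝ) ^ k / n.descFactorial k) * Pc) * this

/-- Pointwise lower bound, with an error term, for the probability that the sampled vertices are
`a` and satisfy the degree constraints. -/
lemma prod_cellWeight_sub_le (hT : IsWeightedRecursiveTree P ν W parent)
    (hw₀ : 0 < w₀) (hν : ∀ᵐ x ∂ν, w₀ ≤ x ∧ x ≤ 1) (hμ : 0 < μ)
    (hη0 : 0 ≤ η) (hη1 : η < 1 / 2) (hL2 : 2 ≤ L) (hL : 1 ≤ η * μ * L)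
    (hkn : k ≤ n) (hv : IsUniformSample P W parent n k v) {d : Fin k → ℤ}
    {D : Fin k → ℕ} (hD : D = fun i => (d i).toNat)
    (a : Fin k → Fin n) (haL : ∀ i, L ≤ (a i : ℕ)) (ha : Function.Injective a) :
    ((1 + η)⁻¹) ^ (∑ i, (D i)) * ∏ i, cellWeight ν μ n (D i) (a i)
      - 6 * 2 ^ k * k ^ 2 * (w₀⁻¹) ^ 2 * (L : ℝ)⁻¹ * ((1 - 2 * η)⁻¹) ^ (∑ i, (D i)) *
        ((n : ℝ) ^ k / n.descFactorial k) *
        ∏ i, ((mixedMass ν μ (D i))⁻¹ * ((n : ℝ)⁻¹ *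
          mixedTail ν μ ((D i) - 2) (Real.log n - Real.log ((a i : ℕ) : ℝ))))
      - (∏ i, mixedMass ν μ (D i))⁻¹ *
        ((n.descFactorial k : ℝ)⁻¹ * P.real (goodEvent W μ η L n)ᶜ)
      ≤ (∏ i, mixedMass ν μ (D i))⁻¹ *
        P.real (sampleEvent parent n v d fun i => (a i : ℕ)) := by
  set Pc := P.real (goodEvent W μ η L n)ᶜ with hPc
  have hf0 := descFactorial_pos hkn
  have hM : ∀ i, 0 < mixedMass ν μ (D i) := fun i => mixedMass_pos hw₀ hν hμ _
  have hMt : 0 < ∏ i, mixedMass ν μ (D i) := Finset.prod_pos fun i _ => hM i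
  have h := le_measureReal_vertexDegreeEvent hT hw₀ hν hμ hη0 hη1 (by omega) hL
    (a := fun i => (a i : ℕ)) (Fin.val_injective.comp ha) haL (fun i => (a i).2) D
  rw [Fintype.card_fin] at h
  rw [measureReal_sampleEvent hv d ha, ← hD]
  set ρ := ((1 + η)⁻¹) ^ (∑ i, D i) with hρ
  have hρ0 : 0 ≤ ρ := by positivity
  set K := 6 * 2 ^ k * (k : ℝ) ^ 2 * (w₀⁻¹) ^ 2 * (L : ℝ)⁻¹ with hK
  have h2 := mul_le_mul_of_nonneg_left
    (mul_le_mul_of_nonneg_left h (inv_nonneg.2 hf0.le)) (inv_nonneg.2 hMt.le)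
  refine le_trans ?_ h2
  -- Passing from `n ^ k` to `n.descFactorial k` goes in the right direction, because sampling
  -- without replacement makes each admissible tuple more likely.
  have hq : ∏ i, cellWeight ν μ n (D i) (a i) ≤ (∏ i, mixedMass ν μ (D i))⁻¹ *
      ((n.descFactorial k : ℝ)⁻¹ *
        ∏ i, mixedTail ν μ (D i) (Real.log n - Real.log (((a i : ℕ) + 1 : ℕ) : ℝ))) := by
    have hh0 : ∀ i, 0 ≤ mixedTail ν μ (D i) (Real.log n - Real.log (((a i : ℕ) + 1 : ℕ) : ℝ)) :=
      fun i => mixedTail.nonneg hw₀ hν hμ _ (log_sub_log_nonneg (Nat.succ_pos _) (a i).2)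
    have h1 : ∏ i, cellWeight ν μ n (D i) (a i) ≤ ∏ i, ((mixedMass ν μ (D i))⁻¹ * ((n : ℝ)⁻¹ *
        mixedTail ν μ (D i) (Real.log n - Real.log (((a i : ℕ) + 1 : ℕ) : ℝ)))) := by
      refine Finset.prod_le_prod (fun i _ => cellWeight_nonneg hw₀ hν hμ _ _ _) fun i _ => ?_
      rw [cellWeight]
      split_ifs with hi
      · exact mul_le_mul_of_nonneg_left (cellMass_le hw₀ hν hμ _ (Nat.succ_pos _) hi)
          (inv_nonneg.2 (hM i).le)
      · exact mul_nonneg (inv_nonneg.2 (hM i).le) (mul_nonneg (by positivity) (hh0 i))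
    refine h1.trans ?_
    rw [Finset.prod_mul_distrib, Finset.prod_mul_distrib, Finset.prod_inv_distrib]
    refine mul_le_mul_of_nonneg_left (mul_le_mul_of_nonneg_right ?_
      (Finset.prod_nonneg fun i _ => hh0 i)) (inv_nonneg.2 hMt.le)
    rw [Finset.prod_const, Finset.card_univ, Fintype.card_fin, inv_pow]
    refine inv_anti₀ hf0 ?_
    exact_mod_cast Nat.descFactorial_le_pow n k
  have hn0 : k = 0 ∨ (0 : ℝ) < n := by
    rcases Nat.eq_zero_or_pos k with h | h
    · exact Or.inl h
    · exact Or.inr (by exact_mod_cast lt_of_lt_of_le h hkn)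
  have hnk : (n : ℝ) ^ k * ((n : ℝ)⁻¹) ^ k = 1 := by
    rcases hn0 with h | h
    · simp [h]
    · rw [inv_pow, mul_inv_cancel₀ (by positivity)]
  have hg : ((n : ℝ) ^ k / n.descFactorial k) * ∏ i, ((mixedMass ν μ (D i))⁻¹ * ((n : ℝ)⁻¹ *
          mixedTail ν μ (D i - 2) (Real.log n - Real.log ((a i : ℕ) : ℝ))))
      = (∏ i, mixedMass ν μ (D i))⁻¹ * ((n.descFactorial k : ℝ)⁻¹ *
        ∏ i, mixedTail ν μ (D i - 2) (Real.log n - Real.log ((a i : ℕ) : ℝ))) := by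
    rw [Finset.prod_mul_distrib, Finset.prod_mul_distrib, Finset.prod_inv_distrib,
      Finset.prod_const, Finset.card_univ, Fintype.card_fin, div_eq_mul_inv]
    linear_combination ((n.descFactorial k : ℝ)⁻¹ * (∏ i, mixedMass ν μ (D i))⁻¹ *
      ∏ i, mixedTail ν μ (D i - 2) (Real.log n - Real.log ((a i : ℕ) : ℝ))) * hnk
  have hfin := mul_le_mul_of_nonneg_left hq hρ0
  simp only [mul_assoc] at hg hfin ⊢
  rw [hg]
  linear_combination hfin

end Comparison

end WRT

/-! ### Total variation distance at a fixed size -/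

namespace WRT

section TotalVariation

variable {Ω : Type*} [mΩ : MeasurableSpace Ω] {P : Measure Ω} [IsProbabilityMeasure P]
  {ν : Measure ℝ} [IsProbabilityMeasure ν] {W : ℕ → Ω → ℝ} {parent : ℕ → Ω → ℕ} {n k : ℕ}
  {v : Fin k → Ω → ℕ} {w₀ μ η s : ℝ} {L : ℕ}

/-- The normalised law of the sampled vertices on the degree event is close to a product law. -/
lemma sum_abs_sub_prod_cellWeight_le (hT : IsWeightedRecursiveTree P ν W parent)
    (hw₀ : 0 < w₀) (hν : ∀ᵐ x ∂ν, w₀ ≤ x ∧ x ≤ 1) (hμ : 0 < μ)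
    (hη0 : 0 ≤ η) (hη1 : η < 1 / 2) (hL2 : 2 ≤ L) (hL : 1 ≤ η * μ * L) (hs : 1 ≤ s)
    (hLn : L + 1 ≤ n) (hkn : k ≤ n) (hv : IsUniformSample P W parent n k v) {d : Fin k → ℤ}
    {D : Fin k → ℕ} (hD : D = fun i => (d i).toNat) {δ : Fin k → ℝ}
    (hδ : ∀ i, (mixedMass ν μ (D i))⁻¹ *
      ∫ t in Set.Ioi (Real.log n - Real.log ((L + 1 : ℕ) : ℝ)),
        Real.exp (-t) * mixedTail ν μ (D i) t ≤ δ i) (hδ1 : ∀ i, δ i ≤ 1) :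
    ∑ a : Fin k → Fin n, |(∏ i, mixedMass ν μ (D i))⁻¹ *
        P.real (sampleEvent parent n v d fun i => (a i : ℕ))
        - ∏ i, cellWeight ν μ n (D i) (a i)| ≤
      ((n : ℝ) ^ k / n.descFactorial k *
        (∏ i, (((1 - 2 * η)⁻¹) ^ (D i) + (mixedMass ν μ (D i))⁻¹ * (L / n *
          ((s⁻¹) ^ (D i) * Real.exp ((s - 1) *
            (w₀⁻¹ * (1 + Real.log L) + (μ * (1 - η))⁻¹ * (1 + Real.log n))))))
        + (∏ i, mixedMass ν μ (D i))⁻¹ * P.real (goodEvent W μ η L n)ᶜ) - ∏ i, (1 - δ i))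
      + 2 * ((1 - ((1 + η)⁻¹) ^ (∑ i, D i))
        + 6 * 2 ^ k * k ^ 2 * (w₀⁻¹) ^ 2 * (L : ℝ)⁻¹ * ((1 - 2 * η)⁻¹) ^ (∑ i, D i) *
          ((n : ℝ) ^ k / n.descFactorial k) * (((1 + μ) / w₀) ^ 2) ^ k
        + (n : ℝ) ^ k / n.descFactorial k *
          ((∏ i, mixedMass ν μ (D i))⁻¹ * P.real (goodEvent W μ η L n)ᶜ)
        + ∑ i, δ i + k ^ 2 * (L : ℝ)⁻¹) := by
  set Pc := P.real (goodEvent W μ η L n)ᶜ with hPc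
  have hPc0 : 0 ≤ Pc := measureReal_nonneg
  have hf0 := descFactorial_pos hkn
  have hη' : 0 < 1 - 2 * η := by linarith
  have hM : ∀ i, 0 < mixedMass ν μ (D i) := fun i => mixedMass_pos hw₀ hν hμ _
  have hMt : 0 < ∏ i, mixedMass ν μ (D i) := Finset.prod_pos fun i _ => hM i
  have hup := sum_measureReal_sampleEvent_le hT hw₀ hν hμ hη0 hη1 hL2 hL hs (by omega) hkn hv hD
  set ρ := ((1 + η)⁻¹) ^ (∑ i, D i) with hρ
  have hρ1 : ρ ≤ 1 := pow_le_one₀ (by positivity) (inv_le_one_of_one_le₀ (by linarith))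
  set K := 6 * 2 ^ k * (k : ℝ) ^ 2 * (w₀⁻¹) ^ 2 * (L : ℝ)⁻¹ * ((1 - 2 * η)⁻¹) ^ (∑ i, D i) *
    ((n : ℝ) ^ k / n.descFactorial k) with hK
  have hK0 : 0 ≤ K := by positivity
  set c : Fin k → Fin n → ℝ := fun i b => cellWeight ν μ n (D i) b with hc
  have hc0 : ∀ i b, 0 ≤ c i b := fun i b => cellWeight_nonneg hw₀ hν hμ _ _ _
  have hc1 : ∀ i, ∑ b, c i b ≤ 1 := fun i => sum_cellWeight_le_one hw₀ hν hμ (by omega) _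
  have hq0 : ∀ a : Fin k → Fin n, 0 ≤ ∏ i, c i (a i) := fun a =>
    Finset.prod_nonneg fun i _ => hc0 i _
  set g : Fin k → Fin n → ℝ := fun i b => (mixedMass ν μ (D i))⁻¹ * (if (b : ℕ) < L then 0 else
    (n : ℝ)⁻¹ * mixedTail ν μ (D i - 2) (Real.log n - Real.log ((b : ℕ) : ℝ))) with hg
  have hg0 : ∀ i b, 0 ≤ g i b := fun i b => by
    refine mul_nonneg (inv_nonneg.2 (hM i).le) ?_
    split_ifs with h
    · exact le_rfl
    · exact mul_nonneg (by positivity) (mixedTail.nonneg hw₀ hν hμ _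
        (log_sub_log_nonneg (by omega) b.2.le))
  -- The five errors are: the error in the clocks, competition for the same edge, bad weights, some
  -- index below `L`, and two equal indices above `L`. In the last two cases `r` is at least the
  -- whole product weight, and nonnegativity of the sampled law suffices.
  set r : (Fin k → Fin n) → ℝ := fun a => (1 - ρ) * ∏ i, c i (a i) + K * ∏ i, g i (a i)
    + (∏ i, mixedMass ν μ (D i))⁻¹ * ((n.descFactorial k : ℝ)⁻¹ * Pc)
    + ∑ i, (if (a i : ℕ) < L then ∏ j, c j (a j) else 0)
    + ∑ i, ∑ j, (if j ≠ i ∧ a i = a j ∧ L ≤ (a i : ℕ) then ∏ l, c l (a l) else 0) with hr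
  have hA1 : ∀ a : Fin k → Fin n, 0 ≤ (1 - ρ) * ∏ i, c i (a i) := fun a =>
    mul_nonneg (by linarith) (hq0 a)
  have hA2 : ∀ a : Fin k → Fin n, 0 ≤ K * ∏ i, g i (a i) := fun a =>
    mul_nonneg hK0 (Finset.prod_nonneg fun i _ => hg0 i _)
  have hA3 : 0 ≤ (∏ i, mixedMass ν μ (D i))⁻¹ * ((n.descFactorial k : ℝ)⁻¹ * Pc) := by positivity
  have hB1 : ∀ (a : Fin k → Fin n) i, 0 ≤ if (a i : ℕ) < L then ∏ j, c j (a j) else 0 :=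
    fun a i => by split_ifs <;> simp [hq0]
  have hB2 : ∀ (a : Fin k → Fin n) i j, 0 ≤
      if j ≠ i ∧ a i = a j ∧ L ≤ (a i : ℕ) then ∏ l, c l (a l) else 0 :=
    fun a i j => by split_ifs <;> simp [hq0]
  have hS1 : ∀ a : Fin k → Fin n, 0 ≤ ∑ i, (if (a i : ℕ) < L then ∏ j, c j (a j) else 0) :=
    fun a => Finset.sum_nonneg fun i _ => hB1 a i
  have hS2 : ∀ a : Fin k → Fin n, 0 ≤
      ∑ i, ∑ j, (if j ≠ i ∧ a i = a j ∧ L ≤ (a i : ℕ) then ∏ l, c l (a l) else 0) :=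
    fun a => Finset.sum_nonneg fun i _ => Finset.sum_nonneg fun j _ => hB2 a i j
  have hr0 : ∀ a, 0 ≤ r a := fun a => by
    simp only [hr]
    linarith [hA1 a, hA2 a, hS1 a, hS2 a]
  have hlow : ∀ a, ∏ i, c i (a i) - r a ≤ (∏ i, mixedMass ν μ (D i))⁻¹ *
      P.real (sampleEvent parent n v d fun i => (a i : ℕ)) := by
    intro a
    have hp0 : 0 ≤ (∏ i, mixedMass ν μ (D i))⁻¹ *
      P.real (sampleEvent parent n v d fun i => (a i : ℕ)) := by positivity
    by_cases haL : ∀ i, L ≤ (a i : ℕ)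
    · by_cases ha : Function.Injective a
      · have h := prod_cellWeight_sub_le hT hw₀ hν hμ hη0 hη1 hL2 hL hkn hv hD a haL ha
        have hge : ∏ i, ((mixedMass ν μ (D i))⁻¹ * ((n : ℝ)⁻¹ *
            mixedTail ν μ (D i - 2) (Real.log n - Real.log ((a i : ℕ) : ℝ)))) = ∏ i, g i (a i) :=
          Finset.prod_congr rfl fun i _ => by
            simp only [hg]
            rw [if_neg (haL i).not_gt]
        rw [hge] at h
        refine le_trans ?_ h
        simp only [hr]
        linarith [hS1 a, hS2 a]
      · obtain ⟨i, j, hij, hne⟩ : ∃ i j, a i = a j ∧ i ≠ j := by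
          simpa [Function.Injective] using ha
        have h1 := Finset.single_le_sum (f := fun i =>
          ∑ j, (if j ≠ i ∧ a i = a j ∧ L ≤ (a i : ℕ) then ∏ l, c l (a l) else 0))
          (fun i _ => Finset.sum_nonneg fun j _ => hB2 a i j) (Finset.mem_univ i)
        have h2 := Finset.single_le_sum (f := fun j =>
          (if j ≠ i ∧ a i = a j ∧ L ≤ (a i : ℕ) then ∏ l, c l (a l) else 0))
          (fun j _ => hB2 a i j) (Finset.mem_univ j)
        rw [if_pos ⟨hne.symm, hij, haL i⟩] at h2
        simp only [hr]
        linarith [hS1 a, hA1 a, hA2 a]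
    · push Not at haL
      obtain ⟨i, hi⟩ := haL
      have h1 := Finset.single_le_sum (f := fun i =>
        (if (a i : ℕ) < L then ∏ j, c j (a j) else 0)) (fun i _ => hB1 a i) (Finset.mem_univ i)
      rw [if_pos hi] at h1
      simp only [hr]
      linarith [hS2 a, hA1 a, hA2 a]
  have htail : ∀ i, 0 ≤ δ i := fun i => by
    refine le_trans ?_ ((sum_cellWeight_low_le hw₀ hν hμ hLn (D i)).trans (hδ i))
    refine Finset.sum_nonneg fun b _ => ?_
    split_ifs
    · exact hc0 i b
    · exact le_rfl
  have hqsum : ∏ i, (1 - δ i) ≤ ∑ a : Fin k → Fin n, ∏ i, c i (a i) := by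
    rw [sum_pi_prod c]
    refine Finset.prod_le_prod (fun i _ => by linarith [hδ1 i]) fun i _ => ?_
    refine le_trans ?_ (le_sum_cellWeight hw₀ hν hμ (by omega) (D i))
    refine sub_le_sub_left (le_trans ?_ (hδ i)) _
    refine mul_le_mul_of_nonneg_left ?_ (inv_nonneg.2 (hM i).le)
    have h0 := log_sub_log_nonneg (Nat.succ_pos L) hLn
    refine setIntegral_mono_set ((mixedTail.integrableOn_exp_mul hw₀ hν hμ (D i)).mono_set
      (Set.Ioi_subset_Ioi h0)) ?_ (Set.Ioi_subset_Ioi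
        (sub_le_self _ (Real.log_natCast_nonneg _))).eventuallyLE
    refine (ae_restrict_iff' measurableSet_Ioi).2 (Eventually.of_forall fun t ht => ?_)
    exact mul_nonneg (Real.exp_pos _).le
      (mixedTail.nonneg hw₀ hν hμ (D i) (h0.trans (le_of_lt ht)))
  have hrsum : ∑ a, r a ≤ (1 - ρ) + K * (((1 + μ) / w₀) ^ 2) ^ k
        + (n : ℝ) ^ k / n.descFactorial k * ((∏ i, mixedMass ν μ (D i))⁻¹ * Pc)
        + ∑ i, δ i + k ^ 2 * (L : ℝ)⁻¹ := by
    simp only [hr, Finset.sum_add_distrib]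
    refine add_le_add (add_le_add (add_le_add (add_le_add ?_ ?_) (le_of_eq ?_)) ?_) ?_
    · rw [← Finset.mul_sum, sum_pi_prod c]
      refine mul_le_of_le_one_right (by linarith) ?_
      exact Finset.prod_le_one (fun i _ => Finset.sum_nonneg fun b _ => hc0 i b) fun i _ => hc1 i
    · rw [← Finset.mul_sum, sum_pi_prod g]
      refine mul_le_mul_of_nonneg_left ?_ hK0
      refine (Finset.prod_le_prod (fun i _ => Finset.sum_nonneg fun b _ => hg0 i b)
        (g := fun _ => ((1 + μ) / w₀) ^ 2) fun i _ => ?_).trans_eq (by simp)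
      simp only [hg]
      rw [← Finset.mul_sum, inv_mul_le_iff₀ (hM i), mul_comm]
      exact (sum_mixedTail_le hw₀ hν hμ hL2 _).trans (mixedMass.sub_two_le hw₀ hν hμ _)
    · simp only [Finset.sum_const, Finset.card_univ, Fintype.card_fun, Fintype.card_fin,
        nsmul_eq_mul, Nat.cast_pow]
      ring
    · rw [Finset.sum_comm]
      refine Finset.sum_le_sum fun i _ => ?_
      refine sum_prod_filter_le hc0 hc1 i (fun a => (a i : ℕ) < L) (htail i) fun a => ?_
      simp only [Function.update_self]
      exact (sum_cellWeight_low_le hw₀ hν hμ hLn (D i)).trans (hδ i)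
    · rw [Finset.sum_comm]
      have hij : ∀ i j : Fin k, ∑ a : Fin k → Fin n,
          (if j ≠ i ∧ a i = a j ∧ L ≤ (a i : ℕ) then ∏ l, c l (a l) else 0) ≤ (L : ℝ)⁻¹ := by
        intro i j
        -- With the other indices fixed, a coincidence leaves one value for the index in direction
        -- `i`, of weight at most `1 / L`.
        refine sum_prod_filter_le hc0 hc1 i
          (fun a => j ≠ i ∧ a i = a j ∧ L ≤ (a i : ℕ)) (by positivity) fun a => ?_
        by_cases hji : j = i
        · simp [hji]
        · simp only [Function.update_self, Function.update_of_ne hji]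
          refine (Finset.sum_le_sum (g := fun b => if b = a j then (L : ℝ)⁻¹ else 0)
            fun b _ => ?_).trans (by simp)
          split_ifs with h1 h2 h2
          · exact cellWeight_le_inv hw₀ hν hμ (by omega) h1.2.2 _
          · exact absurd h1.2.1 h2
          · positivity
          · exact le_rfl
      calc _ ≤ ∑ i : Fin k, ∑ j : Fin k, (L : ℝ)⁻¹ := by
            refine Finset.sum_le_sum fun i _ => ?_
            rw [Finset.sum_comm]
            exact Finset.sum_le_sum fun j _ => hij i j
        _ = k ^ 2 * (L : ℝ)⁻¹ := by
            simp only [Finset.sum_const, Finset.card_univ, Fintype.card_fin, nsmul_eq_mul]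
            ring
  rw [Finset.mul_sum] at hup
  refine (sum_abs_sub_le Finset.univ (fun a _ => hr0 a) (fun a _ => hlow a)
    (hup.trans (?_ : _ ≤ _ + _))).trans (add_le_add_right
      (mul_le_mul_of_nonneg_left hrsum (by norm_num)) _)
  linarith

end TotalVariation

end WRT

/-! ### Powers of `n` against powers of `log n` -/

section Scales

lemma tendsto_log_natCast_atTop : Tendsto (fun n : ℕ => Real.log n) atTop atTop :=
  Real.tendsto_log_atTop.comp tendsto_natCast_atTop_atTop

lemma tendsto_log_pow_mul_exp_neg (q : ℕ) {g : ℝ} (hg : 0 < g) :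
    Tendsto (fun n : ℕ => Real.log n ^ q * Real.exp (-g * Real.log n)) atTop (𝓝 0) := by
  have h := (tendsto_rpow_mul_exp_neg_mul_atTop_nhds_zero (q : ℝ) g hg).comp
    tendsto_log_natCast_atTop
  refine h.congr fun n => ?_
  simp [Real.rpow_natCast]

lemma tendsto_pow_div_descFactorial (k : ℕ) :
    Tendsto (fun n : ℕ => (n : ℝ) ^ k / n.descFactorial k) atTop (𝓝 1) := by
  have h := (isEquivalent_descFactorial k).symm
  refine (Asymptotics.isEquivalent_iff_tendsto_one ?_).1 h
  filter_upwards [eventually_ge_atTop k] with n hn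
  exact (WRT.descFactorial_pos hn).ne'

lemma tendsto_one_sub_pow {y : ℕ → ℝ} {D : ℕ → ℕ} (hy0 : ∀ᶠ n in atTop, 0 ≤ y n)
    (hy1 : ∀ᶠ n in atTop, y n ≤ 1) (hD : Tendsto (fun n => D n * y n) atTop (𝓝 0)) :
    Tendsto (fun n => (1 - y n) ^ D n) atTop (𝓝 1) := by
  have h1 : Tendsto (fun n => 1 - D n * y n) atTop (𝓝 1) := by simpa using hD.const_sub 1
  refine tendsto_of_tendsto_of_tendsto_of_le_of_le' h1 tendsto_const_nhds ?_ ?_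
  · filter_upwards [hy0, hy1] with n h0 h1
    have := one_add_mul_le_pow (a := -y n) (by linarith) (D n)
    calc 1 - D n * y n = 1 + D n * -y n := by ring
      _ ≤ (1 + -y n) ^ D n := this
      _ = (1 - y n) ^ D n := by ring
  · filter_upwards [hy0, hy1] with n h0 h1
    exact pow_le_one₀ (by linarith) (by linarith)

variable {ε : ℝ}

lemma tendsto_natCast_rpow_neg (hε : 0 < ε) :
    Tendsto (fun n : ℕ => (n : ℝ) ^ (-ε)) atTop (𝓝 0) :=
  (tendsto_rpow_neg_atTop hε).comp tendsto_natCast_atTop_atTop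

lemma tendsto_natCast_rpow (hε : 0 < ε) : Tendsto (fun n : ℕ => (n : ℝ) ^ ε) atTop atTop :=
  (tendsto_rpow_atTop hε).comp tendsto_natCast_atTop_atTop

lemma tendsto_log_mul_rpow_neg (hε : 0 < ε) :
    Tendsto (fun n : ℕ => Real.log n * (n : ℝ) ^ (-ε)) atTop (𝓝 0) := by
  have h := tendsto_log_pow_mul_exp_neg 1 hε
  refine h.congr' ?_
  filter_upwards [eventually_ge_atTop 1] with n hn
  have : (0 : ℝ) < n := by exact_mod_cast hn
  rw [Real.rpow_def_of_pos this, pow_one, mul_comm (-ε)]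

lemma tendsto_natCast_mul_rpow_neg (hε : 0 < ε) {c : ℝ} {D : ℕ → ℕ}
    (hD : ∀ᶠ n : ℕ in atTop, (D n : ℝ) ≤ c * Real.log n) :
    Tendsto (fun n : ℕ => D n * (n : ℝ) ^ (-ε)) atTop (𝓝 0) := by
  have h := (tendsto_log_mul_rpow_neg hε).const_mul c
  rw [mul_zero] at h
  refine squeeze_zero' (Eventually.of_forall fun n => by positivity) ?_ h
  filter_upwards [hD] with n hn
  rw [← mul_assoc]
  exact mul_le_mul_of_nonneg_right hn (by positivity)

end Scales

/-! ### Discarded contributions relative to the mass -/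

section MassRatios

variable {ν : Measure ℝ} [IsProbabilityMeasure ν] {w₀ μ : ℝ}
  (hw₀ : 0 < w₀) (hν : ∀ᵐ x ∂ν, w₀ ≤ x ∧ x ≤ 1) (hμ : 0 < μ) {C : ℝ} {q : ℕ} (hC : 0 < C)
  (htail : ∀ y : ℝ, 0 < y → y ≤ 1 → C * y ^ q ≤ ν.real (Set.Ici (1 - y)))

include hw₀ hν hμ hC htail

/-- The mass is of order at least `d ^ (-q) * (1 + μ) ^ (-d)`, so a Chernoff factor `s ^ (-d)`
exceeds it by at most a polynomial times `((1 + μ) / s) ^ d`. -/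
lemma inv_mixedMass_mul_pow_le {s : ℝ} (hs1 : 1 ≤ s) (hsμ : s ≤ 1 + μ) {d : ℕ} (hd : 2 ≤ d)
    {y : ℝ} (hdy : (d : ℝ) ≤ y) :
    (mixedMass ν μ d)⁻¹ * (s⁻¹) ^ d ≤ 4 / C * y ^ q * Real.exp (y * Real.log ((1 + μ) / s)) := by
  have h := mixedMass.ge_pow hw₀ hν hμ hC htail hd
  have hd0 : (0 : ℝ) < d := by
    have : 0 < d := by omega
    exact_mod_cast this
  have hs0 : 0 < s := by linarith
  have hy0 : 0 ≤ y := hd0.le.trans hdy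
  have h1 : (mixedMass ν μ d)⁻¹ ≤ 4 / C * (d : ℝ) ^ q * (1 + μ) ^ d := by
    refine (inv_anti₀ (by positivity) h).trans_eq ?_
    simp only [mul_inv, inv_div, inv_pow, inv_inv]
  have h2 : ((1 + μ) / s) ^ d ≤ Real.exp (y * Real.log ((1 + μ) / s)) := by
    have hpos : 0 < (1 + μ) / s := by positivity
    rw [← Real.rpow_natCast, Real.rpow_def_of_pos hpos, mul_comm, Real.exp_le_exp]
    exact mul_le_mul_of_nonneg_right hdy (Real.log_nonneg ((one_le_div hs0).2 hsμ))
  calc (mixedMass ν μ d)⁻¹ * (s⁻¹) ^ d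
      ≤ 4 / C * (d : ℝ) ^ q * (1 + μ) ^ d * (s⁻¹) ^ d :=
        mul_le_mul_of_nonneg_right h1 (by positivity)
    _ = 4 / C * (d : ℝ) ^ q * ((1 + μ) / s) ^ d := by rw [div_pow, inv_pow]; ring
    _ ≤ _ := by gcongr

/-- Used with `x = log n`. Times beyond `x - ℓ` are those of the lowest labels, and the exponent is
the Chernoff rate reduced by the fraction `ε` of logarithmic time that is cut off. -/
lemma inv_mixedMass_mul_tail_le {s c x ℓ ε : ℝ} (hs1 : 1 ≤ s) (hsμ : s < 1 + μ) {d : ℕ}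
    (hd : 2 ≤ d) (hdc : (d : ℝ) ≤ c * x) (hℓ0 : 0 ≤ ℓ) (hℓx : ℓ ≤ x)
    (hℓ : ℓ ≤ ε * x + Real.log 3) :
    (mixedMass ν μ d)⁻¹ * ∫ t in Set.Ioi (x - ℓ), Real.exp (-t) * mixedTail ν μ d t
      ≤ 4 / C * c ^ q * (1 - (s - 1) / μ)⁻¹ * 3 * (x ^ q *
        Real.exp (-(1 - (s - 1) / μ - c * Real.log ((1 + μ) / s) - ε) * x)) := by
  have hκ : 0 < 1 - (s - 1) / μ := by rw [sub_pos, div_lt_one hμ]; linarith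
  have hκ1 : 1 - (s - 1) / μ ≤ 1 := by
    have : 0 ≤ (s - 1) / μ := div_nonneg (by linarith) hμ.le
    linarith
  have hM := mixedMass_pos hw₀ hν hμ d
  have h1 := setIntegral_Ioi_mixedTail_le hw₀ hν hμ d hs1 hsμ (sub_nonneg.2 hℓx)
  have h2 := inv_mixedMass_mul_pow_le hw₀ hν hμ hC htail hs1 hsμ.le hd hdc
  set κ := 1 - (s - 1) / μ with hκd
  have h3 : Real.exp (-κ * (x - ℓ)) ≤ 3 * Real.exp (-κ * x + ε * x) := by
    rw [← Real.exp_log (by norm_num : (0 : ℝ) < 3), ← Real.exp_add, Real.exp_le_exp]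
    have : κ * ℓ ≤ ℓ := mul_le_of_le_one_left hℓ0 hκ1
    linarith
  have hcx : 0 ≤ c * x := le_trans (Nat.cast_nonneg d) hdc
  calc _ ≤ (mixedMass ν μ d)⁻¹ * ((s⁻¹) ^ d * κ⁻¹ * Real.exp (-κ * (x - ℓ))) :=
        mul_le_mul_of_nonneg_left h1 (inv_nonneg.2 hM.le)
    _ = ((mixedMass ν μ d)⁻¹ * (s⁻¹) ^ d) * (κ⁻¹ * Real.exp (-κ * (x - ℓ))) := by ring
    _ ≤ (4 / C * (c * x) ^ q * Real.exp (c * x * Real.log ((1 + μ) / s))) *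
        (κ⁻¹ * (3 * Real.exp (-κ * x + ε * x))) := by gcongr
    _ = 4 / C * c ^ q * κ⁻¹ * 3 * (x ^ q * (Real.exp (c * x * Real.log ((1 + μ) / s)) *
        Real.exp (-κ * x + ε * x))) := by rw [mul_pow]; ring
    _ = _ := by
        rw [← Real.exp_add]
        congr 4
        ring

/-- The same rate governs the low vertices of the actual tree: they form a fraction of order `n ^ (ε
- 1)` and each satisfies the crude exponential bound. The corrections are all of order `ε`, with the
displayed constant. -/
lemma inv_mixedMass_mul_low_le {s c ε η : ℝ} (hs1 : 1 ≤ s) (hsμ : s ≤ 1 + μ) {d n L : ℕ}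
    (hd : 2 ≤ d) (hdc : (d : ℝ) ≤ c * Real.log n) (hn : 1 ≤ n) (hL : 1 ≤ L)
    (hLn : (L : ℝ) ≤ 2 * (n : ℝ) ^ ε) (hη0 : 0 ≤ η) (hη : η ≤ 1 / 2) (hηε : η ≤ ε) :
    (mixedMass ν μ d)⁻¹ * (L / n * ((s⁻¹) ^ d * Real.exp ((s - 1) *
        (w₀⁻¹ * (1 + Real.log L) + (μ * (1 - η))⁻¹ * (1 + Real.log n)))))
      ≤ 4 / C * c ^ q * 2 * Real.exp ((s - 1) * (w₀⁻¹ * (1 + Real.log 2) + 2 / μ)) *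
        (Real.log n ^ q * Real.exp (-(1 - (s - 1) / μ - c * Real.log ((1 + μ) / s)
          - ε * (1 + (s - 1) * (w₀⁻¹ + 2 / μ))) * Real.log n)) := by
  have hn0 : (0 : ℝ) < n := by exact_mod_cast hn
  have hL0 : (0 : ℝ) < L := by exact_mod_cast hL
  have hM := mixedMass_pos hw₀ hν hμ d
  have h2 := inv_mixedMass_mul_pow_le hw₀ hν hμ hC htail hs1 hsμ hd hdc
  set x := Real.log n with hx
  have hx0 : 0 ≤ x := Real.log_natCast_nonneg n
  have hs0 : 0 ≤ s - 1 := by linarith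
  have hcx : 0 ≤ c * x := le_trans (Nat.cast_nonneg d) hdc
  have hnε : (n : ℝ) ^ ε = Real.exp (ε * x) := by
    rw [Real.rpow_def_of_pos hn0, mul_comm]
  have hLn' : (L : ℝ) / n ≤ 2 * Real.exp (ε * x - x) := by
    rw [div_le_iff₀ hn0, Real.exp_sub, hx, Real.exp_log hn0, ← hx, ← hnε]
    field_simp
    exact hLn
  have hlogL : Real.log L ≤ Real.log 2 + ε * x := by
    rw [← Real.log_exp (ε * x), ← hnε, ← Real.log_mul (by norm_num) (by positivity)]
    exact Real.log_le_log hL0 hLn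
  have hinv : (μ * (1 - η))⁻¹ ≤ μ⁻¹ * (1 + 2 * η) := by
    rw [mul_inv]
    refine mul_le_mul_of_nonneg_left ?_ (inv_nonneg.2 hμ.le)
    rw [inv_le_iff_one_le_mul₀ (by linarith)]
    nlinarith
  have hexp : (s - 1) * (w₀⁻¹ * (1 + Real.log L) + (μ * (1 - η))⁻¹ * (1 + x))
      ≤ (s - 1) * (w₀⁻¹ * (1 + Real.log 2) + 2 / μ)
        + ((s - 1) / μ + ε * ((s - 1) * (w₀⁻¹ + 2 / μ))) * x := by
    have e1 : w₀⁻¹ * (1 + Real.log L) ≤ w₀⁻¹ * (1 + Real.log 2 + ε * x) :=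
      mul_le_mul_of_nonneg_left (by linarith) (inv_nonneg.2 hw₀.le)
    have e2 : (μ * (1 - η))⁻¹ * (1 + x) ≤ μ⁻¹ * 2 + μ⁻¹ * (1 + 2 * ε) * x := by
      refine (mul_le_mul_of_nonneg_right hinv (by linarith)).trans ?_
      have hμi : 0 ≤ μ⁻¹ := inv_nonneg.2 hμ.le
      have e3 : (1 + 2 * η) * (1 + x) ≤ 2 + (1 + 2 * ε) * x := by nlinarith
      calc μ⁻¹ * (1 + 2 * η) * (1 + x) = μ⁻¹ * ((1 + 2 * η) * (1 + x)) := by ring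
        _ ≤ μ⁻¹ * (2 + (1 + 2 * ε) * x) := mul_le_mul_of_nonneg_left e3 hμi
        _ = _ := by ring
    refine (mul_le_mul_of_nonneg_left (add_le_add e1 e2) hs0).trans_eq ?_
    ring
  calc _ = ((mixedMass ν μ d)⁻¹ * (s⁻¹) ^ d) * (L / n * Real.exp ((s - 1) *
        (w₀⁻¹ * (1 + Real.log L) + (μ * (1 - η))⁻¹ * (1 + x)))) := by ring
    _ ≤ (4 / C * (c * x) ^ q * Real.exp (c * x * Real.log ((1 + μ) / s))) *
        (2 * Real.exp (ε * x - x) * Real.exp ((s - 1) * (w₀⁻¹ * (1 + Real.log 2) + 2 / μ)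
        + ((s - 1) / μ + ε * ((s - 1) * (w₀⁻¹ + 2 / μ))) * x)) := by
        gcongr
    _ = 4 / C * c ^ q * 2 * Real.exp ((s - 1) * (w₀⁻¹ * (1 + Real.log 2) + 2 / μ)) *
        (x ^ q * (Real.exp (c * x * Real.log ((1 + μ) / s)) * Real.exp (ε * x - x) *
          Real.exp (((s - 1) / μ + ε * ((s - 1) * (w₀⁻¹ + 2 / μ))) * x))) := by
        rw [Real.exp_add, mul_pow]; ring
    _ = _ := by
        rw [← Real.exp_add, ← Real.exp_add]
        congr 4
        ring

end MassRatios

/-- The rate of the Chernoff bound for the low vertices can be made positive. -/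
lemma exists_chernoff_rate {μ c : ℝ} (hμ : 0 < μ) (hc : c * μ < 1 + μ) :
    ∃ s, 1 ≤ s ∧ s < 1 + μ ∧ 0 < 1 - (s - 1) / μ - c * Real.log ((1 + μ) / s) := by
  rcases le_or_gt c 0 with hc0 | hc0
  · refine ⟨1, le_rfl, by linarith, ?_⟩
    have : 0 ≤ Real.log (1 + μ) := Real.log_nonneg (by linarith)
    simp only [sub_self, zero_div, sub_zero, div_one]
    nlinarith
  -- After `log y ≤ y - 1` the rate is bounded below by `(1 + μ - s) * (s - c * μ) / (μ * s)`,
  -- positive for `c * μ < s < 1 + μ`. This interval is nonempty precisely by the hypothesis on `c`.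
  obtain ⟨s, hs1, hs2⟩ := exists_between (max_lt (by linarith : (1 : ℝ) < 1 + μ) hc)
  have h1 : 1 < s := (le_max_left _ _).trans_lt hs1
  have h2 : c * μ < s := (le_max_right _ _).trans_lt hs1
  have hs0 : 0 < s := by linarith
  refine ⟨s, h1.le, hs2, ?_⟩
  have h3 : Real.log ((1 + μ) / s) ≤ (1 + μ) / s - 1 :=
    Real.log_le_sub_one_of_pos (by positivity)
  have h4 : c * Real.log ((1 + μ) / s) ≤ c * ((1 + μ) / s - 1) :=
    mul_le_mul_of_nonneg_left h3 hc0.le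
  have h5 : 1 - (s - 1) / μ - c * ((1 + μ) / s - 1) = (1 + μ - s) * (s - c * μ) / (μ * s) := by
    field_simp
    ring
  have h6 : 0 < (1 + μ - s) * (s - c * μ) / (μ * s) :=
    div_pos (mul_pos (by linarith) (by linarith)) (by positivity)
  linarith

/-! ### Convergence to a product law in total variation -/

namespace WRT

section Asymptotics

variable {Ω : Type*} [mΩ : MeasurableSpace Ω] {P : Measure Ω} [IsProbabilityMeasure P]
  {ν : Measure ℝ} [IsProbabilityMeasure ν] {W : ℕ → Ω → ℝ} {parent : ℕ → Ω → ℕ} {k : ℕ}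
  {w₀ μ : ℝ}

/-- The bad event is negligible with respect to the probability of the degree event. -/
lemma tendsto_inv_mixedMass_mul_compl_goodEvent (hT : IsWeightedRecursiveTree P ν W parent)
    (hw₀ : 0 < w₀) (hν : ∀ᵐ x ∂ν, w₀ ≤ x ∧ x ≤ 1) (hμ : 0 < μ) (hμν : ∫ x, x ∂ν = μ)
    {ε c : ℝ} (hε : 0 < ε) {D : Fin k → ℕ → ℕ}
    (hD : ∀ i, ∀ᶠ n : ℕ in atTop, (D i n : ℝ) ≤ c * Real.log n) :
    Tendsto (fun n : ℕ => (∏ i, mixedMass ν μ (D i n))⁻¹ *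
      P.real (goodEvent W μ ((n : ℝ) ^ (-(ε / 4))) ⌈(n : ℝ) ^ ε⌉₊ n)ᶜ) atTop (𝓝 0) := by
  set S : ℝ := k * (c * Real.log ((1 + μ) / w₀)) with hS
  have hw1 : w₀ ≤ 1 := by
    obtain ⟨x, hx⟩ := hν.exists
    exact hx.1.trans hx.2
  have hratio : 1 ≤ (1 + μ) / w₀ := (one_le_div hw₀).2 (by linarith)
  have hlog : 0 ≤ Real.log ((1 + μ) / w₀) := Real.log_nonneg hratio
  -- In the variable `n ^ (ε / 2)` the exponent `(1 + S) * (2 / ε)` produces `n ^ (1 + S)`: a factor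
  -- `n` from the union bound and `n ^ S` from the inverse masses. The exponential wins because `η ^
  -- 2 * L ≥ n ^ (ε / 2)`.
  have hlim := ((tendsto_rpow_mul_exp_neg_mul_atTop_nhds_zero ((1 + S) * (2 / ε)) (2 * μ ^ 2)
    (by positivity)).comp (tendsto_natCast_rpow (half_pos hε))).const_mul 2
  rw [mul_zero] at hlim
  refine squeeze_zero' (Eventually.of_forall fun n => ?_) ?_ hlim
  · exact mul_nonneg (inv_nonneg.2 (Finset.prod_nonneg fun i _ =>
      (mixedMass_pos hw₀ hν hμ _).le)) measureReal_nonneg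
  filter_upwards [eventually_all.2 hD, eventually_ge_atTop 1] with n hn hn1
  have hn0 : (0 : ℝ) < n := by exact_mod_cast hn1
  set x := Real.log n with hx
  have hrp : ∀ r : ℝ, (n : ℝ) ^ r = Real.exp (r * x) := fun r => by
    rw [Real.rpow_def_of_pos hn0, mul_comm]
  have hη0 : 0 ≤ (n : ℝ) ^ (-(ε / 4)) := by positivity
  have hL1 : 1 ≤ ⌈(n : ℝ) ^ ε⌉₊ := Nat.one_le_ceil_iff.2 (by positivity)
  have hbad := measureReal_compl_goodEvent_le hT hw₀ hν hμ hμν hη0 (n := n) hL1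
  have hexp : Real.exp (-2 * ((n : ℝ) ^ (-(ε / 4)) * μ) ^ 2 * (⌈(n : ℝ) ^ ε⌉₊ : ℕ))
      ≤ Real.exp (-(2 * μ ^ 2) * (n : ℝ) ^ (ε / 2)) := by
    rw [Real.exp_le_exp]
    have h1 : (n : ℝ) ^ ε ≤ (⌈(n : ℝ) ^ ε⌉₊ : ℕ) := Nat.le_ceil _
    have h2 : ((n : ℝ) ^ (-(ε / 4))) ^ 2 * (n : ℝ) ^ ε = (n : ℝ) ^ (ε / 2) := by
      simp only [hrp]
      rw [← Real.exp_nat_mul, ← Real.exp_add]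
      congr 1
      push_cast
      ring
    have h3 := mul_le_mul_of_nonneg_left h1
      (by positivity : 0 ≤ 2 * μ ^ 2 * ((n : ℝ) ^ (-(ε / 4))) ^ 2)
    linear_combination h3 - 2 * μ ^ 2 * h2
  have hinv : (∏ i, mixedMass ν μ (D i n))⁻¹ ≤ Real.exp (S * x) := by
    rw [← Finset.prod_inv_distrib]
    have : ∏ i : Fin k, (mixedMass ν μ (D i n))⁻¹
        ≤ ∏ _i : Fin k, Real.exp (c * Real.log ((1 + μ) / w₀) * x) := by
      refine Finset.prod_le_prod (fun i _ => inv_nonneg.2 (mixedMass_pos hw₀ hν hμ _).le)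
        fun i _ => ?_
      have h1 := mixedMass.pos hw₀ hν hμ (D i n)
      refine (inv_anti₀ (by positivity) h1).trans ?_
      rw [← inv_pow, inv_div, ← Real.rpow_natCast, Real.rpow_def_of_pos (by positivity),
        Real.exp_le_exp]
      have := mul_le_mul_of_nonneg_left (hn i) hlog
      linarith
    refine this.trans_eq ?_
    rw [Finset.prod_const, Finset.card_univ, Fintype.card_fin, ← Real.exp_nat_mul, hS]
    congr 1
    ring
  have hz : ((n : ℝ) ^ (ε / 2)) ^ ((1 + S) * (2 / ε)) = Real.exp (S * x) * n := by
    rw [← Real.rpow_mul hn0.le, hrp]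
    have : ε / 2 * ((1 + S) * (2 / ε)) * x = S * x + x := by
      field_simp
      ring
    rw [this, Real.exp_add, hx, Real.exp_log hn0]
  calc _ ≤ Real.exp (S * x) * (n * (2 * Real.exp (-(2 * μ ^ 2) * (n : ℝ) ^ (ε / 2)))) :=
        mul_le_mul hinv (hbad.trans (by gcongr)) measureReal_nonneg (Real.exp_pos _).le
    _ = _ := by
        simp only [Function.comp_apply]
        rw [hz]
        ring

/-- The normalised law of the sampled vertices on the degree event is asymptotically a product
law. -/
theorem tendsto_sum_abs_sub_prod_cellWeight (hT : IsWeightedRecursiveTree P ν W parent)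
    (hw₀ : 0 < w₀) (hν : ∀ᵐ x ∂ν, w₀ ≤ x ∧ x ≤ 1) (hμ : 0 < μ) (hμν : ∫ x, x ∂ν = μ)
    {C : ℝ} {q : ℕ} (hC : 0 < C)
    (htail : ∀ y : ℝ, 0 < y → y ≤ 1 → C * y ^ q ≤ ν.real (Set.Ici (1 - y)))
    {c : ℝ} (hc : c * μ < 1 + μ) {d : Fin k → ℕ → ℤ} {D : Fin k → ℕ → ℕ}
    (hdD : ∀ n, (fun i => D i n) = fun i => (d i n).toNat)
    (hD : ∀ i, Tendsto (D i) atTop atTop)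
    (hDc : ∀ i, ∀ᶠ n : ℕ in atTop, (D i n : ℝ) ≤ c * Real.log n)
    {v : ℕ → Fin k → Ω → ℕ} (hv : ∀ n, k ≤ n → IsUniformSample P W parent n k (v n)) :
    Tendsto (fun n : ℕ => ∑ a : Fin k → Fin n, |(∏ i, mixedMass ν μ (D i n))⁻¹ *
        P.real (sampleEvent parent n (v n) (fun i => d i n) fun i => (a i : ℕ))
        - ∏ i, cellWeight ν μ n (D i n) (a i)|) atTop (𝓝 0) := by
  obtain ⟨s, hs1, hsμ, hg⟩ := exists_chernoff_rate hμ hc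
  set g := 1 - (s - 1) / μ - c * Real.log ((1 + μ) / s) with hgd
  set K₁ := 1 + (s - 1) * (w₀⁻¹ + 2 / μ) with hK₁
  have hK1 : 1 ≤ K₁ := by
    have : 0 ≤ (s - 1) * (w₀⁻¹ + 2 / μ) := mul_nonneg (by linarith) (by positivity)
    linarith
  -- Small enough that both reduced rates `g - ε` and `g - ε * K₁` stay positive, and that `L + 1 ≤
  -- n` eventually.
  obtain ⟨ε, hε0, hε1⟩ : ∃ ε, 0 < ε ∧ ε < min (1 / 2) (g / (2 * K₁)) :=
    exists_between (lt_min (by norm_num) (by positivity))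
  have hε2 : ε < 1 / 2 := hε1.trans_le (min_le_left _ _)
  have hεg : ε * K₁ < g / 2 := by
    have := hε1.trans_le (min_le_right _ _)
    rw [lt_div_iff₀ (by positivity)] at this
    linarith
  have hεg' : ε < g / 2 := lt_of_le_of_lt (le_mul_of_one_le_right hε0.le hK1) hεg
  -- The exponent `ε / 4` balances three needs: `η * log n` tends to zero, `η * L` tends to
  -- infinity, and `η ^ 2 * L` grows like a power of `n`.
  set η : ℕ → ℝ := fun n => (n : ℝ) ^ (-(ε / 4)) with hη
  set L : ℕ → ℕ := fun n => ⌈(n : ℝ) ^ ε⌉₊ with hL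
  have hε4 : 0 < ε / 4 := by linarith
  have hηlim : Tendsto η atTop (𝓝 0) := tendsto_natCast_rpow_neg hε4
  have hη0 : ∀ n, 0 ≤ η n := fun n => by positivity
  have hηsmall : ∀ᶠ n in atTop, η n < min (1 / 4) ε :=
    hηlim.eventually_lt_const (lt_min (by norm_num) hε0)
  have hLlim : Tendsto (fun n => (L n : ℝ)) atTop atTop :=
    tendsto_atTop_mono (fun n => Nat.le_ceil _) (tendsto_natCast_rpow hε0)
  have hL2 : ∀ᶠ n in atTop, 2 ≤ L n := by
    filter_upwards [hLlim.eventually_ge_atTop 2] with n hn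
    exact_mod_cast hn
  have hL1 : ∀ n : ℕ, 1 ≤ n → (L n : ℝ) ≤ 2 * (n : ℝ) ^ ε ∧
      ((L n + 1 : ℕ) : ℝ) ≤ 3 * (n : ℝ) ^ ε := fun n hn => by
    have h1 : (1 : ℝ) ≤ (n : ℝ) ^ ε := Real.one_le_rpow (by exact_mod_cast hn) hε0.le
    have h2 : (L n : ℝ) < (n : ℝ) ^ ε + 1 := Nat.ceil_lt_add_one (by positivity)
    push_cast
    constructor <;> linarith
  have hLn : ∀ᶠ n in atTop, L n + 1 ≤ n := by
    filter_upwards [(tendsto_natCast_rpow (by linarith : (0 : ℝ) < 1 - ε)).eventually_ge_atTop 3,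
      eventually_ge_atTop 1] with n hn hn1
    have hn0 : (0 : ℝ) < n := by exact_mod_cast hn1
    have h1 := (hL1 n hn1).2
    have h2 : (n : ℝ) ^ (1 - ε) * (n : ℝ) ^ ε = n := by
      rw [← Real.rpow_add hn0]; simp
    have h3 : ((L n + 1 : ℕ) : ℝ) ≤ n := by
      exact h1.trans ((mul_le_mul_of_nonneg_right hn (by positivity)).trans_eq h2)
    exact_mod_cast h3
  have hLη : ∀ᶠ n in atTop, 1 ≤ η n * μ * L n := by
    filter_upwards [(tendsto_natCast_rpow (by linarith : (0 : ℝ) < 3 / 4 * ε)).eventually_ge_atTop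
      μ⁻¹, eventually_ge_atTop 1] with n hn hn1
    have hn0 : (0 : ℝ) < n := by exact_mod_cast hn1
    have h1 : (n : ℝ) ^ ε ≤ L n := Nat.le_ceil _
    have h2 : η n * (n : ℝ) ^ ε = (n : ℝ) ^ (3 / 4 * ε) := by
      simp only [hη]
      rw [← Real.rpow_add hn0]
      congr 1
      ring
    have h3 : 1 ≤ μ * (n : ℝ) ^ (3 / 4 * ε) := by
      rwa [inv_le_iff_one_le_mul₀' hμ] at hn
    calc (1 : ℝ) ≤ μ * (n : ℝ) ^ (3 / 4 * ε) := h3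
      _ = η n * μ * (n : ℝ) ^ ε := by rw [← h2]; ring
      _ ≤ η n * μ * L n := mul_le_mul_of_nonneg_left h1 (mul_nonneg (hη0 n) hμ.le)
  have hD2 : ∀ᶠ n in atTop, ∀ i, 2 ≤ D i n :=
    eventually_all.2 fun i => (hD i).eventually_ge_atTop 2
  set δ : ℕ → ℝ := fun n => 4 / C * c ^ q * (1 - (s - 1) / μ)⁻¹ * 3 *
    (Real.log n ^ q * Real.exp (-(g - ε) * Real.log n)) with hδ
  have hδlim : Tendsto δ atTop (𝓝 0) := by
    have := (tendsto_log_pow_mul_exp_neg q (by linarith : 0 < g - ε)).const_mul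
      (4 / C * c ^ q * (1 - (s - 1) / μ)⁻¹ * 3)
    rwa [mul_zero] at this
  have hδbd : ∀ᶠ n : ℕ in atTop, ∀ i, (mixedMass ν μ (D i n))⁻¹ *
      ∫ t in Set.Ioi (Real.log n - Real.log ((L n + 1 : ℕ) : ℝ)),
        Real.exp (-t) * mixedTail ν μ (D i n) t ≤ δ n := by
    filter_upwards [hD2, eventually_all.2 hDc, hLn, eventually_ge_atTop 1] with n h2 hc' hLn hn1 i
    have hn0 : (0 : ℝ) < n := by exact_mod_cast hn1
    have hℓ : Real.log ((L n + 1 : ℕ) : ℝ) ≤ ε * Real.log n + Real.log 3 := by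
      refine (Real.log_le_log (by positivity) (hL1 n hn1).2).trans_eq ?_
      rw [Real.log_mul (by norm_num) (by positivity), Real.log_rpow hn0, add_comm]
    exact inv_mixedMass_mul_tail_le hw₀ hν hμ hC htail hs1 hsμ (h2 i) (hc' i)
      (Real.log_natCast_nonneg _) (Real.log_le_log (by positivity) (by exact_mod_cast hLn)) hℓ
  have hlowlim : ∀ i, Tendsto (fun n : ℕ => (mixedMass ν μ (D i n))⁻¹ * (L n / n *
      ((s⁻¹) ^ (D i n) * Real.exp ((s - 1) *
        (w₀⁻¹ * (1 + Real.log (L n)) + (μ * (1 - η n))⁻¹ * (1 + Real.log n)))))) atTop (𝓝 0) := by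
    intro i
    have := (tendsto_log_pow_mul_exp_neg q (by linarith : 0 < g - ε * K₁)).const_mul
      (4 / C * c ^ q * 2 * Real.exp ((s - 1) * (w₀⁻¹ * (1 + Real.log 2) + 2 / μ)))
    rw [mul_zero] at this
    refine squeeze_zero' (Eventually.of_forall fun n => ?_) ?_ this
    · have := mixedMass_pos hw₀ hν hμ (D i n)
      positivity
    · filter_upwards [hD2, hDc i, hL2, hηsmall, eventually_ge_atTop 1] with n h2 hc' hL2 hη' hn1
      exact inv_mixedMass_mul_low_le hw₀ hν hμ hC htail hs1 hsμ.le (h2 i) hc' hn1 (by omega)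
        (hL1 n hn1).1 (hη0 n) (by linarith [hη'.trans_le (min_le_left _ _)])
        (hη'.trans_le (min_le_right _ _)).le
  have hbadlim := tendsto_inv_mixedMass_mul_compl_goodEvent hT hw₀ hν hμ hμν hε0 hDc
  have hηD : ∀ {c' : ℝ} {F : ℕ → ℕ}, (∀ᶠ n : ℕ in atTop, (F n : ℝ) ≤ c' * Real.log n) →
      Tendsto (fun n => ((1 - 2 * η n)⁻¹) ^ F n) atTop (𝓝 1) ∧
      Tendsto (fun n => ((1 + η n)⁻¹) ^ F n) atTop (𝓝 1) := by
    intro c' F hF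
    have h1 : Tendsto (fun n => F n * η n) atTop (𝓝 0) := tendsto_natCast_mul_rpow_neg hε4 hF
    constructor
    · have h2 : Tendsto (fun n => (1 - 2 * η n) ^ F n) atTop (𝓝 1) := by
        refine tendsto_one_sub_pow (Eventually.of_forall fun n => by linarith [hη0 n]) ?_ ?_
        · filter_upwards [hηsmall] with n hn
          linarith [hn.trans_le (min_le_left _ _)]
        · have := h1.const_mul 2
          rw [mul_zero] at this
          exact this.congr fun n => by ring
      have := h2.inv₀ one_ne_zero
      rw [inv_one] at this
      exact this.congr fun n => (inv_pow _ _).symm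
    · have h2 : Tendsto (fun n => (1 - η n) ^ F n) atTop (𝓝 1) := by
        refine tendsto_one_sub_pow (Eventually.of_forall hη0) ?_ h1
        filter_upwards [hηsmall] with n hn
        linarith [hn.trans_le (min_le_left _ _)]
      refine tendsto_of_tendsto_of_tendsto_of_le_of_le' h2 tendsto_const_nhds ?_ ?_
      · filter_upwards [hηsmall] with n hn
        have h4 := hη0 n
        refine pow_le_pow_left₀ (by linarith [hn.trans_le (min_le_left _ _)]) ?_ _
        rw [← one_div, le_div_iff₀ (by linarith)]
        nlinarith
      · exact Eventually.of_forall fun n => pow_le_one₀ (by have := hη0 n; positivity)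
          (inv_le_one_of_one_le₀ (by linarith [hη0 n]))
  have hsumD : ∀ᶠ n : ℕ in atTop, ((∑ i, D i n : ℕ) : ℝ) ≤ (k * c) * Real.log n := by
    filter_upwards [eventually_all.2 hDc] with n hn
    push_cast
    refine (Finset.sum_le_sum fun i _ => hn i).trans_eq ?_
    simp only [Finset.sum_const, Finset.card_univ, Fintype.card_fin, nsmul_eq_mul]
    ring
  have hR := tendsto_pow_div_descFactorial k
  have hLinv : Tendsto (fun n => (L n : ℝ)⁻¹) atTop (𝓝 0) := hLlim.inv_tendsto_atTop
  have hpart1 := (hR.mul ((tendsto_finsetProd Finset.univ fun i _ =>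
    (hηD (hDc i)).1.add (hlowlim i)).add hbadlim)).sub
    (tendsto_finsetProd (Finset.univ : Finset (Fin k)) fun _ _ => hδlim.const_sub 1)
  have hpart2 := (((((hηD hsumD).2.const_sub 1).add
    ((((hLinv.const_mul (6 * 2 ^ k * (k : ℝ) ^ 2 * (w₀⁻¹) ^ 2)).mul (hηD hsumD).1).mul
      hR).mul_const ((((1 + μ) / w₀) ^ 2) ^ k))).add (hR.mul hbadlim)).add
    (tendsto_finsetSum (Finset.univ : Finset (Fin k)) fun _ _ => hδlim)).add
    (hLinv.const_mul ((k : ℝ) ^ 2))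
  have hall := hpart1.add (hpart2.const_mul 2)
  simp only [add_zero, sub_zero, Finset.prod_const_one, mul_one, sub_self, mul_zero, zero_mul,
    Finset.sum_const_zero] at hall
  refine squeeze_zero' (Eventually.of_forall fun n => Finset.sum_nonneg fun a _ => abs_nonneg _)
    ?_ hall
  filter_upwards [hηsmall, hL2, hLη, hLn, eventually_ge_atTop k, hδbd,
    hδlim.eventually_le_const one_pos] with n h1 h2 h3 h4 h5 h6 h7
  exact sum_abs_sub_prod_cellWeight_le hT hw₀ hν hμ (hη0 n)
    (by linarith [h1.trans_le (min_le_left _ _)]) h2 h3 hs1 h4 h5 (hv n h5) (hdD n)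
    (δ := fun _ => δ n) h6 fun _ => h7

end Asymptotics

end WRT

/-! ### Gaussian limits and Lévy's theorem -/

section CellCentralLimit

variable {ν : Measure ℝ} [IsProbabilityMeasure ν] {w₀ μ C : ℝ} {q : ℕ}

/-- Central limit theorem for the logarithm of a vertex chosen according to `cellWeight`. -/
lemma tendsto_sum_cellWeight_mul_cexp (hw₀ : 0 < w₀) (hν : ∀ᵐ x ∂ν, w₀ ≤ x ∧ x ≤ 1)
    (hμ : 0 < μ) (hC : 0 < C)
    (htail : ∀ y : ℝ, 0 < y → y ≤ 1 → C * y ^ q ≤ ν.real (Set.Ici (1 - y)))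
    {c : ℝ} (hc : c * μ < 1 + μ) {D : ℕ → ℕ} (hD : Tendsto D atTop atTop)
    (hDc : ∀ᶠ n : ℕ in atTop, (D n : ℝ) ≤ c * Real.log n) (u : ℝ) :
    Tendsto (fun n : ℕ => ∑ b : Fin n, (cellWeight ν μ n (D n) b : ℂ) *
      Complex.exp (Complex.I * (u * ((μ / (1 + μ) * D n
        - (Real.log n - Real.log ((b + 1 : ℕ) : ℝ))) / (μ / (1 + μ) * Real.sqrt (D n))) : ℝ)))
      atTop (𝓝 (Complex.exp (-(u : ℂ) ^ 2 / 2))) := by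
  obtain ⟨s, hs1, hsμ, hg⟩ := exists_chernoff_rate hμ hc
  set κ := μ / (1 + μ) with hκ
  have hκ0 : 0 < κ := by positivity
  set e : ℕ → ℕ → ℂ := fun n j => Complex.exp (Complex.I * (u * ((κ * D n
        - (Real.log n - Real.log (j : ℝ))) / (κ * Real.sqrt (D n))) : ℝ)) with he
  have hM : ∀ n, 0 < mixedMass ν μ (D n) := fun n => mixedMass_pos hw₀ hν hμ _
  have hsum : ∀ n : ℕ, ∑ b : Fin n, (cellWeight ν μ n (D n) b : ℂ) * e n (b + 1)
      = (mixedMass ν μ (D n) : ℂ)⁻¹ *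
        ∑ j ∈ Finset.Ico 1 n, (cellMass ν μ n (D n) j : ℂ) * e n j := fun n => by
    rw [← sum_fin_shift n fun j => (cellMass ν μ n (D n) j : ℂ) * e n j, Finset.mul_sum]
    refine Finset.sum_congr rfl fun b _ => ?_
    rw [cellWeight]
    split_ifs
    · push_cast; ring
    · simp
  have hlim := (tendsto_charFun_mixedTail hw₀ hν hμ hC htail u).comp hD
  have hsqrt : Tendsto (fun n => Real.sqrt (D n)) atTop atTop :=
    Real.tendsto_sqrt_atTop.comp (tendsto_natCast_atTop_atTop.comp hD)
  have herr : Tendsto (fun n : ℕ => |u| / (κ * Real.sqrt (D n)) +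
      4 / C * c ^ q * (1 - (s - 1) / μ)⁻¹ * 3 * (Real.log n ^ q * Real.exp
        (-(1 - (s - 1) / μ - c * Real.log ((1 + μ) / s) - 0) * Real.log n))) atTop (𝓝 0) := by
    have h1 : Tendsto (fun n => |u| / (κ * Real.sqrt (D n))) atTop (𝓝 0) :=
      (hsqrt.const_mul_atTop hκ0).const_div_atTop _
    have h2 := (tendsto_log_pow_mul_exp_neg q (by rwa [sub_zero] :
      0 < 1 - (s - 1) / μ - c * Real.log ((1 + μ) / s) - 0)).const_mul
        (4 / C * c ^ q * (1 - (s - 1) / μ)⁻¹ * 3)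
    have h3 := h1.add h2
    rwa [mul_zero, add_zero] at h3
  have hdiff : Tendsto (fun n : ℕ => ∑ b : Fin n, (cellWeight ν μ n (D n) b : ℂ) * e n (b + 1)
      - (mixedMass ν μ (D n) : ℂ)⁻¹ * ∫ t in Set.Ioi (0 : ℝ),
        ((Real.exp (-t) * mixedTail ν μ (D n) t : ℝ) : ℂ) * Complex.exp (Complex.I *
          (u * ((κ * (D n : ℕ) - t) / (κ * Real.sqrt (D n : ℕ))) : ℝ))) atTop (𝓝 0) := by
    refine squeeze_zero_norm' ?_ herr
    filter_upwards [hD.eventually_ge_atTop 2, hDc, eventually_ge_atTop 1] with n h2 hc' hn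
    rw [hsum, ← mul_sub, norm_mul, norm_inv, Complex.norm_real, Real.norm_eq_abs,
      abs_of_pos (hM n)]
    have h := norm_sum_cellMass_mul_cexp_sub_le hw₀ hν hμ (d := D n) (by omega) hn hκ0 u
    -- Only times beyond `log n` itself are missing from the cells, hence `ℓ = 0` and `ε = 0`.
    have ht := inv_mixedMass_mul_tail_le hw₀ hν hμ hC htail hs1 hsμ h2 hc' (ℓ := 0) (ε := 0)
      le_rfl (Real.log_natCast_nonneg n)
      (by rw [zero_mul, zero_add]; exact Real.log_nonneg (by norm_num))
    rw [sub_zero (Real.log n)] at ht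
    refine (mul_le_mul_of_nonneg_left h (inv_nonneg.2 (hM n).le)).trans ?_
    rw [mul_add, mul_comm (|u| / _), ← mul_assoc, inv_mul_cancel₀ (hM n).ne', one_mul]
    exact add_le_add_right ht _
  have := hdiff.add hlim
  rw [zero_add] at this
  exact this.congr fun n => sub_add_cancel _ _

end CellCentralLimit

/-- Lévy's convergence theorem on `Fin k → ℝ`. -/
lemma tendsto_integral_of_tendsto_integral_cexp {k : ℕ} {Q : ℕ → Measure (Fin k → ℝ)}
    {Q₀ : Measure (Fin k → ℝ)} [IsProbabilityMeasure Q₀]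
    (hQ : ∀ᶠ n in atTop, IsProbabilityMeasure (Q n))
    (h : ∀ u : Fin k → ℝ, Tendsto
      (fun n => ∫ x, Complex.exp (Complex.I * (∑ i, u i * x i : ℝ)) ∂(Q n)) atTop
      (𝓝 (∫ x, Complex.exp (Complex.I * (∑ i, u i * x i : ℝ)) ∂Q₀)))
    (f : (Fin k → ℝ) →ᵇ ℝ) :
    Tendsto (fun n => ∫ x, f x ∂(Q n)) atTop (𝓝 (∫ x, f x ∂Q₀)) := by
  obtain ⟨N, hN⟩ := eventually_atTop.1 hQ
  -- Characteristic functions live on an inner product space, so the measures are transported there;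
  -- shifting by `N` makes every term of the sequence a probability measure.
  have hm : Measurable (WithLp.toLp 2 : (Fin k → ℝ) → EuclideanSpace ℝ (Fin k)) :=
    WithLp.measurable_toLp 2 _
  have hprob : ∀ n, IsProbabilityMeasure (Q (n + N)) := fun n => hN _ (by omega)
  have hcf : ∀ (Q' : Measure (Fin k → ℝ)) (t : EuclideanSpace ℝ (Fin k)),
      charFun (Q'.map (WithLp.toLp 2)) t
        = ∫ x, Complex.exp (Complex.I * (∑ i, t i * x i : ℝ)) ∂Q' := fun Q' t => by
    rw [charFun_apply, integral_map hm.aemeasurable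
      (Continuous.aestronglyMeasurable (by fun_prop))]
    refine integral_congr_ae (Eventually.of_forall fun x => ?_)
    simp only [PiLp.inner_apply, RCLike.inner_apply, conj_trivial]
    rw [mul_comm]
  set μs : ℕ → ProbabilityMeasure (EuclideanSpace ℝ (Fin k)) := fun n =>
    ⟨(Q (n + N)).map (WithLp.toLp 2),
      have := hprob n; Measure.isProbabilityMeasure_map hm.aemeasurable⟩ with hμs
  set μ₀ : ProbabilityMeasure (EuclideanSpace ℝ (Fin k)) :=
    ⟨Q₀.map (WithLp.toLp 2), Measure.isProbabilityMeasure_map hm.aemeasurable⟩ with hμ₀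
  have hconv : Tendsto μs atTop (𝓝 μ₀) := by
    refine ProbabilityMeasure.tendsto_of_tendsto_charFun fun t => ?_
    simp only [hμs, hμ₀, ProbabilityMeasure.coe_mk, hcf]
    exact (h fun i => t i).comp (tendsto_add_atTop_nat N)
  rw [ProbabilityMeasure.tendsto_iff_forall_integral_tendsto] at hconv
  have hf := hconv (f.compContinuous ⟨WithLp.ofLp, PiLp.continuous_ofLp 2 _⟩)
  have hint : ∀ Q' : Measure (Fin k → ℝ), ∫ y, (f.compContinuous
      (⟨WithLp.ofLp, PiLp.continuous_ofLp 2 _⟩ : C(EuclideanSpace ℝ (Fin k), Fin k → ℝ))) y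
        ∂(Q'.map (WithLp.toLp 2)) = ∫ x, f x ∂Q' := fun Q' => by
    rw [integral_map hm.aemeasurable
      (BoundedContinuousFunction.continuous _).aestronglyMeasurable]
    rfl
  simp only [hμs, hμ₀, ProbabilityMeasure.coe_mk, hint] at hf
  exact (tendsto_add_atTop_iff_nat N).1 hf

lemma integral_cexp_pi_gaussianReal {k : ℕ} (u : Fin k → ℝ) :
    ∫ x, Complex.exp (Complex.I * (∑ i, u i * x i : ℝ))
      ∂(Measure.pi fun _ : Fin k => gaussianReal 0 1)
      = ∏ i, Complex.exp (-(u i : ℂ) ^ 2 / 2) := by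
  have h1 : ∀ x : Fin k → ℝ, Complex.exp (Complex.I * (∑ i, u i * x i : ℝ))
      = ∏ i, Complex.exp (u i * x i * Complex.I) := fun x => by
    rw [← Complex.exp_sum, ← Finset.sum_mul]
    push_cast
    rw [mul_comm]
  simp only [h1]
  rw [integral_fintype_prod_eq_prod (fun i (y : ℝ) => Complex.exp (u i * y * Complex.I))]
  refine Finset.prod_congr rfl fun i _ => ?_
  rw [← charFun_apply_real, charFun_gaussianReal]
  congr 1
  simp
  ring

/-! ### Conclusion -/

namespace WRT

section Limit

variable {Ω : Type*} [mΩ : MeasurableSpace Ω] {P : Measure Ω} [IsProbabilityMeasure P]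
  {ν : Measure ℝ} [IsProbabilityMeasure ν] {W : ℕ → Ω → ℝ} {parent : ℕ → Ω → ℕ} {k : ℕ}
  {w₀ μ C c : ℝ} {q : ℕ}

/-- All phases have modulus one, so closeness in total variation lets the product law replace the
sampled one. The sum then factorises into `k` one-dimensional sums, each with a Gaussian limit. -/
lemma tendsto_sum_sampleEvent_mul_cexp (hT : IsWeightedRecursiveTree P ν W parent)
    (hw₀ : 0 < w₀) (hν : ∀ᵐ x ∂ν, w₀ ≤ x ∧ x ≤ 1) (hμ : 0 < μ) (hμν : ∫ x, x ∂ν = μ)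
    (hC : 0 < C)
    (htail : ∀ y : ℝ, 0 < y → y ≤ 1 → C * y ^ q ≤ ν.real (Set.Ici (1 - y)))
    (hc : c * μ < 1 + μ) {d : Fin k → ℕ → ℤ} {D : Fin k → ℕ → ℕ}
    (hdD : ∀ n, (fun i => D i n) = fun i => (d i n).toNat)
    (hD : ∀ i, Tendsto (D i) atTop atTop)
    (hDc : ∀ i, ∀ᶠ n : ℕ in atTop, (D i n : ℝ) ≤ c * Real.log n)
    {v : ℕ → Fin k → Ω → ℕ} (hv : ∀ n, k ≤ n → IsUniformSample P W parent n k (v n))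
    (u : Fin k → ℝ) :
    Tendsto (fun n : ℕ => ∑ a : Fin k → Fin n, (((∏ i, mixedMass ν μ (D i n))⁻¹ *
        P.real (sampleEvent parent n (v n) (fun i => d i n) fun i => (a i : ℕ)) : ℝ) : ℂ) *
      ∏ i, Complex.exp (Complex.I * (u i * ((μ / (1 + μ) * D i n
        - (Real.log n - Real.log ((a i + 1 : ℕ) : ℝ))) / (μ / (1 + μ) * Real.sqrt (D i n))) : ℝ)))
      atTop (𝓝 (∏ i, Complex.exp (-(u i : ℂ) ^ 2 / 2))) := by
  have hprod := tendsto_finsetProd Finset.univ fun i _ =>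
    tendsto_sum_cellWeight_mul_cexp hw₀ hν hμ hC htail hc (hD i) (hDc i) (u i)
  have htv := tendsto_sum_abs_sub_prod_cellWeight hT hw₀ hν hμ hμν hC htail hc hdD hD hDc hv
  set e : ∀ n : ℕ, Fin k → Fin n → ℂ := fun n i b => Complex.exp (Complex.I * (u i *
    ((μ / (1 + μ) * D i n - (Real.log n - Real.log ((b + 1 : ℕ) : ℝ))) /
      (μ / (1 + μ) * Real.sqrt (D i n))) : ℝ)) with he
  have he1 : ∀ n i b, ‖e n i b‖ = 1 := fun n i b => by
    simp only [he]
    rw [mul_comm, Complex.norm_exp_ofReal_mul_I]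
  have hdiff : Tendsto (fun n : ℕ => ∑ a : Fin k → Fin n, (((∏ i, mixedMass ν μ (D i n))⁻¹ *
        P.real (sampleEvent parent n (v n) (fun i => d i n) fun i => (a i : ℕ)) : ℝ) : ℂ) *
      ∏ i, e n i (a i) - ∏ i, ∑ b : Fin n, (cellWeight ν μ n (D i n) b : ℂ) * e n i b)
      atTop (𝓝 0) := by
    refine squeeze_zero_norm (fun n => ?_) htv
    rw [← sum_pi_prod fun i (b : Fin n) => (cellWeight ν μ n (D i n) b : ℂ) * e n i b,
      ← Finset.sum_sub_distrib]
    refine (norm_sum_le _ _).trans (Finset.sum_le_sum fun a _ => ?_)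
    rw [Finset.prod_mul_distrib, ← sub_mul, norm_mul, norm_prod]
    simp only [he1, Finset.prod_const_one, mul_one]
    rw [← Complex.ofReal_prod, ← Complex.ofReal_sub, Complex.norm_real, Real.norm_eq_abs]
  have := hdiff.add hprod
  rw [zero_add] at this
  refine this.congr fun n => ?_
  simp only [he, sub_add_cancel]

end Limit

end WRT

/-- Conditionally on the degree events, which eventually have positive probability, the rescaled
labels converge in distribution to `k` independent standard normal random variables. -/
theorem mainTheorem11 {Ω : Type*} [MeasurableSpace Ω] (P : Measure Ω) [IsProbabilityMeasure P]
    (α β wstar : ℝ) (hα : 0 < α) (hβ : 0 < β) (hw0 : 0 < wstar) (hw1 : wstar < 1)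
    (W : ℕ → Ω → ℝ) (parent : ℕ → Ω → ℕ)
    (hT : WRT.IsWeightedRecursiveTree P (truncatedBeta α β wstar) W parent)
    (θ : ℝ) (hθ : θ = thetaOf (truncatedBeta α β wstar))
    (k : ℕ) (hk : 1 ≤ k) (c : ℝ) (hc0 : 0 < c) (hc1 : c < θ / (θ - 1))
    (d : Fin k → ℕ → ℤ) (hd : ∀ i, Tendsto (d i) atTop atTop)
    (hdc : ∀ i, ∀ᶠ n : ℕ in atTop, (d i n : ℝ) ≤ c * Real.log n)
    (v : ℕ → Fin k → Ω → ℕ) (hv : ∀ n, k ≤ n → WRT.IsUniformSample P W parent n k (v n)) :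
    (∀ᶠ n : ℕ in atTop, 0 < P (WRT.degreeEvent parent n (v n) fun i => d i n)) ∧
    ∀ f : (Fin k → ℝ) →ᵇ ℝ,
      Tendsto
        (fun n : ℕ => ∫ ω, f (WRT.rescaledLabels θ n (v n) (fun i => d i n) ω)
          ∂(cond P (WRT.degreeEvent parent n (v n) fun i => d i n)))
        atTop
        (𝓝 (∫ x, f x ∂(Measure.pi fun _ : Fin k => gaussianReal 0 1))) := by
  set ν := truncatedBeta α β wstar with hνdef
  have hνp : IsProbabilityMeasure ν := isProbabilityMeasure_truncatedBeta hα hβ hw1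
  have hν : ∀ᵐ x ∂ν, wstar ≤ x ∧ x ≤ 1 := ae_mem_truncatedBeta
  obtain ⟨C, hC, q, htail⟩ := truncatedBeta_tail hα hβ hw0 hw1
  set μ : ℝ := ∫ x, x ∂ν with hμdef
  have hμ : 0 < μ := hw0.trans_le (integral_truncatedBeta_ge hα hβ hw0 hw1)
  have hθμ : θ = 1 + μ := hθ
  have hc : c * μ < 1 + μ := by
    rw [hθμ, add_sub_cancel_left, lt_div_iff₀ hμ] at hc1
    exact hc1
  set D : Fin k → ℕ → ℕ := fun i n => (d i n).toNat with hDdef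
  have hd0 : ∀ᶠ n in atTop, ∀ i, 0 ≤ d i n :=
    eventually_all.2 fun i => (hd i).eventually_ge_atTop 0
  have hDd : ∀ {n i}, 0 ≤ d i n → ((D i n : ℕ) : ℝ) = (d i n : ℝ) := fun {n i} h => by
    have : ((D i n : ℕ) : ℤ) = d i n := Int.toNat_of_nonneg h
    exact_mod_cast congrArg (fun z : ℤ => (z : ℝ)) this
  have hD : ∀ i, Tendsto (D i) atTop atTop := fun i => by
    refine tendsto_atTop.2 fun m => ?_
    filter_upwards [(hd i).eventually_ge_atTop (m : ℤ)] with n hn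
    simp only [hDdef]
    omega
  have hDc : ∀ i, ∀ᶠ n : ℕ in atTop, (D i n : ℝ) ≤ c * Real.log n := fun i => by
    filter_upwards [hdc i, hd0] with n h1 h2
    rwa [hDd (h2 i)]
  have hlim := WRT.tendsto_sum_sampleEvent_mul_cexp hT hw0 hν hμ rfl hC htail hc
    (d := d) (D := D) (fun n => rfl) hD hDc hv
  have hM : ∀ n, 0 < ∏ i, mixedMass ν μ (D i n) := fun n =>
    Finset.prod_pos fun i _ => mixedMass_pos hw0 hν hμ _
  set E : ℕ → Set Ω := fun n => WRT.degreeEvent parent n (v n) fun i => d i n with hE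
  have hmass : Tendsto (fun n => (((∏ i, mixedMass ν μ (D i n))⁻¹ * P.real (E n) : ℝ) : ℂ))
      atTop (𝓝 1) := by
    -- At frequency zero the limit says that the degree event has probability asymptotic to the
    -- product of the masses. This gives both positivity and the normalisation of the conditional
    -- law.
    have h := hlim 0
    simp only [Pi.zero_apply, zero_mul, Complex.ofReal_zero, mul_zero, Complex.exp_zero,
      Finset.prod_const_one, mul_one, ne_eq, OfNat.ofNat_ne_zero, not_false_eq_true, zero_pow,
      neg_zero, zero_div] at h
    refine h.congr' ?_
    filter_upwards [eventually_ge_atTop k] with n hn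
    rw [hE, WRT.measureReal_degreeEvent hT hn (hv n hn), Finset.mul_sum, Complex.ofReal_sum]
  have hpos : ∀ᶠ n in atTop, 0 < P (E n) := by
    have h1 : Tendsto (fun n => (∏ i, mixedMass ν μ (D i n))⁻¹ * P.real (E n)) atTop (𝓝 1) := by
      have := (Complex.continuous_re.tendsto 1).comp hmass
      simpa only [Function.comp_def, Complex.ofReal_re, Complex.one_re] using this
    filter_upwards [h1.eventually_const_lt one_pos] with n hn
    rw [pos_iff_ne_zero]
    intro h0
    rw [measureReal_def, h0, ENNReal.toReal_zero, mul_zero] at hn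
    exact lt_irrefl _ hn
  refine ⟨hpos, fun f => ?_⟩
  set X : ℕ → Ω → Fin k → ℝ := fun n => WRT.rescaledLabels θ n (v n) fun i => d i n with hX
  set x : ℕ → Fin k → ℕ → ℝ := fun n i b => (μ / (1 + μ) * D i n
    - (Real.log n - Real.log ((b + 1 : ℕ) : ℝ))) / (μ / (1 + μ) * Real.sqrt (D i n)) with hx
  have hXx : ∀ᶠ n in atTop, X n = fun ω i => x n i (v n i ω) := by
    filter_upwards [hd0] with n hn
    funext ω i
    have hb : 1 - θ⁻¹ = μ / (1 + μ) := by
      rw [hθμ]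
      field_simp
      ring
    simp only [hX, WRT.rescaledLabels, hx]
    rw [hb, ← hDd (hn i), Real.sqrt_mul (sq_nonneg _), Real.sqrt_sq (by positivity)]
    push_cast
    ring
  have hXm : ∀ᶠ n in atTop, Measurable (X n) := by
    filter_upwards [hXx, eventually_ge_atTop k] with n h1 hn
    rw [h1]
    exact measurable_pi_lambda _ fun i =>
      (measurable_from_top (f := x n i)).comp ((hv n hn).measurable i)
  have key := tendsto_integral_of_tendsto_integral_cexp (k := k)
    (Q := fun n => (cond P (E n)).map (X n))
    (Q₀ := Measure.pi fun _ : Fin k => gaussianReal 0 1) ?_ ?_ f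
  · refine key.congr' ?_
    filter_upwards [hXm] with n hn
    exact integral_map hn.aemeasurable f.continuous.aestronglyMeasurable
  · filter_upwards [hXm, hpos] with n h1 h2
    have := cond_isProbabilityMeasure h2.ne'
    exact Measure.isProbabilityMeasure_map h1.aemeasurable
  · intro u
    rw [integral_cexp_pi_gaussianReal]
    -- The conditional characteristic function is the quotient of the limits at `u` and at zero; the
    -- product of masses cancels.
    have h := (hmass.inv₀ one_ne_zero).mul (hlim u)
    rw [inv_one, one_mul] at h
    refine h.congr' ?_
    filter_upwards [hXm, hXx, hpos, eventually_ge_atTop k] with n h1 h2 h3 hn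
    rw [integral_map h1.aemeasurable (Continuous.aestronglyMeasurable (by fun_prop)), h2,
      ProbabilityTheory.cond, integral_smul_measure]
    have h4 := WRT.setIntegral_degreeEvent hT hn (hv n hn) (fun i => d i n)
      (fun b => Complex.exp (Complex.I * (∑ i, u i * x n i (b i) : ℝ)))
    simp only at h4
    rw [h4, ENNReal.toReal_inv, Finset.smul_sum, Finset.mul_sum]
    refine Finset.sum_congr rfl fun a _ => ?_
    have h5 : Complex.exp (Complex.I * (∑ i, u i * x n i (a i) : ℝ))
        = ∏ i, Complex.exp (Complex.I * (u i * x n i (a i) : ℝ)) := by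
      rw [← Complex.exp_sum, ← Finset.mul_sum]
      push_cast
      rfl
    rw [h5]
    have hPE : (P.real (E n) : ℂ) ≠ 0 := by
      have := (ENNReal.toReal_pos h3.ne' (measure_ne_top P _)).ne'
      exact_mod_cast this
    have hMn : ((∏ i, mixedMass ν μ (D i n) : ℝ) : ℂ) ≠ 0 := by exact_mod_cast (hM n).ne'
    rw [← measureReal_def, Complex.real_smul, Complex.real_smul, Complex.ofReal_mul,
      Complex.ofReal_mul, Complex.ofReal_inv, Complex.ofReal_inv, mul_inv, inv_inv]
    generalize ((∏ i, mixedMass ν μ (D i n) : ℝ) : ℂ) = m at hMn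
    change m * _ * (m⁻¹ * _ * ∏ i, Complex.exp (Complex.I * (u i * x n i (a i) : ℝ))) = _
    generalize ∏ i, Complex.exp (Complex.I * (u i * x n i (a i) : ℝ)) = e
    field_simp
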